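/- **Theorem (Solution to the Neumann BVP).** Let $\tau\in\mathbb C$ with $b=\operatorname{Im}\tau>0$, $\Lambda_\tau=\mathbb Z+\mathbb Z\tau$, and let $\mathbb T_\tau=\mathbb C/\Lambda_\tau$. Let $D_1,\dots,D_M\subset\mathbb C$ be bounded, open, simply connected sets such that the closures of the $D_j$ embed injectively in $\mathbb T_\tau$ with pairwise disjoint images, and such that each $\partial D_j$ is a regular simple closed curve of class $C^2$. Put $D=\bigcup_j D_j$, $\Omega=\mathbb T_\tau\setminus\overline D$, so that $\partial\Omega=\bigcup_j\partial D_j$, and let $\nu(z)$ be the unit normal at $z\in\partial\Omega$ pointing into $D$. Write $x\circ y=\operatorname{Re}(x\overline y)$, let $|d\xi|$ denote arc length, and let $C_0(\partial\Omega)$ be the space of continuous functions $g:\partial\Omega\to\mathbb R$ with $\int_{\partial\Omega}g\,|d\xi|=0$. Let $$\vartheta_1(z)=-i\sum_{n\in\mathbb Z}(-1)^n q^{(n+1/2)^2}e^{(2n+1)\pi i z},\quad q=e^{\pi i\tau},\qquad G(z)=-\frac1{2\pi}\log|\vartheta_1(z)|+\frac1{2b}(\operatorname{Im}z)^2,$$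 and, for $\phi\in C(\partial\Omega)$, $$\mathcal S[\phi](z)=\int_{\partial\Omega}G(z-\xi)\phi(\xi)\,|d\xi|,\qquad \mathrm K^*[\phi](z_0)=\mathrm{p.v.}\!\int_{\partial\Omega}\nu(z_0)\circ\nabla G(z_0-\xi)\,\phi(\xi)\,|d\xi|\quad(z_0\in\partial\Omega).$$ For a function $u$ on $\Omega$ and $z_0\in\partial\Omega$, the normal derivative $\partial_\nu u(z_0)$ is the nontangential limit of $\nu(z_0)\circ\nabla u(z)$ as $\Omega\ni z\to z_0$, that is, the limit within $\{z\in\Omega:|z-z_0|\le\alpha\,\operatorname{dist}(z,\partial\Omega)\}$ for every $\alpha$. A solution of the Neumann problem with data $g$ is a (doubly periodic) function $u$, continuous on $\overline\Omega$, with $\Delta u=0$ in $\Omega$ and $\partial_\nu u=g$ on $\partial\Omega$. The flux of $u$ across $\partial D_j$ is $\int_{\partial D_j}\partial_\nu u\,|d\xi|$. Let $g\in C_0(\partial\Omega)$. The principal values defining $\mathrm K^*[\phi]$ exist for all $\phi\in C(\partial\Omega)$, and there is a unique $\phi\in C_0(\partial\Omega)$ with $$\tfrac12\phi(z_0)+\mathrm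 K^*[\phi](z_0)=g(z_0),\qquad z_0\in\partial\Omega .$$ For this $\phi$ and every $C\in\mathbb R$, the function $u=\mathcal S[\phi]+C$ solves the Neumann problem with data $g$, and for $j=1,\dots,M$ the flux of $u$ across $\partial D_j$ equals $\int_{\partial D_j}\phi\,|d\xi|=\int_{\partial D_j}g\,|d\xi|$. -/

import Mathlib

open Set Filter Topology Complex

noncomputable section

/-- The lattice point `m + n τ` of `Λ_τ = ℤ + ℤ τ`. -/
def latticePoint (τ : ℂ) (m n : ℤ) : ℂ := (m : ℂ) + (n : ℂ) * τ

/-- The Jacobi theta function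
`ϑ₁(z) = -i ∑_{n ∈ ℤ} (-1)^n q^{(n+1/2)^2} e^{(2n+1) π i z}`, with nome `q = e^{π i τ}`. -/
def jacobiThetaOne (τ z : ℂ) : ℂ :=
  -I * ∑' n : ℤ, (-1 : ℂ) ^ n * exp (Real.pi * I * τ * ((n : ℂ) + 1 / 2) ^ 2) *
    exp ((2 * (n : ℂ) + 1) * Real.pi * I * z)

/-- The doubly periodic Green's function
`G(z) = -(1/2π) log |ϑ₁(z)| + (Im z)^2 / (2b)` of the torus `ℂ / Λ_τ`, where `b = Im τ`. -/
def torusGreen (τ z : ℂ) : ℝ :=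
  -(1 / (2 * Real.pi)) * Real.log ‖jacobiThetaOne τ z‖ + 1 / (2 * τ.im) * z.im ^ 2

/-- A finitely connected torus: `M` holes `D j` in `ℂ / Λ_τ`, each of them given by a representative
in `ℂ`, together with `C²` parametrizations (of period one) of their boundary curves.  -/
structure FinitelyConnectedTorus (τ : ℂ) (M : ℕ) where
  /-- the holes -/
  D : Fin M → Set ℂ
  /-- regular `C²` parametrizations of the boundary curves of the holes -/
  γ : Fin M → ℝ → ℂ
  isOpen_D : ∀ j, IsOpen (D j)
  isBounded_D : ∀ j, Bornology.IsBounded (D j)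
  simplyConnected_D : ∀ j, IsSimplyConnected (D j)
  /-- Distinct holes have disjoint closures in the torus, and the closure of each hole is mapped
  injectively into the torus. -/
  disjoint_closure : ∀ i j : Fin M, ∀ m n : ℤ, ∀ z ∈ closure (D i),
    z + latticePoint τ m n ∈ closure (D j) → i = j ∧ m = 0 ∧ n = 0
  contDiff_γ : ∀ j, ContDiff ℝ 2 (γ j)
  periodic_γ : ∀ j, Function.Periodic (γ j) 1
  injOn_γ : ∀ j, InjOn (γ j) (Ico 0 1)
  deriv_γ_ne_zero : ∀ j t, deriv (γ j) t ≠ 0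
  range_γ : ∀ j, range (γ j) = frontier (D j)
  /-- The curves are positively oriented with respect to the complement of the holes: the normal
  `-i γ'(t)` to the right of the curve points into the hole. -/
  orientation : ∀ j t, ∀ᶠ s : ℝ in 𝓝[>] 0, γ j t + (s : ℂ) * (-I * deriv (γ j) t) ∈ D j

namespace FinitelyConnectedTorus

variable {τ : ℂ} {M : ℕ} (H : FinitelyConnectedTorus τ M)

/-- The domain `Ω = 𝕋_τ \ closure D`, as a doubly periodic subset of `ℂ`. -/
def domain : Set ℂ :=
  {z | ∀ (j : Fin M) (m n : ℤ), z + latticePoint τ m n ∉ closure (H.D j)}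

/-- The boundary `∂Ω = ∂D`, the union of the curves `∂D j`; each of its points is represented by the
point of `ℂ` that lies on the chosen representatives of the holes. -/
def boundary : Set ℂ := ⋃ j, frontier (H.D j)

/-- The point `γ j t` of the boundary. -/
def bdryPoint (j : Fin M) (t : ℝ) : H.boundary :=
  ⟨H.γ j t, mem_iUnion.2 ⟨j, H.range_γ j ▸ mem_range_self t⟩⟩

theorem exists_bdryPoint_eq (z : H.boundary) :
    ∃ p : Fin M × ℝ, H.bdryPoint p.1 p.2 = z := by
  obtain ⟨z, hz⟩ := z
  obtain ⟨j, hj⟩ := mem_iUnion.1 hz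
  rw [← H.range_γ j] at hj
  obtain ⟨t, rfl⟩ := hj
  exact ⟨(j, t), rfl⟩

/-- The unit normal vector `ν(z)` at `z ∈ ∂Ω` pointing into the hole (out of `Ω`):
`ν(γ j t) = -i (γ j)'(t) / |(γ j)'(t)|`, see `normal_bdryPoint`. -/
def normal (z : H.boundary) : ℂ :=
  -I * deriv (H.γ (H.exists_bdryPoint_eq z).choose.1) (H.exists_bdryPoint_eq z).choose.2 /
    (‖deriv (H.γ (H.exists_bdryPoint_eq z).choose.1) (H.exists_bdryPoint_eq z).choose.2‖ : ℂ)

theorem normal_bdryPoint (j : Fin M) (t : ℝ) :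
    H.normal (H.bdryPoint j t) = -I * deriv (H.γ j) t / (‖deriv (H.γ j) t‖ : ℂ) := by
  have key : ∀ p : Fin M × ℝ, H.bdryPoint p.1 p.2 = H.bdryPoint j t →
      deriv (H.γ p.1) p.2 = deriv (H.γ j) t := by
    rintro ⟨k, s⟩ h
    have h' : H.γ k s = H.γ j t := congrArg Subtype.val h
    have hk : H.γ k s ∈ closure (H.D k) :=
      frontier_subset_closure (H.range_γ k ▸ mem_range_self s)
    have hj : H.γ j t ∈ closure (H.D j) :=
      frontier_subset_closure (H.range_γ j ▸ mem_range_self t)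
    have hkj : k = j := (H.disjoint_closure k j 0 0 _ hk (by simpa [latticePoint, h'] using hj)).1
    subst hkj
    have hfr : ∀ r : ℝ, H.γ k (Int.fract r) = H.γ k r := fun r => by
      rw [← Int.self_sub_floor, ← zsmul_one]
      exact (H.periodic_γ k).sub_zsmul_eq ⌊r⌋
    have hd : ∀ r : ℝ, deriv (H.γ k) (Int.fract r) = deriv (H.γ k) r := fun r => by
      have hper : Function.Periodic (deriv (H.γ k)) 1 := fun x => by
        rw [← deriv_comp_add_const]
        exact congrArg (fun f => deriv f x) (funext (H.periodic_γ k))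
      rw [← Int.self_sub_floor, ← zsmul_one]
      exact hper.sub_zsmul_eq ⌊r⌋
    have hst : Int.fract s = Int.fract t :=
      H.injOn_γ k ⟨Int.fract_nonneg s, Int.fract_lt_one s⟩ ⟨Int.fract_nonneg t, Int.fract_lt_one t⟩
        (by rw [hfr, hfr, h'])
    show deriv (H.γ k) s = deriv (H.γ k) t
    rw [← hd s, ← hd t, hst]
  unfold normal
  rw [key _ (H.exists_bdryPoint_eq (H.bdryPoint j t)).choose_spec]

/-- The arc length integral `∫_{∂D j} f(ξ) |dξ|`. -/
def holeIntegral (j : Fin M) (f : H.boundary → ℝ) : ℝ :=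
  ∫ t in (0 : ℝ)..1, f (H.bdryPoint j t) * ‖deriv (H.γ j) t‖

/-- The arc length integral `∫_{∂Ω} f(ξ) |dξ|`. -/
def bdryIntegral (f : H.boundary → ℝ) : ℝ := ∑ j, H.holeIntegral j f

/-- The single layer potential `𝒮[φ](z) = ∫_{∂Ω} G(z - ξ) φ(ξ) |dξ|`. -/
def singleLayer (φ : H.boundary → ℝ) (z : ℂ) : ℝ :=
  H.bdryIntegral fun ξ => torusGreen τ (z - ξ) * φ ξ

open Classical in
/-- `∫_{ξ ∈ ∂Ω, |ξ - z₀| > ε} ∂_{ν_z} G(z₀ - ξ) φ(ξ) |dξ|`, the normal derivative being the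
derivative of `z ↦ G(z - ξ)` at `z₀` in the direction `ν(z₀)`. -/
def truncatedAdjoint (φ : H.boundary → ℝ) (z₀ : H.boundary) (ε : ℝ) : ℝ :=
  H.bdryIntegral fun ξ =>
    if ε < ‖(ξ : ℂ) - z₀‖ then
      fderiv ℝ (fun z : ℂ => torusGreen τ (z - ξ)) z₀ (H.normal z₀) * φ ξ
    else 0

/-- The boundary operator
`K*[φ](z₀) = p.v. ∫_{∂Ω} ∂_{ν_z} G(z₀ - ξ) φ(ξ) |dξ|`, a Cauchy principal value. -/
def adjointDoubleLayer (φ : H.boundary → ℝ) (z₀ : H.boundary) : ℝ :=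
  limUnder (𝓝[>] (0 : ℝ)) (H.truncatedAdjoint φ z₀)

/-- Nontangential approach to `z₀ ∈ ∂Ω` from `Ω`: a function tends to a limit along this filter if
and only if, for every `α`, it tends to this limit as `z → z₀` within the approach region
`{z ∈ Ω : |z - z₀| ≤ α dist(z, ∂Ω)}`. -/
def nontangential (z₀ : H.boundary) : Filter ℂ :=
  ⨆ α : ℝ, 𝓝[{z | z ∈ H.domain ∧ ‖z - z₀‖ ≤ α * Metric.infDist z H.boundary}] (z₀ : ℂ)

/-- `∂_ν u = h` at `z₀ ∈ ∂Ω`, from the side of `Ω`: the derivative `ν(z₀) ∘ ∇u(z)` tends to `h` as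
`z → z₀` nontangentially in `Ω`. -/
def HasNormalDeriv (u : ℂ → ℝ) (h : ℝ) (z₀ : H.boundary) : Prop :=
  Tendsto (fun z => fderiv ℝ u z (H.normal z₀)) (H.nontangential z₀) (𝓝 h)

/-- The normal derivative `∂_ν u(z₀)` from the side of `Ω`. -/
def normalDeriv (u : ℂ → ℝ) (z₀ : H.boundary) : ℝ :=
  limUnder (H.nontangential z₀) fun z => fderiv ℝ u z (H.normal z₀)

/-- The flux `∫_{∂D j} ∂_ν u |dξ|` of `u` across `∂D j`. -/
def flux (u : ℂ → ℝ) (j : Fin M) : ℝ := H.holeIntegral j (H.normalDeriv u)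

/-- `u` solves the Neumann problem `Δu = 0` in `Ω`, `∂_ν u = g` on `∂Ω` on the torus: it is doubly
periodic, harmonic in `Ω`, continuous up to the boundary, and has the normal derivative `g`. -/
structure IsNeumannSolution (g : H.boundary → ℝ) (u : ℂ → ℝ) : Prop where
  periodic : ∀ (z : ℂ) (m n : ℤ), u (z + latticePoint τ m n) = u z
  harmonic : InnerProductSpace.HarmonicOnNhd u H.domain
  continuousOn : ContinuousOn u (closure H.domain)
  normalDeriv_eq : ∀ z₀ : H.boundary, H.HasNormalDeriv u (g z₀) z₀

/-- `φ` is a zero mean solution of the boundary integral equation `½ φ + K*[φ] = g` on `∂Ω`. -/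
structure IsDensity (g φ : H.boundary → ℝ) : Prop where
  mean_zero : H.bdryIntegral φ = 0
  equation : ∀ z₀ : H.boundary, 1 / 2 * φ z₀ + H.adjointDoubleLayer φ z₀ = g z₀

end FinitelyConnectedTorus

end

/-! The proof is classical potential theory on the torus, resting on a Fredholm argument.

The function ϑ₁ has simple zeros exactly at the lattice points (`jacobiThetaOne_eq_zero_iff`,
`deriv_jacobiThetaOne_zero_ne_zero`). Hence near the origin G is -(1/2π) log|w| plus a smooth term,
and its complex gradient 2∂G is -(1/2π)/w plus a continuous term. For a density of mean zero, the
only part of the gradient of 𝒮[φ] that is not holomorphic in z is a multiple of ∫φ, which vanishes.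
Thus 𝒮[φ] is harmonic off the curves, is doubly periodic, and is continuous everywhere because the
logarithmic singularity is integrable.

Since the curves are C², the normal component of ξ - z is O(|ξ - z|²) for boundary points
(`exists_normal_le`). So the kernel of K* is bounded, the principal value is an ordinary integral,
and K* is compact on continuous functions by Arzelà–Ascoli (`isCompactOperator_adjointOp`).
Comparing the curve with its tangent line, on which the singular kernel is exactly a Poisson kernel,
gives the jump relations: the normal derivative of 𝒮[φ] is ½φ + K*φ from Ω and -½φ + K*φ from the
holes (`tendsto_layerGrad`).

Inside the simply connected hole D_j, the function ϑ₁(z - ξ) has no zeros, so the gradient of 𝒮[φ]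
has no periods along closed curves in D_j. Letting such curves tend to ∂D_j shows that -½φ + K*φ has
integral zero over ∂D_j (`holeIntegral_adjointDoubleLayer`). Therefore the integral of K*φ over ∂D_j
is half that of φ. This makes the space of mean zero densities invariant under K* and yields the
statement about fluxes.

It remains to see that -½ is not an eigenvalue on that space
(`eq_zero_of_half_add_adjointDoubleLayer`). If ½φ + K*φ = 0, then 𝒮[φ] has zero normal derivative
from Ω. By the maximum principle and the Hopf lemma it is locally constant in Ω
(`eventually_eq_of_tendsto_layerGrad`), so by continuity it is constant on each ∂D_j, and then in
each D_j. The inner normal derivative -½φ + K*φ is therefore zero as well, and the difference of the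
two relations is φ = 0. The Fredholm alternative then solves the integral equation, and the outer
jump relation identifies the normal derivative with g. -/

open Metric MeasureTheory

/-! ### The q-Pochhammer product and quotients of entire functions -/

/-- The entire function `∏ (1 - Q ^ n x)`. -/
noncomputable def qPochhammer (Q x : ℂ) : ℂ := ∏' n : ℕ, (1 + -(Q ^ n * x))

theorem summable_norm_pow_mul {Q : ℂ} (hQ : ‖Q‖ < 1) (x : ℂ) :
    Summable fun n : ℕ => ‖-(Q ^ n * x)‖ := by
  simpa using (summable_geometric_of_lt_one (norm_nonneg Q) hQ).mul_right ‖x‖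

theorem differentiable_qPochhammer {Q : ℂ} (hQ : ‖Q‖ < 1) : Differentiable ℂ (qPochhammer Q) := by
  intro x
  have h := Summable.hasProdLocallyUniformlyOn_nat_one_add
    (f := fun (n : ℕ) (x : ℂ) => -(Q ^ n * x)) (K := Metric.ball 0 (‖x‖ + 1)) Metric.isOpen_ball
    (u := fun n => ‖Q‖ ^ n * (‖x‖ + 1))
    ((summable_geometric_of_lt_one (norm_nonneg Q) hQ).mul_right _)
    (.of_forall fun n y hy => by
      have : ‖y‖ ≤ ‖x‖ + 1 := by simpa using (Metric.mem_ball.1 hy).le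
      simpa using mul_le_mul_of_nonneg_left this (by positivity)) (fun n => by fun_prop)
  have h' := h.differentiableOn (.of_forall fun s => by
    simpa [Finset.prod_fn] using DifferentiableOn.finsetProd (fun _ _ => by fun_prop))
    Metric.isOpen_ball
  exact h'.differentiableAt (Metric.isOpen_ball.mem_nhds (by simp))

/-- Splitting off the factor with `n = 0`. This functional equation is the source of the
quasi-periodicity of `thetaProduct` in τ and isolates its zero at the origin. -/
theorem qPochhammer_eq {Q : ℂ} (hQ : ‖Q‖ < 1) (x : ℂ) :
    qPochhammer Q x = (1 - x) * qPochhammer Q (Q * x) := by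
  unfold qPochhammer
  have e : ∀ n : ℕ, Q ^ n * (Q * x) = Q ^ (n + 1) * x := fun n => by ring
  simp_rw [e]
  rw [tprod_eq_zero_mul']
  · simp [sub_eq_add_neg]
  · simp_rw [← e]
    exact multipliable_one_add_of_summable (summable_norm_pow_mul hQ _)

theorem qPochhammer_ne_zero {Q : ℂ} (hQ : ‖Q‖ < 1) {x : ℂ} (hx : ∀ n : ℕ, Q ^ n * x ≠ 1) :
    qPochhammer Q x ≠ 0 :=
  tprod_one_add_ne_zero_of_summable
    (fun n h => hx n (by linear_combination -h)) (summable_norm_pow_mul hQ x)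

theorem AnalyticOnNhd.eq_of_mul_eq_mul {f g h : ℂ → ℂ} (hf : Differentiable ℂ f)
    (hg : Differentiable ℂ g) (hh : Differentiable ℂ h) {z₀ : ℂ} (h0 : h z₀ ≠ 0)
    (H : ∀ z, f z * h z = g z * h z) : f = g := by
  rcases AnalyticOnNhd.eq_zero_or_eq_zero_of_mul_eq_zero (U := univ) (f := f - g) (g := h)
    ((hf.sub hg).differentiableOn.analyticOnNhd isOpen_univ)
    (hh.differentiableOn.analyticOnNhd isOpen_univ)
    (fun z _ => by simp [sub_mul, H z]) isPreconnected_univ with h1 | h1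
  · exact funext fun z => sub_eq_zero.1 (h1 z trivial)
  · exact absurd (h1 z₀ trivial) h0

theorem differentiable_dslope {f : ℂ → ℂ} (hf : Differentiable ℂ f) (c : ℂ) :
    Differentiable ℂ (dslope f c) :=
  differentiableOn_univ.1 ((Complex.differentiableOn_dslope univ_mem).2 hf.differentiableOn)

/-- The zeros of g are simple and shared by f, so the singularities of f / g are removable: near a
zero z both functions are w - z times their `dslope`, and that of g does not vanish at z. -/
theorem exists_entire_quotient {f g : ℂ → ℂ} (hf : Differentiable ℂ f) (hg : Differentiable ℂ g)
    (hfg : ∀ z, g z = 0 → f z = 0 ∧ deriv g z ≠ 0) :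
    ∃ R : ℂ → ℂ, Differentiable ℂ R ∧ ∀ z, f z = R z * g z := by
  classical
  refine ⟨fun z => if g z = 0 then deriv f z / deriv g z else f z / g z, fun z => ?_, fun z => ?_⟩
  · by_cases hz : g z = 0
    · obtain ⟨h1, h2⟩ := hfg z hz
      have hB : dslope g z z ≠ 0 := by simpa using h2
      have hd : DifferentiableAt ℂ (fun w => dslope f z w / dslope g z w) z :=
        (differentiable_dslope hf z z).div (differentiable_dslope hg z z) hB
      refine hd.congr_of_eventuallyEq ?_
      filter_upwards [(differentiable_dslope hg z z).continuousAt.eventually_ne hB] with w hw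
      by_cases hwz : w = z
      · subst hwz
        simp [hz]
      · have e1 : f w = (w - z) * dslope f z w := by
          simpa [h1] using (sub_smul_dslope f z w).symm
        have e2 : g w = (w - z) * dslope g z w := by
          simpa [hz] using (sub_smul_dslope g z w).symm
        have hne : w - z ≠ 0 := sub_ne_zero.2 hwz
        rw [if_neg (by rw [e2]; exact mul_ne_zero hne hw), e1, e2]
        field_simp
    · refine ((hf z).div (hg z) hz).congr_of_eventuallyEq ?_
      filter_upwards [(hg z).continuousAt.eventually_ne hz] with w hw
      simp [hw]
  · by_cases hz : g z = 0
    · simp [hz, (hfg z hz).1]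
    · simp [hz]

/-! ### The zeros of ϑ₁ through the Jacobi triple product -/

section Theta

variable {τ : ℂ}

theorem latticePoint_zero (τ : ℂ) : latticePoint τ 0 0 = 0 := by simp [latticePoint]

theorem latticePoint_neg (τ : ℂ) (m n : ℤ) : latticePoint τ (-m) (-n) = -latticePoint τ m n := by
  simp only [latticePoint]; push_cast; ring

theorem latticePoint_add (τ : ℂ) (m n m' n' : ℤ) :
    latticePoint τ (m + m') (n + n') = latticePoint τ m n + latticePoint τ m' n' := by
  simp only [latticePoint]; push_cast; ring

theorem apply_add_latticePoint {α : Type*} {f : ℂ → α} (h1 : ∀ z, f (z + 1) = f z)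
    (hτ : ∀ z, f (z + τ) = f z) (z : ℂ) (m n : ℤ) : f (z + latticePoint τ m n) = f z := by
  have p1 : Function.Periodic f 1 := h1
  have p2 : Function.Periodic f τ := hτ
  have e : z + latticePoint τ m n = z + m • (1 : ℂ) + n • τ := by
    simp [latticePoint, add_assoc]
  rw [e, p2.zsmul n, p1.zsmul m]

/-- Writing (-1)^n as e^{πin} and expanding (n + 1/2)² turns the series into that of `jacobiTheta₂`
at a shifted argument, whose convergence and transformation laws are then inherited. -/
theorem jacobiThetaOne_eq (τ z : ℂ) : jacobiThetaOne τ z =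
    -I * exp (Real.pi * I * (τ / 4 + z)) * jacobiTheta₂ (z + τ / 2 + 1 / 2) τ := by
  rw [jacobiThetaOne, jacobiTheta₂, ← tsum_mul_left, ← tsum_mul_left]
  refine tsum_congr fun n => ?_
  have h : ((-1 : ℂ)) ^ n = exp (Real.pi * I * n) := by
    rw [← Complex.exp_pi_mul_I, ← Complex.exp_int_mul, mul_comm]
  rw [jacobiTheta₂_term, h, mul_assoc (-I), ← exp_add, ← exp_add, ← exp_add]
  congr 2
  ring

theorem differentiable_jacobiThetaOne (hτ : 0 < τ.im) : Differentiable ℂ (jacobiThetaOne τ) := by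
  have e : jacobiThetaOne τ = fun z =>
      -I * exp (Real.pi * I * (τ / 4 + z)) * jacobiTheta₂ (z + τ / 2 + 1 / 2) τ :=
    funext (jacobiThetaOne_eq τ)
  rw [e]
  intro z
  have h := (differentiableAt_jacobiTheta₂_fst (z + τ / 2 + 1 / 2) hτ).comp z
    (f := fun z => z + τ / 2 + 1 / 2) (by fun_prop)
  exact DifferentiableAt.mul (by fun_prop) h

theorem jacobiThetaOne_add_one (τ z : ℂ) : jacobiThetaOne τ (z + 1) = -jacobiThetaOne τ z := by
  rw [jacobiThetaOne_eq, jacobiThetaOne_eq]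
  have e1 : z + 1 + τ / 2 + 1 / 2 = z + τ / 2 + 1 / 2 + 1 := by ring
  have e2 : Real.pi * I * (τ / 4 + (z + 1)) = Real.pi * I * (τ / 4 + z) + Real.pi * I := by ring
  rw [e1, jacobiTheta₂_add_left, e2, exp_add, exp_pi_mul_I]
  ring

theorem jacobiThetaOne_add_tau (τ z : ℂ) : jacobiThetaOne τ (z + τ) =
    -exp (-(Real.pi * I * (τ + 2 * z))) * jacobiThetaOne τ z := by
  rw [jacobiThetaOne_eq, jacobiThetaOne_eq]
  have e1 : z + τ + τ / 2 + 1 / 2 = z + τ / 2 + 1 / 2 + τ := by ring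
  rw [e1, jacobiTheta₂_add_left']
  have e2 : exp (Real.pi * I * (τ / 4 + (z + τ))) *
      exp (-Real.pi * I * (τ + 2 * (z + τ / 2 + 1 / 2))) =
      -exp (-(Real.pi * I * (τ + 2 * z))) * exp (Real.pi * I * (τ / 4 + z)) := by
    rw [← exp_add, ← neg_one_mul (exp (-(_ * _))), ← exp_neg_pi_mul_I, ← exp_add, ← exp_add]
    congr 1
    ring
  linear_combination -I * jacobiTheta₂ (z + τ / 2 + 1 / 2) τ * e2

/-- At w = (τ + 1)/2, quasi-periodicity gives θ₂(w) = -θ₂(-w), while θ₂ is even. -/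
theorem jacobiThetaOne_zero (τ : ℂ) : jacobiThetaOne τ 0 = 0 := by
  have h1 := jacobiTheta₂_add_left' (-((τ + 1) / 2)) τ
  have h2 : jacobiTheta₂ (-((τ + 1) / 2) + τ) τ = jacobiTheta₂ ((τ + 1) / 2) τ := by
    rw [← jacobiTheta₂_add_left]
    congr 1
    ring
  rw [h2, jacobiTheta₂_neg_left] at h1
  have e : -Real.pi * I * (τ + 2 * -((τ + 1) / 2)) = Real.pi * I := by ring
  rw [e, exp_pi_mul_I] at h1
  have h3 : jacobiTheta₂ (0 + τ / 2 + 1 / 2) τ = 0 := by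
    have : (0 + τ / 2 + 1 / 2 : ℂ) = (τ + 1) / 2 := by ring
    rw [this]
    linear_combination h1 / 2
  rw [jacobiThetaOne_eq, h3, mul_zero]

/-- The zeroth Fourier coefficient. Its only purpose is to show that theta does not vanish
identically. -/
theorem integral_jacobiTheta₂ (hτ : 0 < τ.im) :
    ∫ x in (0 : ℝ)..1, jacobiTheta₂ x τ = 1 := by
  have hs : Summable fun n : ℤ => ‖jacobiTheta₂_term n 0 τ‖ :=
    ((summable_jacobiTheta₂_term_iff 0 τ).2 hτ).norm
  have hc : ∀ n : ℤ, Continuous fun x : ℝ => jacobiTheta₂_term n x τ := fun n => by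
    unfold jacobiTheta₂_term
    fun_prop
  have key := intervalIntegral.hasSum_integral_of_dominated_convergence
    (μ := MeasureTheory.volume) (a := (0 : ℝ)) (b := 1)
    (F := fun (n : ℤ) (x : ℝ) => jacobiTheta₂_term n x τ) (f := fun x : ℝ => jacobiTheta₂ x τ)
    (fun n _ => ‖jacobiTheta₂_term n 0 τ‖) (fun n => (hc n).aestronglyMeasurable)
    (fun n => .of_forall fun x _ => by
      rw [norm_jacobiTheta₂_term, norm_jacobiTheta₂_term]
      simp)
    (.of_forall fun x _ => hs) (by simp)
    (.of_forall fun x _ => hasSum_jacobiTheta₂_term x hτ)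
  refine key.unique ?_
  have hz : ∀ n : ℤ, n ≠ 0 → ∫ x in (0 : ℝ)..1, jacobiTheta₂_term n x τ = 0 := fun n hn => by
    have hc0 : (2 * Real.pi * I * n : ℂ) ≠ 0 := by
      simp [Real.pi_ne_zero, I_ne_zero, hn]
    simp only [jacobiTheta₂_term, exp_add]
    rw [intervalIntegral.integral_mul_const, integral_exp_mul_complex hc0]
    have : exp (2 * Real.pi * I * n * (1 : ℝ)) = 1 := by
      rw [exp_eq_one_iff]
      exact ⟨n, by push_cast; ring⟩
    rw [this]
    simp
  have h1 : ∫ x in (0 : ℝ)..1, jacobiTheta₂_term 0 x τ = 1 := by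
    simp [jacobiTheta₂_term]
  rw [← h1]
  exact hasSum_single 0 hz

theorem exists_jacobiThetaOne_ne_zero (hτ : 0 < τ.im) : ∃ z, jacobiThetaOne τ z ≠ 0 := by
  by_contra! h
  have h0 : ∀ w, jacobiTheta₂ w τ = 0 := fun w => by
    have := h (w - τ / 2 - 1 / 2)
    rw [jacobiThetaOne_eq] at this
    have e : w - τ / 2 - 1 / 2 + τ / 2 + 1 / 2 = w := by ring
    rw [e] at this
    simpa [I_ne_zero, exp_ne_zero] using this
  have := integral_jacobiTheta₂ hτ
  simp [h0] at this

/-- The product side of the Jacobi triple product identity for `ϑ₁`, up to a constant. -/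
noncomputable def thetaProduct (τ z : ℂ) : ℂ :=
  exp (-(Real.pi * I * z)) * qPochhammer (exp (2 * Real.pi * I * τ)) (exp (2 * Real.pi * I * z)) *
    qPochhammer (exp (2 * Real.pi * I * τ))
      (exp (2 * Real.pi * I * τ) * exp (-(2 * Real.pi * I * z)))

theorem norm_exp_two_pi_I_mul_lt_one (hτ : 0 < τ.im) : ‖exp (2 * Real.pi * I * τ)‖ < 1 := by
  rw [norm_exp, Real.exp_lt_one_iff]
  have := mul_pos Real.two_pi_pos hτ
  simpa using this

theorem differentiable_thetaProduct (hτ : 0 < τ.im) : Differentiable ℂ (thetaProduct τ) := by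
  have h := differentiable_qPochhammer (norm_exp_two_pi_I_mul_lt_one hτ)
  unfold thetaProduct
  exact ((Differentiable.cexp (by fun_prop)).mul (h.comp (by fun_prop))).mul (h.comp (by fun_prop))

theorem thetaProduct_add_one (τ z : ℂ) : thetaProduct τ (z + 1) = -thetaProduct τ z := by
  have e1 : exp (2 * Real.pi * I * (z + 1)) = exp (2 * Real.pi * I * z) := by
    rw [mul_add, exp_add, mul_one, exp_two_pi_mul_I, mul_one]
  have e2 : exp (-(2 * Real.pi * I * (z + 1))) = exp (-(2 * Real.pi * I * z)) := by
    rw [exp_neg, exp_neg, e1]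
  have e3 : exp (-(Real.pi * I * (z + 1))) = -exp (-(Real.pi * I * z)) := by
    rw [mul_add, neg_add, exp_add, mul_one, exp_neg (Real.pi * I), exp_pi_mul_I]
    ring
  rw [thetaProduct, e1, e2, e3, thetaProduct]
  ring

theorem thetaProduct_add_tau (hτ : 0 < τ.im) (z : ℂ) : thetaProduct τ (z + τ) =
    -exp (-(Real.pi * I * (τ + 2 * z))) * thetaProduct τ z := by
  have hQ := norm_exp_two_pi_I_mul_lt_one hτ
  have hQ0 := exp_ne_zero (2 * Real.pi * I * τ)
  have hX0 := exp_ne_zero (2 * Real.pi * I * z)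
  have e1 : exp (2 * Real.pi * I * (z + τ)) =
      exp (2 * Real.pi * I * τ) * exp (2 * Real.pi * I * z) := by
    rw [← exp_add]; ring_nf
  have e3 : exp (-(Real.pi * I * (z + τ))) =
      exp (-(Real.pi * I * z)) * exp (-(Real.pi * I * τ)) := by
    rw [← exp_add]; ring_nf
  have e4 : exp (-(Real.pi * I * (τ + 2 * z))) =
      exp (-(Real.pi * I * τ)) * (exp (2 * Real.pi * I * z))⁻¹ := by
    rw [← exp_neg, ← exp_add]; ring_nf
  rw [thetaProduct, thetaProduct, exp_neg (2 * Real.pi * I * (z + τ)), e1, e3, e4,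
    exp_neg (2 * Real.pi * I * z)]
  generalize exp (2 * Real.pi * I * τ) = Q at *
  generalize exp (2 * Real.pi * I * z) = X at *
  have e5 : Q * (Q * X)⁻¹ = X⁻¹ := by field_simp
  have e6 : (1 - X⁻¹) = -X⁻¹ * (1 - X) := by field_simp; ring
  rw [e5, qPochhammer_eq hQ X⁻¹, qPochhammer_eq hQ X, e6]
  ring

theorem exists_latticePoint_of_exp_eq {z : ℂ} {n : ℤ}
    (h : exp (2 * Real.pi * I * (z - n * τ)) = 1) : ∃ m n : ℤ, z = latticePoint τ m n := by
  obtain ⟨m, hm⟩ := exp_eq_one_iff.1 h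
  refine ⟨m, n, ?_⟩
  have := mul_left_cancel₀ two_pi_I_ne_zero (hm.trans (mul_comm _ _))
  rw [latticePoint]
  linear_combination this

theorem exists_latticePoint_of_thetaProduct_eq_zero (hτ : 0 < τ.im) {z : ℂ}
    (h : thetaProduct τ z = 0) : ∃ m n : ℤ, z = latticePoint τ m n := by
  have hQ := norm_exp_two_pi_I_mul_lt_one hτ
  by_contra hz
  have aux : ∀ n : ℤ, exp (2 * Real.pi * I * (z - n * τ)) ≠ 1 := fun n h =>
    hz (exists_latticePoint_of_exp_eq h)
  refine absurd h (mul_ne_zero (mul_ne_zero (exp_ne_zero _) (qPochhammer_ne_zero hQ fun n hn => ?_))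
    (qPochhammer_ne_zero hQ fun n hn => ?_))
  -- The first product vanishes on the lattice rows -n ≤ 0, the second on the rows n + 1 ≥ 1.
  · refine aux (-n) ?_
    rw [← hn, ← exp_nat_mul, ← exp_add]
    push_cast
    ring_nf
  · refine aux (n + 1) ?_
    rw [← inv_inj, inv_one, ← hn, ← exp_nat_mul, ← exp_add, ← exp_add, ← exp_neg]
    push_cast
    ring_nf

theorem thetaProduct_zero (hτ : 0 < τ.im) : thetaProduct τ 0 = 0 := by
  have h1 : qPochhammer (exp (2 * Real.pi * I * τ)) 1 = 0 := by
    rw [qPochhammer_eq (norm_exp_two_pi_I_mul_lt_one hτ)]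
    simp
  simp [thetaProduct, h1]

/-- The zero comes from the single factor 1 - e^{2πiz}. The cofactor has the value `qPochhammer Q Q`
squared at the origin, which is nonzero because |Q^n Q| < 1. -/
theorem deriv_thetaProduct_zero_ne_zero (hτ : 0 < τ.im) : deriv (thetaProduct τ) 0 ≠ 0 := by
  have hQ := norm_exp_two_pi_I_mul_lt_one hτ
  have hp := differentiable_qPochhammer hQ
  set Q := exp (2 * Real.pi * I * τ) with hQdef
  set g : ℂ → ℂ := fun z => exp (-(Real.pi * I * z)) * qPochhammer Q (Q * exp (2 * Real.pi * I * z)) *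
    qPochhammer Q (Q * exp (-(2 * Real.pi * I * z))) with hg
  have hgd : Differentiable ℂ g :=
    ((Differentiable.cexp (by fun_prop)).mul (hp.comp (by fun_prop))).mul (hp.comp (by fun_prop))
  have e : thetaProduct τ = fun z => (1 - exp (2 * Real.pi * I * z)) * g z := by
    funext z
    rw [thetaProduct, ← hQdef, qPochhammer_eq hQ (exp (2 * Real.pi * I * z)), hg]
    ring
  have hd : HasDerivAt (fun z : ℂ => 1 - exp (2 * Real.pi * I * z)) (-(2 * Real.pi * I)) 0 := by
    have := (((hasDerivAt_id (0 : ℂ)).const_mul (2 * Real.pi * I)).cexp).const_sub 1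
    simpa using this
  rw [e, (hd.fun_mul (hgd 0).hasDerivAt).deriv]
  have hne : qPochhammer Q Q ≠ 0 := qPochhammer_ne_zero hQ fun n hn => by
    have h1 : ‖Q ^ n * Q‖ < 1 := by
      rw [norm_mul, norm_pow]
      exact (mul_le_of_le_one_left (norm_nonneg _) (pow_le_one₀ (norm_nonneg _) hQ.le)).trans_lt hQ
    rw [hn] at h1
    simp at h1
  have : g 0 = qPochhammer Q Q * qPochhammer Q Q := by simp [hg]
  simp [this, hne, Real.pi_ne_zero, I_ne_zero]

theorem thetaProduct_latticePoint (hτ : 0 < τ.im) (m n : ℤ) :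
    thetaProduct τ (latticePoint τ m n) = 0 ∧ deriv (thetaProduct τ) (latticePoint τ m n) ≠ 0 ∧
      jacobiThetaOne τ (latticePoint τ m n) = 0 := by
  have hP := differentiable_thetaProduct hτ
  -- The properties are carried along the lattice together: under z ↦ z + τ the derivative acquires
  -- the multiplier only at zeros of the product, so its nonvanishing cannot be moved alone.
  set S : ℂ → Prop := fun z =>
    thetaProduct τ z = 0 ∧ deriv (thetaProduct τ) z ≠ 0 ∧ jacobiThetaOne τ z = 0 with hS
  have s1 : ∀ z, S (z + 1) ↔ S z := fun z => by
    have hd : deriv (thetaProduct τ) (z + 1) = -deriv (thetaProduct τ) z := by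
      rw [← deriv_comp_add_const, funext (thetaProduct_add_one τ)]
      simp
    simp [hS, thetaProduct_add_one, jacobiThetaOne_add_one, hd]
  have s2 : ∀ z, S (z + τ) ↔ S z := fun z => by
    have h1 : thetaProduct τ (z + τ) = 0 ↔ thetaProduct τ z = 0 := by
      simp [thetaProduct_add_tau hτ, exp_ne_zero]
    have hd : thetaProduct τ z = 0 → deriv (thetaProduct τ) (z + τ) =
        -exp (-(Real.pi * I * (τ + 2 * z))) * deriv (thetaProduct τ) z := fun h0 => by
      rw [← deriv_comp_add_const, funext (thetaProduct_add_tau hτ)]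
      rw [deriv_fun_mul (by fun_prop) (hP z), h0]
      ring
    simp only [hS]
    rw [h1]
    refine and_congr_right fun h0 => ?_
    rw [hd h0]
    simp [jacobiThetaOne_add_tau, exp_ne_zero]
  have := apply_add_latticePoint (fun z => propext (s1 z)) (fun z => propext (s2 z)) 0 m n
  rw [zero_add] at this
  change S _
  rw [this]
  exact ⟨thetaProduct_zero hτ, deriv_thetaProduct_zero_ne_zero hτ, jacobiThetaOne_zero τ⟩

theorem exists_mem_parallelogram (hτ : 0 < τ.im) (z : ℂ) :
    ∃ m n : ℤ, ‖z + latticePoint τ m n‖ ≤ 1 + ‖τ‖ := by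
  set s : ℝ := z.im / τ.im
  set r : ℝ := (z - s * τ).re
  refine ⟨-⌊r⌋, -⌊s⌋, ?_⟩
  have e : z + latticePoint τ (-⌊r⌋) (-⌊s⌋) = (Int.fract r : ℝ) + (Int.fract s : ℝ) * τ := by
    have h0 : z = r + s * τ := by
      apply Complex.ext
      · simp [r]
      · simp [s, hτ.ne']
    rw [latticePoint, ← Int.self_sub_floor r, ← Int.self_sub_floor s]
    push_cast
    linear_combination h0
  rw [e]
  refine (norm_add_le _ _).trans (add_le_add ?_ ?_)
  · rw [norm_real, Real.norm_of_nonneg (Int.fract_nonneg _)]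
    exact (Int.fract_lt_one _).le
  · rw [norm_mul, norm_real, Real.norm_of_nonneg (Int.fract_nonneg _)]
    exact mul_le_of_le_one_left (norm_nonneg _) (Int.fract_lt_one _).le

/-- The Jacobi triple product identity up to the constant. -/
theorem exists_jacobiThetaOne_eq_mul (hτ : 0 < τ.im) :
    ∃ c : ℂ, c ≠ 0 ∧ ∀ z, jacobiThetaOne τ z = c * thetaProduct τ z := by
  have hP := differentiable_thetaProduct hτ
  -- Both functions have the same multipliers, so the entire quotient is doubly periodic, hence
  -- bounded, hence constant by Liouville's theorem.
  obtain ⟨R, hR, hRe⟩ := exists_entire_quotient (differentiable_jacobiThetaOne hτ) hP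
    (fun z hz => by
      obtain ⟨m, n, rfl⟩ := exists_latticePoint_of_thetaProduct_eq_zero hτ hz
      exact (thetaProduct_latticePoint hτ m n).2.symm)
  obtain ⟨z₀, hz₀⟩ := exists_jacobiThetaOne_ne_zero hτ
  have hP0 : thetaProduct τ z₀ ≠ 0 := fun h => hz₀ (by rw [hRe, h, mul_zero])
  have p1 : (fun z => R (z + 1)) = R :=
    AnalyticOnNhd.eq_of_mul_eq_mul (hR.comp (by fun_prop)) hR hP hP0 fun z => by
      have := hRe (z + 1)
      rw [jacobiThetaOne_add_one, thetaProduct_add_one, hRe] at this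
      linear_combination this
  have p2 : (fun z => R (z + τ)) = R :=
    AnalyticOnNhd.eq_of_mul_eq_mul (hR.comp (by fun_prop)) hR hP hP0 fun z => by
      have := hRe (z + τ)
      rw [jacobiThetaOne_add_tau, thetaProduct_add_tau hτ, hRe] at this
      have h0 := exp_ne_zero (-(Real.pi * I * (τ + 2 * z)))
      refine mul_left_cancel₀ h0 ?_
      linear_combination this
  have hb : Bornology.IsBounded (range R) := by
    refine ((isCompact_closedBall (0 : ℂ) (1 + ‖τ‖)).image hR.continuous).isBounded.subset ?_
    rintro _ ⟨z, rfl⟩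
    obtain ⟨m, n, h⟩ := exists_mem_parallelogram hτ z
    exact ⟨_, by simpa using h, apply_add_latticePoint (congrFun p1) (congrFun p2) z m n⟩
  have hc : ∀ z, R z = R z₀ := fun z => hR.apply_eq_apply_of_bounded hb z z₀
  refine ⟨R z₀, fun h => hz₀ (by rw [hRe, h, zero_mul]), fun z => by rw [hRe, hc]⟩

theorem jacobiThetaOne_eq_zero_iff (hτ : 0 < τ.im) {z : ℂ} :
    jacobiThetaOne τ z = 0 ↔ ∃ m n : ℤ, z = latticePoint τ m n := by
  constructor
  · intro h
    obtain ⟨c, hc, e⟩ := exists_jacobiThetaOne_eq_mul hτ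
    rw [e] at h
    exact exists_latticePoint_of_thetaProduct_eq_zero hτ ((mul_eq_zero.1 h).resolve_left hc)
  · rintro ⟨m, n, rfl⟩
    exact (thetaProduct_latticePoint hτ m n).2.2

theorem deriv_jacobiThetaOne_zero_ne_zero (hτ : 0 < τ.im) : deriv (jacobiThetaOne τ) 0 ≠ 0 := by
  obtain ⟨c, hc, e⟩ := exists_jacobiThetaOne_eq_mul hτ
  rw [funext e, deriv_const_mul _ (differentiable_thetaProduct hτ 0)]
  exact mul_ne_zero hc (deriv_thetaProduct_zero_ne_zero hτ)

end Theta

/-! ### Green's function and its complex gradient -/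

section Kernel

variable {τ : ℂ}

/-- The entire function `ϑ₁(w) / w`. -/
noncomputable def thetaReg (τ : ℂ) : ℂ → ℂ := dslope (jacobiThetaOne τ) 0

theorem jacobiThetaOne_eq_mul_thetaReg (τ w : ℂ) : jacobiThetaOne τ w = w * thetaReg τ w := by
  simpa [jacobiThetaOne_zero, thetaReg] using (sub_smul_dslope (jacobiThetaOne τ) 0 w).symm

theorem differentiable_thetaReg (hτ : 0 < τ.im) : Differentiable ℂ (thetaReg τ) :=
  differentiable_dslope (differentiable_jacobiThetaOne hτ) 0

/-- The complement of the nonzero lattice points. -/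
def regSet (τ : ℂ) : Set ℂ := {w | thetaReg τ w ≠ 0}

theorem isOpen_regSet (hτ : 0 < τ.im) : IsOpen (regSet τ) :=
  isOpen_ne_fun (differentiable_thetaReg hτ).continuous continuous_const

theorem mem_regSet (hτ : 0 < τ.im) {w : ℂ} (h : ∀ m n : ℤ, w = latticePoint τ m n → w = 0) :
    w ∈ regSet τ := by
  by_cases hw : w = 0
  · subst hw
    simpa [regSet, thetaReg] using deriv_jacobiThetaOne_zero_ne_zero hτ
  · intro h0
    have : jacobiThetaOne τ w = 0 := by rw [jacobiThetaOne_eq_mul_thetaReg, h0, mul_zero]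
    obtain ⟨m, n, e⟩ := (jacobiThetaOne_eq_zero_iff hτ).1 this
    exact hw (h m n e)

/-- The part of the gradient of `torusGreen` that is regular at the origin. -/
noncomputable def greenKernelReg (τ w : ℂ) : ℂ :=
  -(1 / (2 * Real.pi)) * logDeriv (thetaReg τ) w - I * w.im / τ.im

/-- The gradient `2 ∂G` of `torusGreen`. -/
noncomputable def greenKernel (τ w : ℂ) : ℂ :=
  -(1 / (2 * Real.pi)) * w⁻¹ + greenKernelReg τ w

/-- The part of `torusGreen` that is regular at the origin. -/
noncomputable def greenReg (τ w : ℂ) : ℝ :=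
  -(1 / (2 * Real.pi)) * Real.log ‖thetaReg τ w‖ + 1 / (2 * τ.im) * w.im ^ 2

theorem continuousOn_greenKernelReg (hτ : 0 < τ.im) :
    ContinuousOn (greenKernelReg τ) (regSet τ) := by
  have hd := differentiable_thetaReg hτ
  have h1 : Continuous (deriv (thetaReg τ)) :=
    (hd.contDiff (n := 1)).continuous_deriv le_rfl
  have h2 : ContinuousOn (logDeriv (thetaReg τ)) (regSet τ) :=
    h1.continuousOn.div hd.continuous.continuousOn fun w hw => hw
  unfold greenKernelReg
  exact (continuousOn_const.mul h2).sub (by fun_prop)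

theorem continuousOn_greenReg (hτ : 0 < τ.im) : ContinuousOn (greenReg τ) (regSet τ) := by
  have hd := differentiable_thetaReg hτ
  unfold greenReg
  refine (continuousOn_const.mul (ContinuousOn.log hd.continuous.norm.continuousOn fun w hw => ?_)).add
    (by fun_prop)
  exact norm_ne_zero_iff.2 hw

theorem torusGreen_eq (τ : ℂ) {w : ℂ} (hw : w ≠ 0) (h : w ∈ regSet τ) :
    torusGreen τ w = -(1 / (2 * Real.pi)) * Real.log ‖w‖ + greenReg τ w := by
  rw [torusGreen, greenReg, jacobiThetaOne_eq_mul_thetaReg, norm_mul,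
    Real.log_mul (norm_ne_zero_iff.2 hw) (norm_ne_zero_iff.2 h)]
  ring

/-- The punctured plane `ℂ \ Λ_τ`. -/
def latticeCompl (τ : ℂ) : Set ℂ := {w | jacobiThetaOne τ w ≠ 0}

theorem mem_latticeCompl (hτ : 0 < τ.im) {w : ℂ} :
    w ∈ latticeCompl τ ↔ ∀ m n : ℤ, w ≠ latticePoint τ m n := by
  rw [latticeCompl, mem_ofPred_eq, Ne, jacobiThetaOne_eq_zero_iff hτ]
  push Not
  rfl

theorem isOpen_latticeCompl (hτ : 0 < τ.im) : IsOpen (latticeCompl τ) :=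
  isOpen_ne_fun (differentiable_jacobiThetaOne hτ).continuous continuous_const

theorem mem_latticeCompl_iff (τ : ℂ) {w : ℂ} : w ∈ latticeCompl τ ↔ w ≠ 0 ∧ w ∈ regSet τ := by
  rw [latticeCompl, mem_ofPred_eq, jacobiThetaOne_eq_mul_thetaReg, mul_ne_zero_iff]
  rfl

theorem continuousOn_greenKernel (hτ : 0 < τ.im) :
    ContinuousOn (greenKernel τ) (latticeCompl τ) := by
  unfold greenKernel
  refine (continuousOn_const.mul (continuousOn_inv₀.mono fun w hw => ?_)).add
    ((continuousOn_greenKernelReg hτ).mono fun w hw => ?_)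
  · exact ((mem_latticeCompl_iff τ).1 hw).1
  · exact ((mem_latticeCompl_iff τ).1 hw).2

theorem greenKernel_eq (hτ : 0 < τ.im) {w : ℂ} (hw : w ∈ latticeCompl τ) :
    greenKernel τ w = -(1 / (2 * Real.pi)) * logDeriv (jacobiThetaOne τ) w - I * w.im / τ.im := by
  obtain ⟨h0, hr⟩ := (mem_latticeCompl_iff τ).1 hw
  have e : jacobiThetaOne τ = fun w => w * thetaReg τ w :=
    funext (jacobiThetaOne_eq_mul_thetaReg τ)
  rw [e, logDeriv_mul (f := fun w => w) w h0 hr differentiableAt_fun_id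
    (differentiable_thetaReg hτ w), greenKernel, greenKernelReg]
  have : logDeriv (fun x : ℂ => x) w = w⁻¹ := by simp [logDeriv_apply]
  rw [this]
  ring

/-- The real linear form `v ↦ Re (a v)`. -/
noncomputable def reMulCLM (a : ℂ) : ℂ →L[ℝ] ℝ := reCLM.comp (ContinuousLinearMap.mul ℝ ℂ a)

@[simp] theorem reMulCLM_apply (a v : ℂ) : reMulCLM a v = (a * v).re := rfl

theorem continuous_reMulCLM : Continuous reMulCLM :=
  (ContinuousLinearMap.compL ℝ ℂ ℂ ℝ reCLM).continuous.comp (ContinuousLinearMap.mul ℝ ℂ).continuous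

theorem HasDerivAt.hasFDerivAt_re {f : ℂ → ℂ} {f' z : ℂ} (h : HasDerivAt f f' z) :
    HasFDerivAt (fun w => (f w).re) (reMulCLM f') z := by
  have h1 := reCLM.hasFDerivAt.comp z (h.hasFDerivAt.restrictScalars ℝ)
  refine h1.congr_fderiv ?_
  ext v
  simp [mul_comm]

theorem HasDerivAt.hasFDerivAt_log_norm {f : ℂ → ℂ} {f' z : ℂ} (h : HasDerivAt f f' z)
    (hz : f z ≠ 0) : HasFDerivAt (fun w => Real.log ‖f w‖) (reMulCLM (f' / f z)) z := by
  -- Dividing by `f z` moves the value at z to 1, inside the slit plane, so the principal branch is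
  -- differentiable there.
  have h1 : HasDerivAt (fun w => Complex.log (f w / f z)) (f' / f z) z := by
    have := HasDerivAt.clog (h.div_const (f z)) (by simp [hz])
    simpa [hz] using this
  refine ((h1.hasFDerivAt_re).add_const (Real.log ‖f z‖)).congr_of_eventuallyEq ?_
  filter_upwards [h.continuousAt.eventually_ne hz] with w hw
  rw [log_re, norm_div, Real.log_div (norm_ne_zero_iff.2 hw) (norm_ne_zero_iff.2 hz)]
  ring

theorem hasFDerivAt_torusGreen (hτ : 0 < τ.im) {w : ℂ} (hw : w ∈ latticeCompl τ) :
    HasFDerivAt (torusGreen τ) (reMulCLM (greenKernel τ w)) w := by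
  have h1 := ((differentiable_jacobiThetaOne hτ w).hasDerivAt.hasFDerivAt_log_norm hw).const_mul
    (-(1 / (2 * Real.pi)))
  have h2 := ((imCLM.hasFDerivAt (x := w)).pow 2).const_mul (1 / (2 * τ.im))
  refine (h1.add h2).congr_fderiv ?_
  ext v
  rw [greenKernel_eq hτ hw]
  have e1 : (-(1 / (2 * Real.pi)) : ℂ) = ((-(1 / (2 * Real.pi)) : ℝ) : ℂ) := by push_cast; ring
  have e2 : I * (w.im : ℂ) / τ.im = ((w.im / τ.im : ℝ) : ℂ) * I := by push_cast; ring
  rw [e1, e2, logDeriv_apply]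
  simp only [_root_.add_apply, _root_.smul_apply, reMulCLM_apply,
    smul_eq_mul, sub_mul, mul_assoc, sub_re, re_ofReal_mul, I_mul_re, imCLM_apply]
  simp
  field_simp

/-- With y = Im z, the shift by τ multiplies |ϑ₁| by e^{π(b + 2y)}. The resulting change -(b + 2y)/2
of the logarithmic term cancels the growth of y²/(2b). -/
theorem torusGreen_add_latticePoint (hτ : 0 < τ.im) {z : ℂ} (hz : z ∈ latticeCompl τ) (m n : ℤ) :
    torusGreen τ (z + latticePoint τ m n) = torusGreen τ z := by
  classical
  have h0 : ∀ z, jacobiThetaOne τ (z + latticePoint τ m n) = 0 ↔ jacobiThetaOne τ z = 0 := fun z =>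
    Iff.of_eq (apply_add_latticePoint (f := fun z => jacobiThetaOne τ z = 0)
      (fun z => by simp [jacobiThetaOne_add_one])
      (fun z => by simp [jacobiThetaOne_add_tau, exp_ne_zero]) z m n)
  -- At lattice points the default value `Real.log 0 = 0` leaves y²/(2b), which is not periodic.
  -- Replacing it by 0 there gives a function that is periodic everywhere.
  have key := apply_add_latticePoint (τ := τ)
    (f := fun z => if jacobiThetaOne τ z = 0 then 0 else torusGreen τ z)
    (fun z => by simp [torusGreen, jacobiThetaOne_add_one]) (fun z => by
      by_cases h : jacobiThetaOne τ z = 0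
      · simp [h, jacobiThetaOne_add_tau]
      · have h' : jacobiThetaOne τ (z + τ) ≠ 0 := by
          simp [h, jacobiThetaOne_add_tau, exp_ne_zero]
        simp only [h, h', if_false]
        rw [torusGreen, torusGreen, jacobiThetaOne_add_tau, norm_mul, norm_neg, norm_exp,
          Real.log_mul (Real.exp_ne_zero _) (norm_ne_zero_iff.2 h), Real.log_exp]
        have : (-(Real.pi * I * (τ + 2 * z))).re = Real.pi * (τ.im + 2 * z.im) := by
          simp
        rw [this, add_im]
        field_simp
        ring) z m n
  simpa [h0, show jacobiThetaOne τ z ≠ 0 from hz] using key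

end Kernel

/-! ### Uniform estimates for regular closed C² curves -/

theorem exists_pos_forall_le_of_finite {ι : Type*} [Finite ι] {p : ι → ℝ → Prop}
    (hp : ∀ i a b, 0 < a → a ≤ b → p i b → p i a) (h : ∀ i, ∃ a > 0, p i a) :
    ∃ a > 0, ∀ i, p i a := by
  choose a ha hpa using h
  cases isEmpty_or_nonempty ι
  · exact ⟨1, one_pos, fun i => isEmptyElim i⟩
  · obtain ⟨i₀, hi₀⟩ := Finite.exists_min a
    exact ⟨a i₀, ha i₀, fun i => hp i _ _ (ha i₀) (hi₀ i) (hpa i)⟩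

theorem exists_pos_forall_ge_of_finite {ι : Type*} [Finite ι] {p : ι → ℝ → Prop}
    (hp : ∀ i a b, a ≤ b → p i a → p i b) (h : ∀ i, ∃ a, p i a) :
    ∃ a > 0, ∀ i, p i a := by
  choose a hpa using h
  obtain ⟨b, hb⟩ := (Set.finite_range a).bddAbove
  exact ⟨max b 1, by positivity, fun i =>
    hp i _ _ ((hb (mem_range_self i)).trans (le_max_left _ _)) (hpa i)⟩

section Curve

variable {γ : ℝ → ℂ}

theorem Function.Periodic.exists_norm_le {E : Type*} [NormedAddCommGroup E] {f : ℝ → E}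
    (hp : Function.Periodic f 1) (hf : Continuous f) : ∃ C > 0, ∀ t, ‖f t‖ ≤ C := by
  obtain ⟨C, hC, h⟩ := (hp.isBounded_of_continuous one_ne_zero hf).exists_pos_norm_le
  exact ⟨C, hC, fun t => h _ (mem_range_self t)⟩

theorem Function.Periodic.deriv_one (hper : Function.Periodic γ 1) :
    Function.Periodic (deriv γ) 1 := fun x => by
  rw [← deriv_comp_add_const]
  exact congrArg (fun f => deriv f x) (funext hper)

theorem exists_int_eq_of_apply_eq (hper : Function.Periodic γ 1) (hinj : InjOn γ (Ico 0 1))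
    {s t : ℝ} (h : γ s = γ t) : ∃ n : ℤ, s = t + n := by
  have hfr : ∀ r : ℝ, γ (Int.fract r) = γ r := fun r => by
    rw [← Int.self_sub_floor, ← zsmul_one]
    exact hper.sub_zsmul_eq ⌊r⌋
  have hst : Int.fract s = Int.fract t :=
    hinj ⟨Int.fract_nonneg s, Int.fract_lt_one s⟩ ⟨Int.fract_nonneg t, Int.fract_lt_one t⟩
      (by rw [hfr, hfr, h])
  refine ⟨⌊s⌋ - ⌊t⌋, ?_⟩
  rw [← Int.self_sub_floor s, ← Int.self_sub_floor t] at hst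
  push_cast
  linarith

theorem exists_deriv_norm_ge (hγ : ContDiff ℝ 2 γ) (hper : Function.Periodic γ 1)
    (hne : ∀ t, deriv γ t ≠ 0) : ∃ c > 0, ∀ t, c ≤ ‖deriv γ t‖ := by
  have hd : Continuous (deriv γ) := hγ.continuous_deriv (by norm_num)
  have hp : Function.Periodic (fun t => ‖deriv γ t‖⁻¹) 1 := fun t => by
    simp only [hper.deriv_one t]
  obtain ⟨C, hC, h⟩ := hp.exists_norm_le (hd.norm.inv₀ fun t => norm_ne_zero_iff.2 (hne t))
  refine ⟨C⁻¹, inv_pos.2 hC, fun t => ?_⟩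
  have := h t
  rw [norm_inv, norm_norm] at this
  exact inv_le_of_inv_le₀ (norm_pos_iff.2 (hne t)) this

theorem exists_deriv_lipschitz (hγ : ContDiff ℝ 2 γ) (hper : Function.Periodic γ 1) :
    ∃ C > 0, ∀ s t, ‖deriv γ s - deriv γ t‖ ≤ C * |s - t| := by
  have h1 : ContDiff ℝ 1 (deriv γ) := by
    have : ContDiff ℝ (1 + 1) γ := by simpa [one_add_one_eq_two] using hγ
    exact (contDiff_succ_iff_deriv.1 this).2.2
  obtain ⟨C, hC, h⟩ := hper.deriv_one.deriv_one.exists_norm_le (h1.continuous_deriv le_rfl)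
  refine ⟨C, hC, fun s t => ?_⟩
  simpa using Convex.norm_image_sub_le_of_norm_deriv_le (𝕜 := ℝ) (f := deriv γ) (s := univ)
    (fun x _ => (h1.differentiable one_ne_zero) x) (fun x _ => h x) convex_univ (mem_univ t)
    (mem_univ s)

/-- Mean value inequality for the remainder as a function of y between 0 and x: its derivative γ'(t
+ y) - γ'(t) is at most C|x|, since γ' is Lipschitz. -/
theorem exists_taylor_le (hγ : ContDiff ℝ 2 γ) (hper : Function.Periodic γ 1) :
    ∃ C > 0, ∀ t x : ℝ, ‖γ (t + x) - γ t - x * deriv γ t‖ ≤ C * x ^ 2 := by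
  obtain ⟨C, hC, h⟩ := exists_deriv_lipschitz hγ hper
  refine ⟨C, hC, fun t x => ?_⟩
  have hdiff : Differentiable ℝ γ := hγ.differentiable two_ne_zero
  have hd : ∀ y : ℝ, HasDerivAt (fun y : ℝ => γ (t + y) - γ t - y * deriv γ t)
      (deriv γ (t + y) - deriv γ t) y := fun y => by
    have h1 : HasDerivAt (fun y : ℝ => γ (t + y)) (deriv γ (t + y)) y :=
      (hdiff (t + y)).hasDerivAt.comp_const_add t y
    have h2 : HasDerivAt (fun y : ℝ => (y : ℂ) * deriv γ t) (deriv γ t) y := by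
      simpa using (Complex.ofRealCLM.hasDerivAt (x := y)).mul_const (deriv γ t)
    simpa using (h1.sub_const (γ t)).fun_sub h2
  have := Convex.norm_image_sub_le_of_norm_hasDerivWithin_le (s := uIcc 0 x) (C := C * |x|)
    (fun y _ => (hd y).hasDerivWithinAt) (fun y hy => ?_) (convex_uIcc 0 x) left_mem_uIcc
    right_mem_uIcc
  · simpa [mul_assoc, ← sq] using this
  · refine (h _ _).trans (mul_le_mul_of_nonneg_left ?_ hC.le)
    simpa using abs_sub_left_of_mem_uIcc hy

/-- For small x this follows from Taylor's formula and the lower bound for |γ'|. For the other x it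
follows from compactness and injectivity modulo the period. The restriction |x| ≤ 1/2 is natural
because the curve returns after parameter length 1. -/
theorem exists_chord_ge (hγ : ContDiff ℝ 2 γ) (hper : Function.Periodic γ 1)
    (hinj : InjOn γ (Ico 0 1)) (hne : ∀ t, deriv γ t ≠ 0) :
    ∃ c > 0, ∀ t x : ℝ, |x| ≤ 1 / 2 → c * |x| ≤ ‖γ (t + x) - γ t‖ := by
  obtain ⟨c, hc, hc'⟩ := exists_deriv_norm_ge hγ hper hne
  obtain ⟨C, hC, hC'⟩ := exists_taylor_le hγ hper
  -- For |x| ≤ δ the Taylor remainder costs at most half of the linear term.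
  set δ := c / (2 * C) with hδ
  have hδ0 : 0 < δ := by positivity
  have near : ∀ t x : ℝ, |x| ≤ δ → c / 2 * |x| ≤ ‖γ (t + x) - γ t‖ := fun t x hx => by
    have h1 : ‖(x : ℂ) * deriv γ t‖ ≤ ‖γ (t + x) - γ t‖ + C * x ^ 2 := by
      have := norm_sub_le (γ (t + x) - γ t) (γ (t + x) - γ t - x * deriv γ t)
      rw [sub_sub_cancel] at this
      exact this.trans (by gcongr; exact hC' t x)
    have h2 : c * |x| ≤ ‖(x : ℂ) * deriv γ t‖ := by
      rw [norm_mul, norm_real, Real.norm_eq_abs, mul_comm]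
      gcongr
      exact hc' t
    have h3 : C * x ^ 2 ≤ c / 2 * |x| := by
      rw [← sq_abs, sq, ← mul_assoc]
      gcongr
      calc C * |x| ≤ C * δ := by gcongr
        _ = c / 2 := by rw [hδ]; field_simp
    linarith
  set K : Set (ℝ × ℝ) := Icc 0 1 ×ˢ {x | δ ≤ |x| ∧ |x| ≤ 1 / 2} with hK
  have hKc : IsCompact K := by
    refine isCompact_Icc.prod (Metric.isCompact_of_isClosed_isBounded ?_ ?_)
    · exact (isClosed_le continuous_const continuous_abs).inter
        (isClosed_le continuous_abs continuous_const)
    · exact (Metric.isBounded_closedBall (x := (0 : ℝ)) (r := 1 / 2)).subset fun x hx => by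
        simpa using hx.2
  have hcont : Continuous fun p : ℝ × ℝ => ‖γ (p.1 + p.2) - γ p.1‖ := by
    have := hγ.continuous
    fun_prop
  obtain ⟨m, hm, hm'⟩ : ∃ m > 0, ∀ p ∈ K, m ≤ ‖γ (p.1 + p.2) - γ p.1‖ := by
    rcases K.eq_empty_or_nonempty with h | h
    · exact ⟨1, one_pos, by simp [h]⟩
    obtain ⟨p, hp, hmin⟩ := hKc.exists_isMinOn h hcont.continuousOn
    refine ⟨_, norm_pos_iff.2 fun h0 => ?_, fun q hq => hmin hq⟩
    obtain ⟨n, hn⟩ := exists_int_eq_of_apply_eq hper hinj (sub_eq_zero.1 h0)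
    have hpn : p.2 = n := by linarith
    have h1 := hp.2.1
    have h2 := hp.2.2
    rw [hpn, ← Int.cast_abs] at h1 h2
    have h3 : |n| < 1 := by exact_mod_cast h2.trans_lt (by norm_num : (1 / 2 : ℝ) < 1)
    rw [Int.abs_lt_one_iff] at h3
    rw [h3] at h1
    simp at h1
    linarith
  -- The minimum m over the compact part becomes 2m|x| because |x| ≤ 1/2.
  refine ⟨min (c / 2) (2 * m), by positivity, fun t x hx => ?_⟩
  rcases le_total |x| δ with h | h
  · exact (mul_le_mul_of_nonneg_right (min_le_left _ _) (abs_nonneg x)).trans (near t x h)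
  · have hfr : ∀ r : ℝ, γ (Int.fract t + r) = γ (t + r) := fun r => by
      rw [← Int.self_sub_floor, sub_add_eq_add_sub, ← zsmul_one]
      exact hper.sub_zsmul_eq ⌊t⌋
    have h1 := hm' (Int.fract t, x) ⟨⟨Int.fract_nonneg t, (Int.fract_lt_one t).le⟩, h, hx⟩
    simp only [hfr] at h1
    have h2 : γ (Int.fract t) = γ t := by simpa using hfr 0
    rw [h2] at h1
    calc min (c / 2) (2 * m) * |x| ≤ 2 * m * (1 / 2) := by
          gcongr
          exact min_le_right _ _
      _ ≤ _ := by linarith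

/-- The unit normal to the right of the curve. -/
noncomputable def unitNormal (γ : ℝ → ℂ) (t : ℝ) : ℂ := -I * deriv γ t / (‖deriv γ t‖ : ℂ)

theorem norm_unitNormal {t : ℝ} (h : deriv γ t ≠ 0) : ‖unitNormal γ t‖ = 1 := by
  simp [unitNormal, h]

theorem unitNormal_mul_norm {t : ℝ} (h : deriv γ t ≠ 0) :
    unitNormal γ t * ‖deriv γ t‖ = -I * deriv γ t := by
  have : (‖deriv γ t‖ : ℂ) ≠ 0 := by simpa using h
  rw [unitNormal]
  field_simp

theorem continuous_unitNormal (hγ : ContDiff ℝ 2 γ) (hne : ∀ t, deriv γ t ≠ 0) :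
    Continuous (unitNormal γ) := by
  have hd : Continuous (deriv γ) := hγ.continuous_deriv (by norm_num)
  unfold unitNormal
  exact (continuous_const.mul hd).div (by fun_prop) fun t => by simpa using hne t

theorem re_conj_unitNormal_mul_deriv (γ : ℝ → ℂ) (t x : ℝ) :
    (starRingEnd ℂ (unitNormal γ t) * (x * deriv γ t)).re = 0 := by
  have : starRingEnd ℂ (unitNormal γ t) * (x * deriv γ t) =
      ((x / ‖deriv γ t‖ * normSq (deriv γ t) : ℝ) : ℂ) * I := by
    rw [unitNormal, map_div₀, map_mul, conj_ofReal, map_neg, conj_I]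
    push_cast
    rw [normSq_eq_conj_mul_self]
    ring
  rw [this]
  simp

/-- At a minimum of the squared distance the derivative vanishes, so z - γ(t) is orthogonal to γ'(t)
and hence a real multiple of the normal. -/
theorem exists_eq_add_unitNormal_of_isMin (hγ : ContDiff ℝ 2 γ) {t : ℝ} (hne : deriv γ t ≠ 0)
    {z : ℂ} (hmin : ∀ s, ‖z - γ t‖ ≤ ‖z - γ s‖) :
    ∃ s : ℝ, |s| = ‖z - γ t‖ ∧ z = γ t + s * unitNormal γ t := by
  have hdiff : HasDerivAt γ (deriv γ t) t := (hγ.differentiable two_ne_zero t).hasDerivAt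
  have h1 : HasDerivAt (fun s => ‖z - γ s‖ ^ 2) (2 * inner ℝ (z - γ t) (-deriv γ t)) t :=
    (hdiff.const_sub z).norm_sq
  have h2 : IsLocalMin (fun s => ‖z - γ s‖ ^ 2) t := .of_forall fun s => by
    have := hmin s
    dsimp only
    gcongr
  have h3 := h2.hasDerivAt_eq_zero h1
  have hn : (‖deriv γ t‖ : ℂ) ≠ 0 := by simpa using hne
  set s : ℝ := ((z - γ t) / unitNormal γ t).re with hs
  have hun : unitNormal γ t ≠ 0 := by
    rw [← norm_ne_zero_iff, norm_unitNormal hne]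
    exact one_ne_zero
  have him : ((z - γ t) / unitNormal γ t).im = 0 := by
    have e : (z - γ t) / unitNormal γ t = (z - γ t) * starRingEnd ℂ (deriv γ t) * I *
        ((‖deriv γ t‖ / normSq (deriv γ t) : ℝ) : ℂ) := by
      have hc : starRingEnd ℂ (deriv γ t) ≠ 0 := by simpa using hne
      rw [unitNormal]
      push_cast
      rw [normSq_eq_conj_mul_self]
      field_simp
      rw [I_sq]
      ring
    have h4 : ((z - γ t) * starRingEnd ℂ (deriv γ t)).re = 0 := by
      rw [inner_neg_right, Complex.inner] at h3
      have h5 : (deriv γ t * (starRingEnd ℂ) (z - γ t)).re = 0 := by linarith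
      rw [← conj_re, map_mul, conj_conj, mul_comm] at h5
      exact h5
    rw [e, im_mul_ofReal, mul_I_im, h4, zero_mul]
  have hz : (z - γ t) / unitNormal γ t = s := by
    apply Complex.ext <;> simp [hs, him]
  have hz' : z - γ t = s * unitNormal γ t := by rw [← hz]; field_simp
  refine ⟨s, ?_, by rw [← hz']; ring⟩
  rw [hz', norm_mul, norm_unitNormal hne, mul_one, norm_real, Real.norm_eq_abs]

end Curve

/-! ### Topology of the torus domain and geometry of its boundary -/

theorem finite_latticePoint_norm_le {τ : ℂ} (hτ : 0 < τ.im) (R : ℝ) :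
    {p : ℤ × ℤ | ‖latticePoint τ p.1 p.2‖ ≤ R}.Finite := by
  have hfin : ∀ A : ℝ, {n : ℤ | |(n : ℝ)| ≤ A}.Finite := fun A => by
    refine (Set.finite_Icc (-⌈A⌉) ⌈A⌉).subset fun n hn => ?_
    have := abs_le.1 (show |(n : ℝ)| ≤ A from hn)
    have h2 := Int.le_ceil A
    constructor
    · have : (-⌈A⌉ : ℝ) ≤ n := by linarith
      exact_mod_cast this
    · have : (n : ℝ) ≤ ⌈A⌉ := by linarith
      exact_mod_cast this
  refine ((hfin (R + R / τ.im * ‖τ‖)).prod (hfin (R / τ.im))).subset fun p hp => ?_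
  have hp' : ‖latticePoint τ p.1 p.2‖ ≤ R := hp
  have h1 : |(p.2 : ℝ)| ≤ R / τ.im := by
    rw [le_div_iff₀ hτ, ← abs_of_pos hτ, ← abs_mul]
    refine le_trans (le_of_eq ?_) ((abs_im_le_norm _).trans hp')
    simp [latticePoint]
  refine ⟨?_, h1⟩
  have h2 : ‖(p.1 : ℂ)‖ ≤ ‖latticePoint τ p.1 p.2‖ + ‖(p.2 : ℂ) * τ‖ := by
    have := norm_sub_le (latticePoint τ p.1 p.2) ((p.2 : ℂ) * τ)
    simpa [latticePoint] using this
  have h3 : |(p.2 : ℝ)| * ‖τ‖ ≤ R / τ.im * ‖τ‖ := by gcongr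
  rw [norm_mul] at h2
  simp only [norm_intCast] at h2
  show |(p.1 : ℝ)| ≤ _
  linarith

namespace FinitelyConnectedTorus

variable {τ : ℂ} {M : ℕ} (H : FinitelyConnectedTorus τ M)

theorem isCompact_frontier (j : Fin M) : IsCompact (frontier (H.D j)) :=
  (H.isBounded_D j).isCompact_closure.of_isClosed_subset isClosed_frontier frontier_subset_closure

theorem isCompact_boundary : IsCompact H.boundary := isCompact_iUnion H.isCompact_frontier

instance : CompactSpace H.boundary := isCompact_iff_compactSpace.1 H.isCompact_boundary

theorem γ_mem_frontier (j : Fin M) (t : ℝ) : H.γ j t ∈ frontier (H.D j) :=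
  H.range_γ j ▸ mem_range_self t

theorem γ_mem_closure (j : Fin M) (t : ℝ) : H.γ j t ∈ closure (H.D j) :=
  frontier_subset_closure (H.γ_mem_frontier j t)

theorem frontier_subset_boundary (j : Fin M) : frontier (H.D j) ⊆ H.boundary :=
  subset_iUnion (fun j => frontier (H.D j)) j

theorem exists_of_mem_boundary {z : ℂ} (hz : z ∈ H.boundary) : ∃ j t, H.γ j t = z := by
  obtain ⟨j, hj⟩ := mem_iUnion.1 hz
  rw [← H.range_γ j] at hj
  exact ⟨j, hj⟩

theorem eq_of_mem_closure {i j : Fin M} {z : ℂ} (hi : z ∈ closure (H.D i))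
    (hj : z ∈ closure (H.D j)) : i = j :=
  (H.disjoint_closure i j 0 0 z hi (by simpa [latticePoint_zero] using hj)).1

theorem sub_mem_regSet (hτ : 0 < τ.im) {i j : Fin M} {z w : ℂ} (hz : z ∈ closure (H.D i))
    (hw : w ∈ closure (H.D j)) : z - w ∈ regSet τ :=
  mem_regSet hτ fun m n h => by
    obtain ⟨-, hm, hn⟩ := H.disjoint_closure j i m n w hw (by rwa [← h, add_sub_cancel])
    rw [h, hm, hn, latticePoint_zero]

theorem D_subset_compl_boundary (j : Fin M) : Disjoint (H.D j) H.boundary := by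
  refine Set.disjoint_left.2 fun z hz hzB => ?_
  obtain ⟨i, hi⟩ := mem_iUnion.1 hzB
  obtain rfl := H.eq_of_mem_closure (frontier_subset_closure hi) (subset_closure hz)
  rw [(H.isOpen_D i).frontier_eq] at hi
  exact hi.2 hz

/-- The translates of the closed holes form a locally finite family, because bounded sets contain
finitely many lattice points. The index set is arbitrary so that the lemma serves both for the
domain (all translates) and for the separation of one hole (all but one). -/
theorem isOpen_domain_aux (hτ : 0 < τ.im) (s : Set (Fin M × ℤ × ℤ)) :
    IsClosed {z | ∃ p ∈ s, z + latticePoint τ p.2.1 p.2.2 ∈ closure (H.D p.1)} := by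
  have e : {z | ∃ p ∈ s, z + latticePoint τ p.2.1 p.2.2 ∈ closure (H.D p.1)} =
      ⋃ p : s, {z | z + latticePoint τ p.1.2.1 p.1.2.2 ∈ closure (H.D p.1.1)} := by
    ext z
    simp
  rw [e]
  refine LocallyFinite.isClosed_iUnion ?_ fun p => isClosed_closure.preimage (by fun_prop)
  obtain ⟨R, hR⟩ : ∃ R, ∀ j, ∀ z ∈ closure (H.D j), ‖z‖ ≤ R := by
    obtain ⟨R, hR⟩ := (isCompact_iUnion fun j => (H.isBounded_D j).isCompact_closure).isBounded.exists_norm_le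
    exact ⟨R, fun j z hz => hR z (mem_iUnion_of_mem j hz)⟩
  intro z
  refine ⟨ball z 1, ball_mem_nhds z one_pos, ?_⟩
  have hf : (univ ×ˢ {p : ℤ × ℤ | ‖latticePoint τ p.1 p.2‖ ≤ R + (‖z‖ + 1)} :
      Set (Fin M × ℤ × ℤ)).Finite := finite_univ.prod (finite_latticePoint_norm_le hτ _)
  refine (hf.preimage Subtype.val_injective.injOn).subset ?_
  rintro ⟨p, hp⟩ ⟨w, hw, hwz⟩
  refine ⟨mem_univ _, ?_⟩
  have h1 := hR _ _ hw
  have h2 : ‖w‖ ≤ ‖z‖ + 1 := by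
    have := norm_le_norm_add_norm_sub z w
    rw [mem_ball, dist_eq_norm, norm_sub_rev] at hwz
    linarith
  have h3 := norm_sub_le (w + latticePoint τ p.2.1 p.2.2) w
  rw [add_sub_cancel_left] at h3
  show ‖latticePoint τ p.2.1 p.2.2‖ ≤ _
  linarith

theorem isOpen_domain (hτ : 0 < τ.im) : IsOpen H.domain := by
  have := (H.isOpen_domain_aux hτ univ).isOpen_compl
  convert this using 1
  ext z
  simp [domain]

theorem add_latticePoint_mem_domain {z : ℂ} (hz : z ∈ H.domain) (m n : ℤ) :
    z + latticePoint τ m n ∈ H.domain := fun j m' n' h => hz j (m + m') (n + n') (by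
  rwa [latticePoint_add, ← add_assoc])

theorem notMem_boundary_of_mem_domain {z : ℂ} (hz : z ∈ H.domain) : z ∉ H.boundary := fun h => by
  obtain ⟨j, hj⟩ := mem_iUnion.1 h
  exact hz j 0 0 (by simpa [latticePoint_zero] using frontier_subset_closure hj)

theorem notMem_D_of_mem_domain {z : ℂ} (hz : z ∈ H.domain) (j : Fin M) : z ∉ H.D j := fun h =>
  hz j 0 0 (by simpa [latticePoint_zero] using subset_closure h)

/-- The points of the plane off the curves and their translates. -/
def offBoundary : Set ℂ := {z | ∀ ξ ∈ H.boundary, z - ξ ∈ latticeCompl τ}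

theorem domain_subset_offBoundary (hτ : 0 < τ.im) : H.domain ⊆ H.offBoundary := fun z hz ξ hξ => by
  rw [mem_latticeCompl hτ]
  intro m n h
  obtain ⟨j, hj⟩ := mem_iUnion.1 hξ
  refine hz j (-m) (-n) ?_
  rw [latticePoint_neg, ← h]
  simpa using frontier_subset_closure hj

theorem D_subset_offBoundary (hτ : 0 < τ.im) (j : Fin M) : H.D j ⊆ H.offBoundary :=
  fun z hz ξ hξ => by
  obtain ⟨i, hi⟩ := mem_iUnion.1 hξ
  refine (mem_latticeCompl_iff τ).2
    ⟨fun h => ?_, H.sub_mem_regSet hτ (subset_closure hz) (frontier_subset_closure hi)⟩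
  rw [sub_eq_zero] at h
  exact Set.disjoint_left.1 (H.D_subset_compl_boundary j) hz (h ▸ hξ)

theorem normal_eq (j : Fin M) (t : ℝ) : H.normal (H.bdryPoint j t) = unitNormal (H.γ j) t :=
  H.normal_bdryPoint j t

theorem norm_normal (z : H.boundary) : ‖H.normal z‖ = 1 := by
  obtain ⟨⟨j, t⟩, rfl⟩ := H.exists_bdryPoint_eq z
  rw [normal_eq]
  exact norm_unitNormal (H.deriv_γ_ne_zero j t)

theorem continuous_bdryPoint (j : Fin M) : Continuous (H.bdryPoint j) :=
  (H.contDiff_γ j).continuous.subtype_mk _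

theorem bdryPoint_periodic (j : Fin M) : Function.Periodic (H.bdryPoint j) 1 := fun t =>
  Subtype.ext (H.periodic_γ j t)

/-- A continuous surjection from a compact space to a Hausdorff space is closed. This reduces
continuity of `normal`, which is defined by a choice of parameters, to continuity along the
parametrizations. -/
theorem isQuotientMap_bdryPoint : IsQuotientMap
    fun p : Fin M × Icc (0 : ℝ) 1 => H.bdryPoint p.1 p.2 := by
  have hc : Continuous fun p : Fin M × Icc (0 : ℝ) 1 => H.bdryPoint p.1 p.2 :=
    continuous_prod_of_discrete_left.2 fun j =>
      (H.continuous_bdryPoint j).comp continuous_subtype_val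
  refine hc.isClosedMap.isQuotientMap hc fun z => ?_
  obtain ⟨⟨j, t⟩, rfl⟩ := H.exists_bdryPoint_eq z
  refine ⟨(j, ⟨Int.fract t, Int.fract_nonneg t, (Int.fract_lt_one t).le⟩), ?_⟩
  show H.bdryPoint j (Int.fract t) = _
  rw [← Int.self_sub_floor, ← zsmul_one]
  exact (H.bdryPoint_periodic j).sub_zsmul_eq _

theorem continuous_normal : Continuous H.normal := by
  rw [H.isQuotientMap_bdryPoint.continuous_iff]
  refine continuous_prod_of_discrete_left.2 fun j => ?_
  have : (fun t : Icc (0 : ℝ) 1 => H.normal (H.bdryPoint j t)) = fun t : Icc (0 : ℝ) 1 =>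
    unitNormal (H.γ j) t := funext fun t => H.normal_eq j t
  exact this ▸ (continuous_unitNormal (H.contDiff_γ j) (H.deriv_γ_ne_zero j)).comp
    continuous_subtype_val

theorem exists_chord_ge : ∃ c > 0, ∀ j : Fin M, ∀ t x : ℝ, |x| ≤ 1 / 2 →
    c * |x| ≤ ‖H.γ j (t + x) - H.γ j t‖ :=
  exists_pos_forall_le_of_finite
    (fun _ _ _ _ hab h t x hx => (mul_le_mul_of_nonneg_right hab (abs_nonneg x)).trans (h t x hx))
    fun j => _root_.exists_chord_ge (H.contDiff_γ j) (H.periodic_γ j) (H.injOn_γ j)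
      (H.deriv_γ_ne_zero j)

theorem exists_taylor_le : ∃ C > 0, ∀ j : Fin M, ∀ t x : ℝ,
    ‖H.γ j (t + x) - H.γ j t - x * deriv (H.γ j) t‖ ≤ C * x ^ 2 :=
  exists_pos_forall_ge_of_finite
    (fun _ _ _ hab h t x => (h t x).trans (mul_le_mul_of_nonneg_right hab (sq_nonneg x)))
    fun j => (_root_.exists_taylor_le (H.contDiff_γ j) (H.periodic_γ j)).imp fun _ h => h.2

theorem exists_deriv_le : ∃ C > 0, ∀ j : Fin M, ∀ t, ‖deriv (H.γ j) t‖ ≤ C :=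
  exists_pos_forall_ge_of_finite (fun _ _ _ hab h t => (h t).trans hab) fun j =>
    ((H.periodic_γ j).deriv_one.exists_norm_le
      ((H.contDiff_γ j).continuous_deriv (by norm_num))).imp fun _ h => h.2

theorem exists_deriv_ge : ∃ c > 0, ∀ j : Fin M, ∀ t, c ≤ ‖deriv (H.γ j) t‖ :=
  exists_pos_forall_le_of_finite (fun _ _ _ _ hab h t => hab.trans (h t)) fun j =>
    exists_deriv_norm_ge (H.contDiff_γ j) (H.periodic_γ j) (H.deriv_γ_ne_zero j)

/-- A hole of the torus stays at a positive distance from the other holes and the translates. -/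
theorem exists_separation (hτ : 0 < τ.im) : ∃ δ > 0, ∀ j : Fin M, ∀ z ∈ closure (H.D j),
    ∀ w ∈ ball z δ, ∀ i m n, w + latticePoint τ m n ∈ closure (H.D i) → i = j ∧ m = 0 ∧ n = 0 := by
  refine exists_pos_forall_le_of_finite
    (fun _ _ _ _ hab h z hz w hw => h z hz w (ball_subset_ball hab hw)) fun j => ?_
  -- All translates of closed holes other than the hole j itself form a closed set disjoint from its
  -- compact closure, so the two have disjoint thickenings.
  have hF := H.isOpen_domain_aux hτ {(j, 0, 0)}ᶜ
  set F := {z | ∃ p ∈ ({(j, 0, 0)}ᶜ : Set (Fin M × ℤ × ℤ)),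
    z + latticePoint τ p.2.1 p.2.2 ∈ closure (H.D p.1)}
  have hd : Disjoint (closure (H.D j)) F := Set.disjoint_left.2 fun z hz => by
    rintro ⟨⟨i, m, n⟩, hp, hi⟩
    obtain ⟨rfl, rfl, rfl⟩ := H.disjoint_closure j i m n z hz hi
    exact hp rfl
  obtain ⟨δ, hδ, h⟩ := hd.exists_thickenings (H.isBounded_D j).isCompact_closure hF
  refine ⟨δ, hδ, fun z hz w hw i m n hi => ?_⟩
  by_contra hne
  refine Set.disjoint_left.1 h (mem_thickening_iff.2 ⟨z, hz, hw⟩)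
    (self_subset_thickening hδ _ ⟨(i, m, n), fun h => hne ?_, hi⟩)
  simpa using h

/-- On one curve the linear Taylor term is tangential, so only the quadratic remainder has a normal
component, and the chord bound converts x² into |ξ - z|². On different curves |ξ - z| ≥ δ, so |ξ -
z| ≤ |ξ - z|²/δ. -/
theorem exists_normal_le (hτ : 0 < τ.im) : ∃ C > 0, ∀ z ξ : H.boundary,
    |(starRingEnd ℂ (H.normal z) * (ξ - z)).re| ≤ C * ‖(ξ : ℂ) - z‖ ^ 2 := by
  obtain ⟨c, hc, hc'⟩ := H.exists_chord_ge
  obtain ⟨C, hC, hC'⟩ := H.exists_taylor_le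
  obtain ⟨δ, hδ, hδ'⟩ := H.exists_separation hτ
  refine ⟨max (C / c ^ 2) (1 / δ), by positivity, fun z ξ => ?_⟩
  obtain ⟨⟨j, t⟩, rfl⟩ := H.exists_bdryPoint_eq z
  obtain ⟨⟨i, s⟩, rfl⟩ := H.exists_bdryPoint_eq ξ
  dsimp only
  by_cases hij : i = j
  · subst hij
    -- The representative of s - t modulo the period for which the chord bound is available.
    set x : ℝ := s - t - round (s - t) with hx
    have hγ : H.γ i (t + x) = H.γ i s := by
      have : t + x = s - round (s - t) • (1 : ℝ) := by rw [hx, zsmul_one]; ring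
      rw [this]
      exact (H.periodic_γ i).sub_zsmul_eq _
    have hx2 : |x| ≤ 1 / 2 := abs_sub_round _
    have h1 := hc' i t x hx2
    have h2 := hC' i t x
    rw [hγ] at h1 h2
    rw [normal_eq]
    show |(starRingEnd ℂ (unitNormal (H.γ i) t) * (H.γ i s - H.γ i t)).re| ≤
      _ * ‖H.γ i s - H.γ i t‖ ^ 2
    have e : (starRingEnd ℂ (unitNormal (H.γ i) t) * (H.γ i s - H.γ i t)).re =
        (starRingEnd ℂ (unitNormal (H.γ i) t) *
          (H.γ i s - H.γ i t - x * deriv (H.γ i) t)).re := by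
      rw [mul_sub _ (H.γ i s - H.γ i t), sub_re, re_conj_unitNormal_mul_deriv, sub_zero]
    rw [e]
    calc _ ≤ _ := abs_re_le_norm _
      _ = ‖H.γ i s - H.γ i t - x * deriv (H.γ i) t‖ := by
        rw [norm_mul, norm_conj, norm_unitNormal (H.deriv_γ_ne_zero i t), one_mul]
      _ ≤ C * x ^ 2 := h2
      _ = C / c ^ 2 * (c * |x|) ^ 2 := by rw [mul_pow, sq_abs]; field_simp
      _ ≤ _ := by gcongr; exact le_max_left _ _
  · have hd : δ ≤ ‖(H.bdryPoint i s : ℂ) - H.bdryPoint j t‖ := by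
      by_contra hlt
      exact hij (hδ' j _ (H.γ_mem_closure j t) (H.γ i s) (by rw [mem_ball, dist_eq_norm]; exact not_le.1 hlt) i 0 0
        (by simpa [latticePoint_zero] using H.γ_mem_closure i s)).1
    set d := ‖(H.bdryPoint i s : ℂ) - H.bdryPoint j t‖
    calc _ ≤ _ := abs_re_le_norm _
      _ = d := by rw [norm_mul, norm_conj, norm_normal, one_mul]
      _ ≤ 1 / δ * d ^ 2 := by
        rw [sq, ← mul_assoc]
        refine le_mul_of_one_le_left (norm_nonneg _) ?_
        rw [one_div, ← div_eq_inv_mul]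
        exact (one_le_div hδ).2 hd
      _ ≤ _ := by gcongr; exact le_max_right _ _

/-- Balls of a uniform radius that touch the boundary at a point do not contain any other point
of it. -/
theorem exists_ball_disjoint (hτ : 0 < τ.im) : ∃ r > 0, ∀ z : H.boundary, ∀ s : ℝ, |s| ≤ r →
    Disjoint (ball ((z : ℂ) + s * H.normal z) |s|) H.boundary := by
  obtain ⟨C, hC, hC'⟩ := H.exists_normal_le hτ
  -- With d = ξ - z, the squared distance of ξ from the centre is |d|² - 2s ν·d + s². For |s| ≤
  -- 1/(2C) the middle term is at most |d|², so ξ is not in the ball.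
  refine ⟨1 / (2 * C), by positivity, fun z s hs => Set.disjoint_left.2 fun ξ hξ hB => ?_⟩
  have h1 := hC' z ⟨ξ, hB⟩
  set d : ℂ := ξ - z with hd
  have e : ‖ξ - (z + s * H.normal z)‖ ^ 2 =
      ‖d‖ ^ 2 - 2 * s * (starRingEnd ℂ (H.normal z) * d).re + s ^ 2 := by
    have e1 : ξ - (z + s * H.normal z) = d - s * H.normal z := by rw [hd]; ring
    have e2 : (d * starRingEnd ℂ (s * H.normal z)).re =
        s * (starRingEnd ℂ (H.normal z) * d).re := by
      rw [map_mul, conj_ofReal, ← re_ofReal_mul]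
      ring_nf
    rw [e1, ← normSq_eq_norm_sq, normSq_sub, normSq_eq_norm_sq, normSq_eq_norm_sq, norm_mul, norm_normal, e2, norm_real]
    simp
    ring
  rw [mem_ball, dist_eq_norm] at hξ
  have h3 : ‖ξ - (z + s * H.normal z)‖ ^ 2 < s ^ 2 := by
    rw [← sq_abs s]
    gcongr
  rw [e] at h3
  have h4 : |2 * s * (starRingEnd ℂ (H.normal z) * d).re| ≤ ‖d‖ ^ 2 := by
    rw [abs_mul, abs_mul, abs_two]
    calc 2 * |s| * |(starRingEnd ℂ (H.normal z) * d).re|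
        ≤ 2 * (1 / (2 * C)) * (C * ‖d‖ ^ 2) := by gcongr
      _ = ‖d‖ ^ 2 := by field_simp
  have := (abs_le.1 h4).2
  linarith

/-- Normal coordinates: a point of the plane lies on the normal line through a nearest boundary
point, and the sign of s will tell on which side. -/
theorem exists_nearest {z : ℂ} (hM : H.boundary.Nonempty) : ∃ ξ : H.boundary, ∃ s : ℝ,
    z = ξ + s * H.normal ξ ∧ |s| = ‖z - ξ‖ ∧ ∀ ξ' ∈ H.boundary, |s| ≤ ‖z - ξ'‖ := by
  obtain ⟨ξ, hξ, hmin⟩ := H.isCompact_boundary.exists_isMinOn hM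
    (f := fun ξ => ‖z - ξ‖) (by fun_prop)
  obtain ⟨⟨j, t⟩, h⟩ := H.exists_bdryPoint_eq ⟨ξ, hξ⟩
  have h' : H.γ j t = ξ := congrArg Subtype.val h
  obtain ⟨s, hs, hz⟩ := exists_eq_add_unitNormal_of_isMin (H.contDiff_γ j)
    (H.deriv_γ_ne_zero j t) (z := z)
    (fun s => h' ▸ hmin (H.frontier_subset_boundary j (H.γ_mem_frontier j s)))
  refine ⟨⟨ξ, hξ⟩, s, ?_, ?_, fun ξ' hξ' => ?_⟩
  · rw [← h, normal_eq]
    exact hz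
  · rw [hs, h']
  · rw [hs, h']
    exact hmin hξ'

end FinitelyConnectedTorus

/-! ### Tangent balls on the two sides of the boundary -/

theorem IsPreconnected.subset_of_disjoint_frontier {X : Type*} [TopologicalSpace X] {s t : Set X}
    (hs : IsPreconnected s) (hd : Disjoint s (frontier t)) (hst : (s ∩ t).Nonempty) : s ⊆ t := by
  have hcover : s ⊆ interior t ∪ (closure t)ᶜ := fun x hx => by
    by_contra h
    rw [mem_union, not_or, mem_compl_iff, not_not] at h
    exact Set.disjoint_left.1 hd hx ⟨h.2, h.1⟩
  obtain ⟨x, hx, hxt⟩ := hst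
  have hxi : x ∈ interior t := (hcover hx).resolve_right fun h => h (subset_closure hxt)
  refine (hs.subset_left_of_subset_union isOpen_interior isClosed_closure.isOpen_compl ?_ hcover
    ⟨x, hx, hxi⟩).trans interior_subset
  exact disjoint_compl_right.mono_left (interior_subset.trans subset_closure)

namespace FinitelyConnectedTorus

variable {τ : ℂ} {M : ℕ} (H : FinitelyConnectedTorus τ M)

/-- The ball of radius `|s|` tangent to the boundary at `z`, inside the hole for `s > 0` and outside
of it for `s < 0`. -/
def tangentBall (z : H.boundary) (s : ℝ) : Set ℂ := ball ((z : ℂ) + s * H.normal z) |s|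

theorem isPreconnected_tangentBall (z : H.boundary) (s : ℝ) :
    IsPreconnected (H.tangentBall z s) := (convex_ball _ _).isPreconnected

theorem mem_tangentBall {z : H.boundary} {s r : ℝ} (hr : 0 < r) (hs : 0 < s) (hsr : s < 2 * r) :
    (z : ℂ) + s * H.normal z ∈ H.tangentBall z r := by
  rw [tangentBall, mem_ball, dist_eq_norm, add_sub_add_left_eq_sub, ← sub_mul, norm_mul,
    norm_normal, mul_one, ← ofReal_sub, norm_real, Real.norm_eq_abs, abs_of_pos hr, abs_lt]
  constructor <;> linarith

theorem mem_tangentBall_neg {z : H.boundary} {s r : ℝ} (hr : 0 < r) (hs : 0 < s)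
    (hsr : s < 2 * r) : (z : ℂ) + (-s : ℝ) * H.normal z ∈ H.tangentBall z (-r) := by
  rw [tangentBall, mem_ball, dist_eq_norm, add_sub_add_left_eq_sub, ← sub_mul, norm_mul,
    norm_normal, mul_one, ← ofReal_sub, norm_real, Real.norm_eq_abs, abs_neg, abs_of_pos hr, abs_lt]
  constructor <;> linarith

theorem mem_closure_tangentBall (z : H.boundary) {s : ℝ} (hs : s ≠ 0) :
    (z : ℂ) ∈ closure (H.tangentBall z s) := by
  rw [tangentBall, closure_ball _ (abs_ne_zero.2 hs), mem_closedBall, dist_eq_norm]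
  simp [norm_normal]

/-- All the properties of a radius of tangent balls that are needed in the sequel. -/
structure IsTangentRadius (r : ℝ) : Prop where
  pos : 0 < r
  disjoint : ∀ z : H.boundary, ∀ s : ℝ, |s| ≤ r → Disjoint (H.tangentBall z s) H.boundary
  separation : ∀ j : Fin M, ∀ z ∈ closure (H.D j), ∀ w ∈ ball z (4 * r), ∀ i m n,
    w + latticePoint τ m n ∈ closure (H.D i) → i = j ∧ m = 0 ∧ n = 0

theorem exists_isTangentRadius (hτ : 0 < τ.im) : ∃ r, H.IsTangentRadius r := by
  obtain ⟨r, hr, h⟩ := H.exists_ball_disjoint hτ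
  obtain ⟨δ, hδ, h'⟩ := H.exists_separation hτ
  refine ⟨min r (δ / 4), by positivity, fun z s hs => h z s (hs.trans (min_le_left _ _)), ?_⟩
  intro j z hz w hw
  refine h' j z hz w (ball_subset_ball ?_ hw)
  have := min_le_right r (δ / 4)
  linarith

namespace IsTangentRadius

variable {H} {r : ℝ}

/-- The ball avoids the boundary, and `orientation` supplies one of its points in the hole. -/
theorem tangentBall_subset_D (hr : H.IsTangentRadius r) (j : Fin M) (t : ℝ) : H.tangentBall (H.bdryPoint j t) r ⊆ H.D j := by
  refine (H.isPreconnected_tangentBall _ _).subset_of_disjoint_frontier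
    ((hr.disjoint _ _ (abs_of_pos hr.pos).le).mono_right (H.frontier_subset_boundary j)) ?_
  have hn : 0 < ‖deriv (H.γ j) t‖ := norm_pos_iff.2 (H.deriv_γ_ne_zero j t)
  have h1 : ∀ᶠ s : ℝ in 𝓝[>] 0, s < 2 * r / ‖deriv (H.γ j) t‖ :=
    nhdsWithin_le_nhds (Iio_mem_nhds (div_pos (by linarith [hr.pos]) hn))
  obtain ⟨s, h2, h3, h4⟩ := ((H.orientation j t).and (h1.and self_mem_nhdsWithin)).exists
  refine ⟨_, ?_, h2⟩
  have := H.mem_tangentBall (z := H.bdryPoint j t) hr.pos (mul_pos h4 hn)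
    (by rwa [lt_div_iff₀ hn] at h3)
  rw [normal_eq, ofReal_mul, mul_assoc, mul_comm (‖deriv (H.γ j) t‖ : ℂ),
    unitNormal_mul_norm (H.deriv_γ_ne_zero j t)] at this
  exact this

theorem tangentBall_neg_subset_or (hr : H.IsTangentRadius r) (j : Fin M) (t : ℝ) :
    H.tangentBall (H.bdryPoint j t) (-r) ⊆ H.D j ∨
      Disjoint (H.tangentBall (H.bdryPoint j t) (-r)) (closure (H.D j)) := by
  by_cases h : (H.tangentBall (H.bdryPoint j t) (-r) ∩ H.D j).Nonempty
  · exact .inl ((H.isPreconnected_tangentBall _ _).subset_of_disjoint_frontier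
      ((hr.disjoint _ _ (by rw [abs_neg, abs_of_pos hr.pos])).mono_right
        (H.frontier_subset_boundary j)) h)
  · right
    rw [Set.not_nonempty_iff_eq_empty, ← Set.disjoint_iff_inter_eq_empty] at h
    exact h.closure_right isOpen_ball

theorem center_mem {z : H.boundary} {s : ℝ} (hs : s ≠ 0) :
    (z : ℂ) + s * H.normal z ∈ H.tangentBall z s := mem_ball_self (abs_pos.2 hs)

/-- The orientation says nothing about the other side of the curve. If the hole lay on both sides at
one point, it would do so along the entire curve by connectedness of the parameter line. Its closure
would then be open, hence the whole plane, although the hole is bounded. -/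
theorem disjoint_tangentBall_neg (hr : H.IsTangentRadius r) (j : Fin M) (t : ℝ) :
    Disjoint (H.tangentBall (H.bdryPoint j t) (-r)) (closure (H.D j)) := by
  have hne : -r ≠ 0 := neg_ne_zero.2 hr.pos.ne'
  refine (hr.tangentBall_neg_subset_or j t).resolve_left fun hsub => ?_
  set c : ℝ → ℂ := fun t => H.γ j t + (-r : ℝ) * unitNormal (H.γ j) t with hc
  have hcc : Continuous c := (H.contDiff_γ j).continuous.add
    (continuous_const.mul (continuous_unitNormal (H.contDiff_γ j) (H.deriv_γ_ne_zero j)))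
  have hcm : ∀ s, c s ∈ H.tangentBall (H.bdryPoint j s) (-r) := fun s => by
    have := center_mem (z := H.bdryPoint j s) hne
    rwa [normal_eq] at this
  -- Each ball is inside the hole or disjoint from its closure, so membership of the centre in the
  -- hole is the same as membership in the closure.
  have hA : IsClopen {s | c s ∈ H.D j} := by
    refine ⟨?_, (H.isOpen_D j).preimage hcc⟩
    have : {s | c s ∈ H.D j} = c ⁻¹' closure (H.D j) := by
      ext s
      refine ⟨fun h => subset_closure h, fun h => ?_⟩
      rcases hr.tangentBall_neg_subset_or j s with h' | h'
      · exact h' (hcm s)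
      · exact absurd h (Set.disjoint_left.1 h' (hcm s))
    rw [this]
    exact isClosed_closure.preimage hcc
  have hall : ∀ s, c s ∈ H.D j := fun s => by
    have : s ∈ {s | c s ∈ H.D j} := hA.eq_univ ⟨t, hsub (hcm t)⟩ ▸ mem_univ s
    exact this
  have hin : ∀ s, H.tangentBall (H.bdryPoint j s) (-r) ⊆ H.D j := fun s => by
    refine (hr.tangentBall_neg_subset_or j s).resolve_right fun h => ?_
    exact Set.disjoint_left.1 h (hcm s) (subset_closure (hall s))
  -- A point near ∂D_j is on the curve or in one of the two tangent balls at its nearest boundary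
  -- point, and now both balls are in the hole.
  have hopen : IsOpen (closure (H.D j)) := by
    rw [isOpen_iff_mem_nhds]
    intro z hz
    by_cases hzD : z ∈ H.D j
    · exact mem_of_superset ((H.isOpen_D j).mem_nhds hzD) subset_closure
    have hzf : z ∈ H.boundary := H.frontier_subset_boundary j
      (by rw [(H.isOpen_D j).frontier_eq]; exact ⟨hz, hzD⟩)
    refine mem_of_superset (ball_mem_nhds z hr.pos) fun w hw => ?_
    obtain ⟨ξ, s, hws, hs, hmin⟩ := H.exists_nearest (z := w) ⟨z, hzf⟩
    have hsr : |s| < r := (hmin z hzf).trans_lt (by rwa [← dist_eq_norm])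
    obtain ⟨⟨i, u⟩, rfl⟩ := H.exists_bdryPoint_eq ξ
    have hij : i = j := by
      refine (hr.separation j z hz (H.γ i u) ?_ i 0 0
        (by simpa [latticePoint_zero] using H.γ_mem_closure i u)).1
      have h1 := dist_triangle (H.γ i u) w z
      rw [dist_comm _ w, dist_eq_norm w] at h1
      have h2 : ‖w - H.γ i u‖ < r := hs ▸ hsr
      rw [mem_ball] at hw ⊢
      linarith [hr.pos]
    subst hij
    rcases lt_trichotomy s 0 with h0 | h0 | h0
    · rw [abs_of_neg h0] at hsr
      have := H.mem_tangentBall_neg (z := H.bdryPoint i u) hr.pos (neg_pos.2 h0) (by linarith)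
      rw [neg_neg, ← hws] at this
      exact subset_closure (hin u this)
    · rw [hws, h0]
      simpa [bdryPoint] using H.γ_mem_closure i u
    · rw [abs_of_pos h0] at hsr
      have := H.mem_tangentBall (z := H.bdryPoint i u) hr.pos h0 (by linarith [hr.pos])
      rw [← hws] at this
      exact subset_closure (hr.tangentBall_subset_D i u this)
  have huniv : closure (H.D j) = univ :=
    (show IsClopen (closure (H.D j)) from ⟨isClosed_closure, hopen⟩).eq_univ
      (H.simplyConnected_D j).nonempty.closure
  have hb := (H.isBounded_D j).closure
  rw [huniv] at hb
  exact NormedSpace.unbounded_univ ℝ ℂ hb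

theorem tangentBall_neg_subset_domain (hr : H.IsTangentRadius r) (z : H.boundary) : H.tangentBall z (-r) ⊆ H.domain := by
  obtain ⟨⟨j, t⟩, rfl⟩ := H.exists_bdryPoint_eq z
  intro w hw i m n hi
  have hw2 : w ∈ ball (H.γ j t) (4 * r) := by
    refine ball_subset_ball' ?_ hw
    rw [dist_eq_norm]
    show |-r| + ‖H.γ j t + _ - H.γ j t‖ ≤ _
    rw [add_sub_cancel_left, norm_mul, norm_normal, norm_real, Real.norm_eq_abs, abs_neg,
      abs_of_pos hr.pos]
    linarith [hr.pos]
  obtain ⟨rfl, rfl, rfl⟩ := hr.separation j _ (H.γ_mem_closure j t) w hw2 i m n hi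
  exact Set.disjoint_left.1 (hr.disjoint_tangentBall_neg i t) hw
    (by simpa [latticePoint_zero] using hi)

/-- In normal coordinates a positive signed distance below r would put z in a tangent ball inside a
hole, and a zero one would put it on the boundary. -/
theorem nearest_mem_tangentBall (hr : H.IsTangentRadius r) {z : ℂ} (hz : z ∈ H.domain) {z₀ : H.boundary}
    (hzz₀ : ‖z - z₀‖ < r) :
    ∃ ξ : H.boundary, ∃ s : ℝ, 0 < s ∧ s ≤ ‖z - z₀‖ ∧ z = ξ + (-s : ℝ) * H.normal ξ := by
  obtain ⟨ξ, s, hws, hs, hmin⟩ := H.exists_nearest (z := z) ⟨z₀, z₀.2⟩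
  have hsr := hmin z₀ z₀.2
  refine ⟨ξ, -s, ?_, (neg_le_abs s).trans hsr, by rwa [neg_neg]⟩
  by_contra hneg
  have h0 : 0 ≤ s := by linarith
  rcases h0.eq_or_lt with h0 | h0
  · subst h0
    refine H.notMem_boundary_of_mem_domain hz ?_
    rw [hws]
    simp
  · rw [abs_of_pos h0] at hsr
    have := H.mem_tangentBall (z := ξ) hr.pos h0 (by linarith [hr.pos])
    rw [← hws] at this
    obtain ⟨⟨j, t⟩, rfl⟩ := H.exists_bdryPoint_eq ξ
    exact H.notMem_D_of_mem_domain hz j (hr.tangentBall_subset_D j t this)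

theorem le_norm_sub (hr : H.IsTangentRadius r) {z : H.boundary} {s : ℝ} (hs : |s| ≤ r) {ξ : ℂ} (hξ : ξ ∈ H.boundary) :
    |s| ≤ ‖(z : ℂ) + s * H.normal z - ξ‖ := by
  by_contra hlt
  refine Set.disjoint_left.1 (hr.disjoint z s hs) ?_ hξ
  rw [tangentBall, mem_ball, dist_comm, dist_eq_norm]
  exact not_le.1 hlt

end IsTangentRadius

end FinitelyConnectedTorus

/-! ### Arc length measure and integrals of functions of the distance -/

theorem setLIntegral_Ioc_eq_of_periodic {g : ℝ → ENNReal} (hg : Function.Periodic g 1) (a b : ℝ) :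
    ∫⁻ t in Ioc a (a + 1), g t = ∫⁻ t in Ioc b (b + 1), g t := by
  refine (isAddFundamentalDomain_Ioc one_pos a).setLIntegral_eq
    (isAddFundamentalDomain_Ioc one_pos b) g fun v x => ?_
  obtain ⟨v, n, rfl⟩ := v
  show g (n • (1 : ℝ) + x) = g x
  rw [add_comm]
  exact hg.zsmul n x

namespace FinitelyConnectedTorus

variable {τ : ℂ} {M : ℕ} (H : FinitelyConnectedTorus τ M)

/-- Arc length on the boundary of a hole. -/
noncomputable def holeMeasure (j : Fin M) : Measure H.boundary :=
  Measure.map (H.bdryPoint j) ((volume.restrict (Ioc 0 1)).withDensity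
    fun t => ENNReal.ofReal ‖deriv (H.γ j) t‖)

/-- Arc length on the boundary. -/
noncomputable def arcMeasure : Measure H.boundary := ∑ j, H.holeMeasure j

theorem continuous_deriv_γ (j : Fin M) : Continuous (deriv (H.γ j)) :=
  (H.contDiff_γ j).continuous_deriv (by norm_num)

theorem lintegral_holeMeasure (j : Fin M) {f : H.boundary → ENNReal} (hf : Measurable f) :
    ∫⁻ ξ, f ξ ∂H.holeMeasure j =
      ∫⁻ t in Ioc 0 1, ENNReal.ofReal ‖deriv (H.γ j) t‖ * f (H.bdryPoint j t) := by
  have hm := (H.continuous_deriv_γ j).measurable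
  rw [holeMeasure, lintegral_map hf (H.continuous_bdryPoint j).measurable,
    lintegral_withDensity_eq_lintegral_mul _ (by fun_prop) (g := fun t => f (H.bdryPoint j t))
      (hf.comp (H.continuous_bdryPoint j).measurable)]
  rfl

instance (j : Fin M) : IsFiniteMeasure (H.holeMeasure j) := by
  refine ⟨?_⟩
  rw [← lintegral_one, H.lintegral_holeMeasure j measurable_const]
  obtain ⟨C, hC, h⟩ := H.exists_deriv_le
  calc _ ≤ ∫⁻ t in Ioc (0 : ℝ) 1, ENNReal.ofReal C := by
        refine lintegral_mono fun t => ?_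
        rw [mul_one]
        exact ENNReal.ofReal_le_ofReal (h j t)
    _ < ⊤ := by simp

instance : IsFiniteMeasure H.arcMeasure := by
  unfold arcMeasure
  infer_instance

theorem integral_holeMeasure (j : Fin M) {E : Type*} [NormedAddCommGroup E] [NormedSpace ℝ E]
    {f : H.boundary → E} (hf : AEStronglyMeasurable f (H.holeMeasure j)) :
    ∫ ξ, f ξ ∂H.holeMeasure j =
      ∫ t in (0 : ℝ)..1, ‖deriv (H.γ j) t‖ • f (H.bdryPoint j t) := by
  have hm := (H.continuous_deriv_γ j).measurable
  rw [holeMeasure, integral_map (H.continuous_bdryPoint j).measurable.aemeasurable hf,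
    integral_withDensity_eq_integral_toReal_smul (by fun_prop) (by simp),
    intervalIntegral.integral_of_le zero_le_one]
  simp

theorem holeIntegral_eq (j : Fin M) {f : H.boundary → ℝ}
    (hf : AEStronglyMeasurable f (H.holeMeasure j)) :
    H.holeIntegral j f = ∫ ξ, f ξ ∂H.holeMeasure j := by
  rw [H.integral_holeMeasure j hf, holeIntegral]
  simp [mul_comm]

theorem holeMeasure_le (j : Fin M) : H.holeMeasure j ≤ H.arcMeasure :=
  Finset.single_le_sum (f := H.holeMeasure) (fun _ _ => Measure.zero_le _) (Finset.mem_univ j)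

theorem integral_arcMeasure {E : Type*} [NormedAddCommGroup E] [NormedSpace ℝ E]
    {f : H.boundary → E} (hf : Integrable f H.arcMeasure) :
    ∫ ξ, f ξ ∂H.arcMeasure = ∑ j, ∫ ξ, f ξ ∂H.holeMeasure j :=
  integral_finsetSum_measure fun j _ => hf.mono_measure (H.holeMeasure_le j)

theorem bdryIntegral_eq {f : H.boundary → ℝ} (hf : Integrable f H.arcMeasure) :
    H.bdryIntegral f = ∫ ξ, f ξ ∂H.arcMeasure := by
  rw [H.integral_arcMeasure hf, bdryIntegral]
  exact Finset.sum_congr rfl fun j _ =>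
    H.holeIntegral_eq j (hf.mono_measure (H.holeMeasure_le j)).aestronglyMeasurable

theorem integrable_of_continuous {E : Type*} [NormedAddCommGroup E] {f : H.boundary → E}
    (hf : Continuous f) (μ : Measure H.boundary) [IsFiniteMeasure μ] : Integrable f μ :=
  (integrableOn_univ (μ := μ)).1 (hf.continuousOn.integrableOn_compact isCompact_univ)

/-- The integral over the boundary of a function of the distance is controlled by the integral over
an interval. -/
theorem exists_lintegral_le : ∃ C : ENNReal, C ≠ ⊤ ∧ ∃ c > 0, ∀ (z : ℂ) (f : ℝ → ENNReal),
    Measurable f → AntitoneOn f (Ioi 0) →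
    ∫⁻ ξ, f ‖z - ξ‖ ∂H.arcMeasure ≤ C * ∫⁻ x in Icc (-(1 / 2)) (1 / 2), f (c * |x|) := by
  obtain ⟨A, hA, hA'⟩ := H.exists_deriv_le
  obtain ⟨c, hc, hc'⟩ := H.exists_chord_ge
  refine ⟨M * ENNReal.ofReal A, ENNReal.mul_ne_top (by simp) (by simp), c / 2, by positivity,
    fun z f hf hanti => ?_⟩
  have key : ∀ j, ∫⁻ ξ, f ‖z - ξ‖ ∂H.holeMeasure j ≤
      ENNReal.ofReal A * ∫⁻ x in Icc (-(1 / 2)) (1 / 2), f (c / 2 * |x|) := fun j => by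
    -- For γ(t₀) nearest to z, |γ(t) - γ(t₀)| ≤ 2|z - γ(t)|. So the chord bound gives |z - γ(t)| ≥
    -- (c/2)|t - t₀| on the period centred at t₀, with a constant independent of z.
    obtain ⟨ξ, hξ, hmin⟩ := (H.isCompact_frontier j).exists_isMinOn ⟨_, H.γ_mem_frontier j 0⟩
      (f := fun ξ => ‖z - ξ‖) (by fun_prop)
    rw [← H.range_γ j] at hξ
    obtain ⟨t₀, rfl⟩ := hξ
    have hp : Function.Periodic (fun t => ENNReal.ofReal ‖deriv (H.γ j) t‖ *
        f ‖z - H.bdryPoint j t‖) 1 := fun t => by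
      simp only [(H.periodic_γ j).deriv_one t, H.bdryPoint_periodic j t]
    rw [H.lintegral_holeMeasure j (f := fun ξ : H.boundary => f ‖z - ξ‖) (hf.comp (by fun_prop))]
    have h1 := setLIntegral_Ioc_eq_of_periodic hp 0 (t₀ - 1 / 2)
    rw [zero_add] at h1
    rw [h1]
    have h2 : ∫⁻ x in Icc (-(1 / 2)) (1 / 2), f (c / 2 * |x|) =
        ∫⁻ t in Icc (t₀ - 1 / 2) (t₀ + 1 / 2), f (c / 2 * |t - t₀|) := by
      have hmp := measurePreserving_sub_right (volume : Measure ℝ) t₀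
      have := hmp.setLIntegral_comp_preimage (measurableSet_Icc (a := -(1 / 2 : ℝ)) (b := 1 / 2))
        (f := fun x => f (c / 2 * |x|)) (by fun_prop)
      rw [← this, preimage_sub_const_Icc]
      congr 3 <;> ring
    rw [h2, ← lintegral_const_mul _ (by fun_prop)]
    have h3 : t₀ - 1 / 2 + 1 = t₀ + 1 / 2 := by ring
    rw [h3]
    refine (lintegral_mono_set Ioc_subset_Icc_self).trans ?_
    refine lintegral_mono_ae ?_
    have hne : ∀ᵐ t : ℝ ∂volume.restrict (Icc (t₀ - 1 / 2) (t₀ + 1 / 2)), t ≠ t₀ :=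
      ae_restrict_of_ae (Measure.ae_ne volume t₀)
    filter_upwards [hne, ae_restrict_mem measurableSet_Icc] with t ht htI
    refine mul_le_mul' (ENNReal.ofReal_le_ofReal (hA' j t)) ?_
    have h4 : 0 < |t - t₀| := abs_pos.2 (sub_ne_zero.2 ht)
    have h5 : c / 2 * |t - t₀| ≤ ‖z - H.bdryPoint j t‖ := by
      have h6 := hc' j t₀ (t - t₀) (abs_le.2 ⟨by linarith [htI.1], by linarith [htI.2]⟩)
      rw [add_sub_cancel] at h6
      have h7 : ‖z - H.γ j t₀‖ ≤ ‖z - H.γ j t‖ := hmin (H.γ_mem_frontier j t)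
      have h8 := norm_sub_le (z - H.γ j t₀) (z - H.γ j t)
      rw [sub_sub_sub_cancel_left] at h8
      show _ ≤ ‖z - H.γ j t‖
      linarith
    exact hanti (mem_Ioi.2 (by positivity)) (mem_Ioi.2 (lt_of_lt_of_le (by positivity) h5)) h5
  rw [arcMeasure, lintegral_finsetSum_measure]
  refine (Finset.sum_le_sum fun j _ => key j).trans ?_
  simp [mul_assoc]

/-- The comparison with an interval is applied to the indicator of (-∞, 0], which sees only the
points at distance zero. -/
instance : NullSingletonClass H.arcMeasure := by
  refine ⟨fun z => ?_⟩
  obtain ⟨C, hC, c, hc, h⟩ := H.exists_lintegral_le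
  have h1 := h z ((Iic 0).indicator 1) (measurable_one.indicator measurableSet_Iic)
    fun a ha b hb _ => by simp [indicator, not_le.2 (mem_Ioi.1 ha), not_le.2 (mem_Ioi.1 hb)]
  have h2 : ∫⁻ x in Icc (-(1 / 2) : ℝ) (1 / 2),
      (Iic (0 : ℝ)).indicator (1 : ℝ → ENNReal) (c * |x|) = 0 := by
    rw [lintegral_eq_zero_iff (f := fun x : ℝ => (Iic (0 : ℝ)).indicator (1 : ℝ → ENNReal) (c * |x|))
      ((measurable_one.indicator measurableSet_Iic).comp (by fun_prop))]
    filter_upwards [ae_restrict_of_ae (Measure.ae_ne volume (0 : ℝ))] with x hx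
    have : 0 < c * |x| := mul_pos hc (abs_pos.2 hx)
    simp [indicator, not_le.2 this]
  rw [h2, mul_zero] at h1
  refine le_antisymm (le_trans ?_ h1) (zero_le)
  rw [← lintegral_indicator_one (measurableSet_singleton z)]
  refine lintegral_mono fun ξ => ?_
  by_cases hξ : ξ = z
  · subst hξ
    simp
  · simp [hξ]

theorem lintegral_rpow_neg_half_lt_top :
    ∫⁻ x in Icc (-(1 / 2) : ℝ) (1 / 2), ENNReal.ofReal (√|x|)⁻¹ < ⊤ := by
  have h1 : IntervalIntegrable (fun x : ℝ => |x| ^ (-(1 / 2) : ℝ)) volume 0 (1 / 2) := by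
    refine (intervalIntegral.intervalIntegrable_rpow' (r := -(1 / 2)) (by norm_num)).congr_ae ?_
    filter_upwards [ae_restrict_mem measurableSet_uIoc] with x hx
    rw [uIoc_of_le (by norm_num)] at hx
    rw [abs_of_pos hx.1]
  have h2 : IntervalIntegrable (fun x : ℝ => |x| ^ (-(1 / 2) : ℝ)) volume (-(1 / 2)) 0 := by
    have := (IntervalIntegrable.iff_comp_neg (f := fun x : ℝ => |x| ^ (-(1 / 2) : ℝ)) (by simp)).1 h1.symm
    simpa using this
  have h3 := (h2.trans h1)
  rw [intervalIntegrable_iff_integrableOn_Icc_of_le (by norm_num)] at h3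
  have h4 := h3.lintegral_lt_top
  refine (lintegral_congr fun x => ?_).trans_lt h4
  rw [Real.rpow_neg (abs_nonneg _), Real.sqrt_eq_rpow]

/-- Reduces to the integrability of |x|^{-1/2}. The weight dominates the error of truncating the
logarithm at scale ε; the case ε = 1 is used to bound the gradient. -/
theorem exists_lintegral_sqrt_le : ∃ C : ℝ, ∀ (z : ℂ) (ε : ℝ), 0 ≤ ε →
    ∫⁻ ξ, ENNReal.ofReal (2 * √(ε / ‖z - ξ‖)) ∂H.arcMeasure ≤ ENNReal.ofReal (C * √ε) := by
  obtain ⟨C, hC, c, hc, h⟩ := H.exists_lintegral_le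
  set K := ∫⁻ x in Icc (-(1 / 2) : ℝ) (1 / 2), ENNReal.ofReal (√|x|)⁻¹ with hK
  have hKt : K ≠ ⊤ := lintegral_rpow_neg_half_lt_top.ne
  refine ⟨(C * (ENNReal.ofReal (2 / √c) * K)).toReal, fun z ε hε => ?_⟩
  have h1 := h z (fun y => ENNReal.ofReal (2 * √(ε / y))) (by fun_prop) fun a ha b hb hab => by
    have : (0 : ℝ) < a := ha
    dsimp only
    gcongr
  refine h1.trans ?_
  rw [ENNReal.ofReal_mul ENNReal.toReal_nonneg, ENNReal.ofReal_toReal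
    (ENNReal.mul_ne_top hC (ENNReal.mul_ne_top (by simp) hKt)), mul_assoc]
  gcongr
  rw [hK, mul_assoc, ← lintegral_mul_const _ (by fun_prop), ← lintegral_const_mul _ (by fun_prop)]
  refine lintegral_mono fun x => ?_
  rw [← ENNReal.ofReal_mul (by positivity), ← ENNReal.ofReal_mul (by positivity)]
  apply ENNReal.ofReal_le_ofReal
  rw [Real.sqrt_div hε, Real.sqrt_mul hc.le]
  apply le_of_eq
  field_simp

/-- The comparison integral s/(s² + c²x²) over the whole line equals π/c for every s. -/
theorem exists_lintegral_poisson_le : ∃ C : ℝ, ∀ (z : ℂ) (s : ℝ), 0 < s →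
    ∫⁻ ξ, ENNReal.ofReal (s / (s ^ 2 + ‖z - ξ‖ ^ 2)) ∂H.arcMeasure ≤ ENNReal.ofReal C := by
  obtain ⟨C, hC, c, hc, h⟩ := H.exists_lintegral_le
  refine ⟨(C * ENNReal.ofReal (Real.pi / c)).toReal, fun z s hs => ?_⟩
  have h1 := h z (fun y => ENNReal.ofReal (s / (s ^ 2 + y ^ 2))) (by fun_prop) fun a ha b hb hab => by
    have : (0 : ℝ) < a := ha
    dsimp only
    gcongr
  refine h1.trans ?_
  rw [ENNReal.ofReal_toReal (ENNReal.mul_ne_top hC (by simp))]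
  gcongr
  have h2 : Integrable fun x : ℝ => s⁻¹ * (1 + (c / s * x) ^ 2)⁻¹ :=
    (integrable_inv_one_add_sq.comp_mul_left' (by positivity)).const_mul _
  have h3 : ∫ x : ℝ, s⁻¹ * (1 + (c / s * x) ^ 2)⁻¹ = Real.pi / c := by
    rw [integral_const_mul, Measure.integral_comp_mul_left (fun x : ℝ => (1 + x ^ 2)⁻¹),
      integral_univ_inv_one_add_sq, abs_of_pos (by positivity), smul_eq_mul]
    field_simp
  rw [← h3, ofReal_integral_eq_lintegral_ofReal h2 (.of_forall fun x => by positivity)]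
  refine (setLIntegral_le_lintegral _ _).trans (lintegral_mono fun x => ?_)
  apply ENNReal.ofReal_le_ofReal
  rw [mul_pow, sq_abs]
  apply le_of_eq
  field_simp

end FinitelyConnectedTorus

/-! ### Integrals of kernels over the boundary: continuity and differentiation -/

namespace FinitelyConnectedTorus

variable {τ : ℂ} {M : ℕ} (H : FinitelyConnectedTorus τ M)

/-- A closed thickening of the compact set z₀ - ∂Ω still lies in W. This provides the uniform bounds
for dominated convergence near z₀. -/
theorem exists_compact_of_sub_mem {W : Set ℂ} (hW : IsOpen W) {z₀ : ℂ}
    (h : ∀ ξ ∈ H.boundary, z₀ - ξ ∈ W) :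
    ∃ K ⊆ W, IsCompact K ∧ ∃ δ > 0, ∀ z ∈ ball z₀ δ, ∀ ξ ∈ H.boundary, z - ξ ∈ K := by
  have hc : IsCompact ((fun ξ => z₀ - ξ) '' H.boundary) :=
    H.isCompact_boundary.image (by fun_prop)
  obtain ⟨δ, hδ, h'⟩ := hc.exists_cthickening_subset_open hW (image_subset_iff.2 h)
  refine ⟨_, h', hc.cthickening, δ, hδ, fun z hz ξ hξ => ?_⟩
  refine mem_cthickening_of_dist_le _ (z₀ - ξ) _ _ (mem_image_of_mem _ hξ) ?_
  rw [dist_sub_right]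
  exact (mem_ball.1 hz).le

theorem isOpen_offBoundary (hτ : 0 < τ.im) : IsOpen H.offBoundary := by
  rw [isOpen_iff_mem_nhds]
  intro z₀ hz₀
  obtain ⟨K, hKW, -, δ, hδ, h⟩ := H.exists_compact_of_sub_mem (isOpen_latticeCompl hτ) hz₀
  exact mem_of_superset (ball_mem_nhds z₀ hδ) fun z hz ξ hξ => hKW (h z hz ξ hξ)

theorem continuous_comp_sub {X : Type*} [TopologicalSpace X] {F : ℂ → X} {W : Set ℂ}
    (hF : ContinuousOn F W) {z : ℂ} (h : ∀ ξ ∈ H.boundary, z - ξ ∈ W) :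
    Continuous fun ξ : H.boundary => F (z - ξ) :=
  hF.comp_continuous (by fun_prop) fun ξ => h ξ ξ.2

theorem continuousAt_integral_sub {𝕜 E : Type*} [RCLike 𝕜] [NormedAddCommGroup E] [NormedSpace ℝ E]
    [NormedSpace 𝕜 E] {W : Set ℂ} (hW : IsOpen W) {F : ℂ → E} (hF : ContinuousOn F W)
    (φ : C(H.boundary, 𝕜)) (μ : Measure H.boundary) [IsFiniteMeasure μ] {z₀ : ℂ}
    (h : ∀ ξ ∈ H.boundary, z₀ - ξ ∈ W) :
    ContinuousAt (fun z => ∫ ξ, φ ξ • F (z - ξ) ∂μ) z₀ := by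
  obtain ⟨K, hKW, hK, δ, hδ, hKδ⟩ := H.exists_compact_of_sub_mem hW h
  obtain ⟨A, hA⟩ := hK.exists_bound_of_continuousOn (hF.mono hKW)
  have hb := ball_mem_nhds z₀ hδ
  refine continuousAt_of_dominated (bound := fun _ => ‖φ‖ * A) ?_ ?_ (integrable_const _) ?_
  · filter_upwards [hb] with z hz
    exact (φ.continuous.smul (H.continuous_comp_sub hF fun ξ hξ => hKW (hKδ z hz ξ hξ))).aestronglyMeasurable
  · filter_upwards [hb] with z hz
    refine .of_forall fun ξ => ?_
    rw [norm_smul]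
    gcongr
    · exact φ.norm_coe_le_norm ξ
    · exact hA _ (hKδ z hz ξ ξ.2)
  · refine .of_forall fun ξ => ContinuousAt.const_smul ?_ _
    exact (hF.continuousAt (hW.mem_nhds (h ξ ξ.2))).comp (f := fun z : ℂ => z - ξ)
      (by fun_prop)

/-- The field is left open because the potential is differentiated over ℝ and its gradient over ℂ.
-/
theorem hasFDerivAt_integral_sub {𝕜 E : Type*} [RCLike 𝕜] [NormedAddCommGroup E] [NormedSpace ℝ E]
    [NormedSpace 𝕜 E] [NormedSpace 𝕜 ℂ] {W : Set ℂ} (hW : IsOpen W) {F : ℂ → E}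
    {F' : ℂ → ℂ →L[𝕜] E} (hF : ∀ z ∈ W, HasFDerivAt F (F' z) z) (hF' : ContinuousOn F' W)
    (φ : C(H.boundary, 𝕜)) (μ : Measure H.boundary) [IsFiniteMeasure μ] {z₀ : ℂ}
    (h : ∀ ξ ∈ H.boundary, z₀ - ξ ∈ W) :
    HasFDerivAt (fun z => ∫ ξ, φ ξ • F (z - ξ) ∂μ) (∫ ξ, φ ξ • F' (z₀ - ξ) ∂μ) z₀ := by
  have hFc : ContinuousOn F W := fun z hz => (hF z hz).continuousAt.continuousWithinAt
  obtain ⟨K, hKW, hK, δ, hδ, hKδ⟩ := H.exists_compact_of_sub_mem hW h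
  obtain ⟨A, hA⟩ := hK.exists_bound_of_continuousOn (hF'.mono hKW)
  have hb := ball_mem_nhds z₀ hδ
  have hc : ∀ z ∈ ball z₀ δ, Continuous fun ξ : H.boundary => φ ξ • F (z - ξ) := fun z hz =>
    φ.continuous.smul (H.continuous_comp_sub hFc fun ξ hξ => hKW (hKδ z hz ξ hξ))
  refine hasFDerivAt_integral_of_dominated_of_fderiv_le (bound := fun _ => ‖φ‖ * A)
    (F' := fun z (ξ : H.boundary) => φ ξ • F' (z - ξ)) hb ?_
    (H.integrable_of_continuous (hc z₀ (mem_ball_self hδ)) μ)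
    (φ.continuous.smul (H.continuous_comp_sub hF' h)).aestronglyMeasurable
    (.of_forall fun ξ z hz => ?_) (integrable_const _) (.of_forall fun ξ z hz => ?_)
  · filter_upwards [hb] with z hz
    exact (hc z hz).aestronglyMeasurable
  · rw [norm_smul]
    gcongr
    · exact φ.norm_coe_le_norm ξ
    · exact hA _ (hKδ z hz ξ ξ.2)
  · refine HasFDerivAt.const_smul ?_ (φ ξ)
    have := (hF _ (hKW (hKδ z hz ξ ξ.2))).comp z ((hasFDerivAt_id (𝕜 := 𝕜) z).sub_const (ξ : ℂ))
    simpa [Function.comp_def] using this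

/-- From log √y ≤ √y - 1 with y = ε/x. -/
theorem norm_log_sub_log_max_le {x ε : ℝ} (hx : 0 < x) (hε : 0 < ε) :
    ‖Real.log x - Real.log (max x ε)‖ ≤ 2 * √(ε / x) := by
  rcases le_total ε x with h | h
  · rw [max_eq_left h]
    simp
  · rw [max_eq_right h, norm_sub_rev, ← Real.log_div hε.ne' hx.ne', Real.norm_of_nonneg
      (Real.log_nonneg ((one_le_div hx).2 h))]
    have h1 : 0 < ε / x := by positivity
    have h2 := Real.log_le_sub_one_of_pos (Real.sqrt_pos.2 h1)
    rw [Real.log_sqrt h1.le] at h2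
    linarith

theorem continuous_log_max {ε : ℝ} (hε : 0 < ε) :
    Continuous fun w : ℂ => Real.log (max ‖w‖ ε) :=
  Continuous.log (by fun_prop) fun w => (lt_max_of_lt_right hε).ne'

theorem ae_ne (z : ℂ) : ∀ᵐ ξ : H.boundary ∂H.arcMeasure, z - ξ ≠ 0 := by
  by_cases hz : z ∈ H.boundary
  · filter_upwards [Measure.ae_ne H.arcMeasure ⟨z, hz⟩] with ξ hξ h
    exact hξ (Subtype.ext (sub_eq_zero.1 h).symm)
  · exact .of_forall fun ξ h => hz ((sub_eq_zero.1 h) ▸ ξ.2)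

theorem exists_integral_log_sub_le :
    ∃ C : ℝ, ∀ (z : ℂ) (ε : ℝ), 0 < ε →
      Integrable (fun ξ : H.boundary => Real.log ‖z - ξ‖ - Real.log (max ‖z - ξ‖ ε)) H.arcMeasure ∧
      ∫ ξ : H.boundary, ‖Real.log ‖z - ξ‖ - Real.log (max ‖z - ξ‖ ε)‖ ∂H.arcMeasure ≤
        C * √ε := by
  obtain ⟨C, hC⟩ := H.exists_lintegral_sqrt_le
  refine ⟨max C 0, fun z ε hε => ?_⟩
  have hm : AEStronglyMeasurable (fun ξ : H.boundary =>
      Real.log ‖z - ξ‖ - Real.log (max ‖z - ξ‖ ε)) H.arcMeasure := by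
    refine Measurable.aestronglyMeasurable ?_
    fun_prop
  have hle : ∫⁻ ξ : H.boundary, ‖Real.log ‖z - ξ‖ - Real.log (max ‖z - ξ‖ ε)‖ₑ ∂H.arcMeasure ≤
      ENNReal.ofReal (C * √ε) := by
    refine le_trans (lintegral_mono_ae ?_) (hC z ε hε.le)
    filter_upwards [H.ae_ne z] with ξ hξ
    rw [← ofReal_norm]
    exact ENNReal.ofReal_le_ofReal (norm_log_sub_log_max_le (norm_pos_iff.2 hξ) hε)
  refine ⟨⟨hm, hle.trans_lt ENNReal.ofReal_lt_top⟩, ?_⟩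
  rw [integral_norm_eq_lintegral_enorm hm]
  refine ENNReal.toReal_le_of_le_ofReal (by positivity) (hle.trans (ENNReal.ofReal_le_ofReal ?_))
  gcongr
  exact le_max_left _ _

theorem integrable_log_max (z : ℂ) {ε : ℝ} (hε : 0 < ε) :
    Integrable (fun ξ : H.boundary => Real.log (max ‖z - ξ‖ ε)) H.arcMeasure :=
  H.integrable_of_continuous ((continuous_log_max hε).comp (by fun_prop)) _

theorem integrable_log_norm_sub (z : ℂ) :
    Integrable (fun ξ : H.boundary => Real.log ‖z - ξ‖) H.arcMeasure := by
  obtain ⟨C, hC⟩ := H.exists_integral_log_sub_le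
  refine ((hC z 1 one_pos).1.add (H.integrable_log_max z one_pos)).congr (.of_forall fun ξ => ?_)
  simp

/-- A uniform limit of continuous functions: truncating the kernel to log max(|w|, ε) changes the
integral by at most ‖φ‖ C √ε, uniformly in z. -/
theorem continuous_integral_log (φ : C(H.boundary, ℝ)) :
    Continuous fun z : ℂ => ∫ ξ : H.boundary, φ ξ • Real.log ‖z - ξ‖ ∂H.arcMeasure := by
  obtain ⟨C, hC⟩ := H.exists_integral_log_sub_le
  refine continuous_of_uniform_approx_of_continuous fun u hu => ?_
  obtain ⟨δ, hδ, hu⟩ := Metric.mem_uniformity_dist.1 hu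
  have ht : Tendsto (fun ε : ℝ => ‖φ‖ * (C * √ε)) (𝓝[>] 0) (𝓝 0) := by
    refine Tendsto.mono_left (Continuous.tendsto' (by fun_prop) _ _ ?_) nhdsWithin_le_nhds
    simp
  obtain ⟨ε, hε, hε0⟩ := ((ht.eventually_lt_const hδ).and self_mem_nhdsWithin).exists
  refine ⟨fun z => ∫ ξ : H.boundary, φ ξ • Real.log (max ‖z - ξ‖ ε) ∂H.arcMeasure,
    continuous_iff_continuousAt.2 fun z => H.continuousAt_integral_sub isOpen_univ
      (continuous_log_max hε0).continuousOn φ _ fun _ _ => mem_univ _, fun z => hu ?_⟩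
  have hi : ∀ {f : H.boundary → ℝ}, Integrable f H.arcMeasure →
      Integrable (fun ξ => φ ξ • f ξ) H.arcMeasure := fun hf =>
    hf.bdd_mul φ.continuous.aestronglyMeasurable (.of_forall fun ξ => φ.norm_coe_le_norm ξ)
  rw [dist_eq_norm, ← integral_sub (hi (H.integrable_log_norm_sub z)) (hi (H.integrable_log_max z hε0))]
  refine lt_of_le_of_lt ?_ hε
  simp_rw [← smul_sub]
  refine (norm_integral_le_integral_norm _).trans ?_
  refine le_trans ?_ (mul_le_mul_of_nonneg_left (hC z ε hε0).2 (norm_nonneg φ))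
  rw [← integral_const_mul]
  refine integral_mono_of_nonneg (.of_forall fun _ => norm_nonneg _)
    ((hC z ε hε0).1.norm.const_mul _) (.of_forall fun ξ => ?_)
  simp only [norm_smul]
  gcongr
  exact φ.norm_coe_le_norm ξ

end FinitelyConnectedTorus

/-! ### The single layer potential on the torus -/

theorem differentiableOn_logDeriv_jacobiThetaOne {τ : ℂ} (hτ : 0 < τ.im) :
    DifferentiableOn ℂ (logDeriv (jacobiThetaOne τ)) (latticeCompl τ) := by
  intro w hw
  have hd := differentiable_jacobiThetaOne hτ
  refine DifferentiableAt.differentiableWithinAt ?_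
  refine DifferentiableAt.div (hd.deriv w) (hd w) fun h => ?_
  obtain ⟨m, n, h⟩ := (jacobiThetaOne_eq_zero_iff hτ).1 h
  exact (mem_latticeCompl hτ).1 hw m n h

namespace FinitelyConnectedTorus

variable {τ : ℂ} {M : ℕ} (H : FinitelyConnectedTorus τ M)

/-- A point off all translates of the boundary needs no shift; any other point is shifted onto the
boundary itself, where differences avoid the nonzero lattice points. By periodicity only the
singularity at the origin then has to be treated. -/
theorem exists_add_latticePoint_sub_mem_regSet (hτ : 0 < τ.im) (z : ℂ) :
    ∃ m n, ∀ ξ ∈ H.boundary, z + latticePoint τ m n - ξ ∈ regSet τ := by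
  by_cases hz : z ∈ H.offBoundary
  · exact ⟨0, 0, fun ξ hξ => by
      simpa [latticePoint] using ((mem_latticeCompl_iff τ).1 (hz ξ hξ)).2⟩
  · simp only [offBoundary, mem_ofPred_eq, not_forall] at hz
    obtain ⟨ξ, hξ, h⟩ := hz
    rw [mem_latticeCompl hτ] at h
    push Not at h
    obtain ⟨m, n, h⟩ := h
    refine ⟨-m, -n, fun ξ' hξ' => ?_⟩
    have : z + latticePoint τ (-m) (-n) = ξ := by
      rw [latticePoint_neg, ← h]
      ring
    rw [this]
    obtain ⟨j, t, rfl⟩ := H.exists_of_mem_boundary hξ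
    obtain ⟨k, s, rfl⟩ := H.exists_of_mem_boundary hξ'
    exact H.sub_mem_regSet hτ (H.γ_mem_closure j t) (H.γ_mem_closure k s)

theorem ae_sub_mem_latticeCompl (hτ : 0 < τ.im) (z : ℂ) :
    ∀ᵐ ξ : H.boundary ∂H.arcMeasure, z - ξ ∈ latticeCompl τ := by
  have hc : {ξ : H.boundary | z - ξ ∉ latticeCompl τ}.Countable := by
    have h1 : (range fun p : ℤ × ℤ => z - latticePoint τ p.1 p.2).Countable := countable_range _
    refine (h1.preimage (f := ((↑) : H.boundary → ℂ)) Subtype.val_injective).mono fun ξ hξ => ?_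
    rw [mem_ofPred_eq, mem_latticeCompl hτ] at hξ
    push Not at hξ
    obtain ⟨m, n, h⟩ := hξ
    exact ⟨(m, n), by simp [← h]⟩
  exact hc.measure_zero _

theorem integral_torusGreen_of_mem_regSet (hτ : 0 < τ.im) (φ : C(H.boundary, ℝ)) {z : ℂ}
    (h : ∀ ξ ∈ H.boundary, z - ξ ∈ regSet τ) :
    Integrable (fun ξ : H.boundary => φ ξ • torusGreen τ (z - ξ)) H.arcMeasure ∧
    ∫ ξ : H.boundary, φ ξ • torusGreen τ (z - ξ) ∂H.arcMeasure =
      -(1 / (2 * Real.pi)) * ∫ ξ : H.boundary, φ ξ • Real.log ‖z - ξ‖ ∂H.arcMeasure +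
        ∫ ξ : H.boundary, φ ξ • greenReg τ (z - ξ) ∂H.arcMeasure := by
  have h1 : Integrable (fun ξ : H.boundary => φ ξ • Real.log ‖z - ξ‖) H.arcMeasure :=
    (H.integrable_log_norm_sub z).bdd_mul φ.continuous.aestronglyMeasurable
      (.of_forall fun ξ => φ.norm_coe_le_norm ξ)
  have h2 : Integrable (fun ξ : H.boundary => φ ξ • greenReg τ (z - ξ)) H.arcMeasure :=
    H.integrable_of_continuous
      (φ.continuous.smul (H.continuous_comp_sub (continuousOn_greenReg hτ) h)) _
  have h3 : (fun ξ : H.boundary => φ ξ • torusGreen τ (z - ξ)) =ᵐ[H.arcMeasure] fun ξ =>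
      -(1 / (2 * Real.pi)) * (φ ξ • Real.log ‖z - ξ‖) + φ ξ • greenReg τ (z - ξ) := by
    filter_upwards [H.ae_ne z] with ξ hξ
    rw [torusGreen_eq τ hξ (h ξ ξ.2)]
    simp only [smul_eq_mul]
    ring
  refine ⟨((h1.const_mul _).add h2).congr h3.symm, ?_⟩
  rw [integral_congr_ae h3, integral_add (h1.const_mul _) h2, integral_const_mul]

theorem ae_torusGreen_add_latticePoint (hτ : 0 < τ.im) (φ : C(H.boundary, ℝ)) (z : ℂ) (m n : ℤ) :
    (fun ξ : H.boundary => φ ξ • torusGreen τ (z + latticePoint τ m n - ξ)) =ᵐ[H.arcMeasure]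
      fun ξ => φ ξ • torusGreen τ (z - ξ) := by
  filter_upwards [H.ae_sub_mem_latticeCompl hτ z] with ξ hξ
  rw [add_sub_right_comm, torusGreen_add_latticePoint hτ hξ]

theorem integrable_torusGreen (hτ : 0 < τ.im) (φ : C(H.boundary, ℝ)) (z : ℂ) :
    Integrable (fun ξ : H.boundary => φ ξ • torusGreen τ (z - ξ)) H.arcMeasure := by
  obtain ⟨m, n, h⟩ := H.exists_add_latticePoint_sub_mem_regSet hτ z
  exact (H.integral_torusGreen_of_mem_regSet hτ φ h).1.congr
    (H.ae_torusGreen_add_latticePoint hτ φ z m n)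

theorem singleLayer_eq (hτ : 0 < τ.im) (φ : C(H.boundary, ℝ)) (z : ℂ) :
    H.singleLayer φ z = ∫ ξ : H.boundary, φ ξ • torusGreen τ (z - ξ) ∂H.arcMeasure := by
  unfold singleLayer
  simp only [mul_comm (torusGreen τ _)]
  exact H.bdryIntegral_eq (H.integrable_torusGreen hτ φ z)

theorem singleLayer_add_latticePoint (hτ : 0 < τ.im) (φ : C(H.boundary, ℝ)) (z : ℂ) (m n : ℤ) :
    H.singleLayer φ (z + latticePoint τ m n) = H.singleLayer φ z := by
  rw [H.singleLayer_eq hτ, H.singleLayer_eq hτ]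
  exact integral_congr_ae (H.ae_torusGreen_add_latticePoint hτ φ z m n)

theorem continuous_singleLayer (hτ : 0 < τ.im) (φ : C(H.boundary, ℝ)) :
    Continuous (H.singleLayer φ) := by
  rw [continuous_iff_continuousAt]
  have key : ∀ z : ℂ, (∀ ξ ∈ H.boundary, z - ξ ∈ regSet τ) →
      ContinuousAt (H.singleLayer φ) z := by
    intro z h
    obtain ⟨K, hKW, -, δ, hδ, hK⟩ := H.exists_compact_of_sub_mem (isOpen_regSet hτ) h
    have he : H.singleLayer φ =ᶠ[𝓝 z] fun z =>
        -(1 / (2 * Real.pi)) * ∫ ξ : H.boundary, φ ξ • Real.log ‖z - ξ‖ ∂H.arcMeasure +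
        ∫ ξ : H.boundary, φ ξ • greenReg τ (z - ξ) ∂H.arcMeasure := by
      filter_upwards [ball_mem_nhds z hδ] with w hw
      rw [H.singleLayer_eq hτ]
      exact (H.integral_torusGreen_of_mem_regSet hτ φ fun ξ hξ => hKW (hK w hw ξ hξ)).2
    refine ContinuousAt.congr ?_ he.symm
    exact ((H.continuous_integral_log φ).continuousAt.const_mul _).add
      (H.continuousAt_integral_sub (isOpen_regSet hτ) (continuousOn_greenReg hτ) φ _ h)
  intro z
  obtain ⟨m, n, h⟩ := H.exists_add_latticePoint_sub_mem_regSet hτ z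
  have h1 : H.singleLayer φ = fun w => H.singleLayer φ (w + latticePoint τ m n) :=
    funext fun w => (H.singleLayer_add_latticePoint hτ φ w m n).symm
  rw [h1]
  exact (key _ h).comp (f := fun w : ℂ => w + latticePoint τ m n) (by fun_prop)

/-- The complex derivative `∂ₓS[φ] - i∂ᵧS[φ]` of the single layer potential. -/
noncomputable def layerGrad (φ : H.boundary → ℝ) (z : ℂ) : ℂ :=
  ∫ ξ : H.boundary, φ ξ • greenKernel τ (z - ξ) ∂H.arcMeasure

theorem integrable_smul_greenKernel (hτ : 0 < τ.im) (φ : C(H.boundary, ℝ)) {z : ℂ}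
    (hz : z ∈ H.offBoundary) :
    Integrable (fun ξ : H.boundary => φ ξ • greenKernel τ (z - ξ)) H.arcMeasure :=
  H.integrable_of_continuous
    (φ.continuous.smul (H.continuous_comp_sub (continuousOn_greenKernel hτ) hz)) _

theorem hasFDerivAt_singleLayer (hτ : 0 < τ.im) (φ : C(H.boundary, ℝ)) {z : ℂ}
    (hz : z ∈ H.offBoundary) :
    HasFDerivAt (H.singleLayer φ) (reMulCLM (H.layerGrad φ z)) z := by
  have hc : ContinuousOn (fun w => reMulCLM (greenKernel τ w)) (latticeCompl τ) :=
    continuous_reMulCLM.comp_continuousOn (continuousOn_greenKernel hτ)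
  have h := H.hasFDerivAt_integral_sub (𝕜 := ℝ) (isOpen_latticeCompl hτ)
    (fun w hw => hasFDerivAt_torusGreen hτ hw) hc φ H.arcMeasure hz
  have he : H.singleLayer φ = fun z => ∫ ξ : H.boundary, φ ξ • torusGreen τ (z - ξ) ∂H.arcMeasure :=
    funext (H.singleLayer_eq hτ φ)
  rw [he]
  have hi : Integrable (fun ξ : H.boundary => φ ξ • reMulCLM (greenKernel τ (z - ξ)))
      H.arcMeasure :=
    H.integrable_of_continuous (φ.continuous.smul (H.continuous_comp_sub hc hz)) _
  refine h.congr_fderiv (ContinuousLinearMap.ext fun v => ?_)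
  rw [ContinuousLinearMap.integral_apply hi, reMulCLM_apply, layerGrad,
    ← integral_mul_const, ← reCLM_apply, ← reCLM.integral_comp_comm
      ((H.integrable_smul_greenKernel hτ φ hz).mul_const v)]
  refine integral_congr_ae (.of_forall fun ξ => ?_)
  simp [reMulCLM_apply, mul_assoc]

/-- The only nonholomorphic dependence on z is the term -i Im z / Im τ, which enters multiplied by
∫φ = 0. This is where mean zero is needed for harmonicity. -/
theorem layerGrad_eq_of_mean_zero (hτ : 0 < τ.im) (φ : C(H.boundary, ℝ))
    (hφ : ∫ ξ, φ ξ ∂H.arcMeasure = 0) {z : ℂ} (hz : z ∈ H.offBoundary) :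
    H.layerGrad φ z = -(1 / (2 * Real.pi)) *
      ∫ ξ : H.boundary, (φ ξ : ℂ) • logDeriv (jacobiThetaOne τ) (z - ξ) ∂H.arcMeasure +
      I / τ.im * ∫ ξ : H.boundary, (φ ξ : ℂ) * ((ξ : ℂ).im : ℂ) ∂H.arcMeasure := by
  have hd := differentiableOn_logDeriv_jacobiThetaOne hτ
  have hi : ∀ {f : H.boundary → ℂ}, Continuous f →
      Integrable (fun ξ => (φ ξ : ℂ) * f ξ) H.arcMeasure := fun hf =>
    H.integrable_of_continuous ((continuous_ofReal.comp φ.continuous).mul hf) _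
  have h1 := hi (H.continuous_comp_sub hd.continuousOn hz)
  have h2 := hi (f := fun ξ => ((ξ : ℂ).im : ℂ)) (by fun_prop)
  have h3 := hi (f := fun _ => 1) continuous_const
  simp only [mul_one] at h3
  have h4 : ∫ ξ, (φ ξ : ℂ) ∂H.arcMeasure = 0 := by
    rw [integral_complex_ofReal, hφ, ofReal_zero]
  have : ∀ ξ : H.boundary, φ ξ • greenKernel τ (z - ξ) =
      (-(1 / (2 * Real.pi)) * ((φ ξ : ℂ) * logDeriv (jacobiThetaOne τ) (z - ξ)) +
      I / τ.im * ((φ ξ : ℂ) * ((ξ : ℂ).im : ℂ))) - (I * z.im / τ.im) * φ ξ := by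
    intro ξ
    rw [greenKernel_eq hτ (hz ξ ξ.2), real_smul, sub_im, ofReal_sub]
    ring
  simp only [layerGrad, this]
  rw [integral_sub ((h1.const_mul _).fun_add (h2.const_mul _)) (h3.const_mul _),
    integral_add (h1.const_mul _) (h2.const_mul _), integral_const_mul, integral_const_mul,
    integral_const_mul, h4]
  simp

theorem differentiableOn_layerGrad (hτ : 0 < τ.im) (φ : C(H.boundary, ℝ))
    (hφ : ∫ ξ, φ ξ ∂H.arcMeasure = 0) : DifferentiableOn ℂ (H.layerGrad φ) H.offBoundary := by
  have hd := differentiableOn_logDeriv_jacobiThetaOne hτ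
  have ho := isOpen_latticeCompl hτ
  refine DifferentiableOn.congr (fun z hz => ?_)
    fun z hz => H.layerGrad_eq_of_mean_zero hτ φ hφ hz
  have h := H.hasFDerivAt_integral_sub (𝕜 := ℂ) ho
    (F' := fderiv ℂ (logDeriv (jacobiThetaOne τ)))
    (fun w hw => ((hd w hw).differentiableAt (ho.mem_nhds hw)).hasFDerivAt)
    ((hd.contDiffOn (n := 1) ho).continuousOn_fderiv_of_isOpen ho le_rfl)
    ⟨fun ξ => (φ ξ : ℂ), continuous_ofReal.comp φ.continuous⟩ H.arcMeasure hz
  exact ((h.differentiableAt.const_mul _).add_const _).differentiableWithinAt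

/-- The holomorphic gradient has a primitive on the ball, and its real part has the same
differential as the potential. The constant of integration is absorbed into P. -/
theorem exists_singleLayer_eq_re (hτ : 0 < τ.im) (φ : C(H.boundary, ℝ))
    (hφ : ∫ ξ, φ ξ ∂H.arcMeasure = 0) {z : ℂ} {r : ℝ}
    (hz : ball z r ⊆ H.offBoundary) :
    ∃ P : ℂ → ℂ, (∀ w ∈ ball z r, HasDerivAt P (H.layerGrad φ w) w) ∧
      ∀ w ∈ ball z r, H.singleLayer φ w = (P w).re := by
  obtain ⟨P, hP⟩ := ((H.differentiableOn_layerGrad hτ φ hφ).mono hz).isExactOn_ball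
  have hd : ∀ w ∈ ball z r, 
      HasFDerivAt (fun w => H.singleLayer φ w - (P w).re) (0 : ℂ →L[ℝ] ℝ) w := by
    intro w hw
    have := (H.hasFDerivAt_singleLayer hτ φ (hz hw)).sub (hP w hw).hasFDerivAt_re
    rw [sub_self] at this
    exact this
  obtain ⟨a, ha⟩ := isOpen_ball.exists_is_const_of_fderiv_eq_zero (𝕜 := ℝ)
    (f := fun w => H.singleLayer φ w - (P w).re)
    (convex_ball z r).isPreconnected
    (fun w hw => (hd w hw).differentiableAt.differentiableWithinAt) (fun w hw => (hd w hw).fderiv)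
  refine ⟨fun w => P w + a, fun w hw => (hP w hw).add_const _, fun w hw => ?_⟩
  have := ha w hw
  simp only [add_re, ofReal_re]
  linarith

theorem harmonicOnNhd_singleLayer (hτ : 0 < τ.im) (φ : C(H.boundary, ℝ))
    (hφ : ∫ ξ, φ ξ ∂H.arcMeasure = 0) :
    InnerProductSpace.HarmonicOnNhd (H.singleLayer φ) H.offBoundary := by
  intro z hz
  obtain ⟨r, hr, hb⟩ := Metric.isOpen_iff.1 (H.isOpen_offBoundary hτ) z hz
  obtain ⟨P, hP, he⟩ := H.exists_singleLayer_eq_re hτ φ hφ hb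
  have ha : AnalyticAt ℂ P z := by
    have : DifferentiableOn ℂ P (ball z r) := fun w hw =>
      (hP w hw).differentiableAt.differentiableWithinAt
    exact this.analyticAt (ball_mem_nhds z hr)
  refine (InnerProductSpace.harmonicAt_congr_nhds ?_).2 ha.harmonicAt_re
  filter_upwards [ball_mem_nhds z hr] with w hw using he w hw

end FinitelyConnectedTorus

/-! ### The Poisson kernel as an approximate identity -/

theorem integral_poisson_kernel (a b X : ℝ) {Y : ℝ} (hY : Y ≠ 0) :
    ∫ x in a..b, Y / ((x - X) ^ 2 + Y ^ 2) =
      Real.arctan ((b - X) / Y) - Real.arctan ((a - X) / Y) := by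
  have hpos : ∀ x : ℝ, (x - X) ^ 2 + Y ^ 2 ≠ 0 := fun x => by positivity
  refine intervalIntegral.integral_eq_sub_of_hasDerivAt
    (f := fun x => Real.arctan ((x - X) / Y)) (fun x _ => ?_) ?_
  · have h := (((hasDerivAt_id x).sub_const X).div_const Y).arctan
    have := hpos x
    have h1 : 1 + ((x - X) / Y) ^ 2 ≠ 0 := by positivity
    refine h.congr_deriv ?_
    simp only [id]
    field_simp
    ring
  · refine Continuous.intervalIntegrable ?_ _ _
    exact continuous_const.div (by fun_prop) hpos

/-- The kernels are positive, concentrate at 0, and have total mass tending to π by the arctangent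
formula. The centre X may move, which allows approach along non-vertical paths. -/
theorem tendsto_integral_poisson_kernel {ι : Type*} {l : Filter ι} {X Y : ι → ℝ}
    (hX : Tendsto X l (𝓝 0)) (hY : Tendsto Y l (𝓝[>] 0)) {ψ : ℝ → ℝ} (hψ : Continuous ψ) {r : ℝ}
    (hr : 0 < r) :
    Tendsto (fun i => ∫ x in -r..r, Y i / ((x - X i) ^ 2 + Y i ^ 2) * ψ x) l
      (𝓝 (Real.pi * ψ 0)) := by
  have hY0 : ∀ᶠ i in l, 0 < Y i := hY.eventually self_mem_nhdsWithin
  have hY' : Tendsto Y l (𝓝 0) := hY.mono_right nhdsWithin_le_nhds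
  have hle : -r ≤ r := by linarith
  have key : Tendsto (fun i => ∫ x in Ioc (-r) r,
      (1 / Real.pi * (Y i / ((x - X i) ^ 2 + Y i ^ 2))) • ψ x) l (𝓝 (ψ 0)) := by
    refine tendsto_setIntegral_peak_smul_of_integrableOn_of_tendsto (t := Ioc (-r) r) (x₀ := 0)
      measurableSet_Ioc measurableSet_Ioc subset_rfl self_mem_nhdsWithin (by simp) ?_ ?_ ?_ ?_
      ((hψ.integrableOn_Icc).mono_set Ioc_subset_Icc_self)
      (hψ.continuousAt.tendsto.mono_left nhdsWithin_le_nhds)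
    · filter_upwards [hY0] with i hi x _
      positivity
    · intro u hu h0
      obtain ⟨δ, hδ, hu⟩ := Metric.isOpen_iff.1 hu 0 h0
      rw [Metric.tendstoUniformlyOn_iff]
      intro ε hε
      have h1 : ∀ᶠ i in l, |X i| < δ / 2 := by
        have := hX.abs
        rw [abs_zero] at this
        exact this.eventually_lt_const (by positivity)
      have h2 : ∀ᶠ i in l, 1 / Real.pi * (Y i / (δ / 2) ^ 2) < ε := by
        have := (hY'.div_const ((δ / 2) ^ 2)).const_mul (1 / Real.pi)
        simp only [zero_div, mul_zero] at this
        exact this.eventually_lt_const hε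
      filter_upwards [hY0, h1, h2] with i hi h1 h2 x hx
      have hxδ : δ ≤ |x| := by
        by_contra hlt
        exact hx.2 (hu (by simpa using hlt))
      have h3 : δ / 2 ≤ |x - X i| := by
        have := abs_sub_abs_le_abs_sub x (X i)
        linarith
      rw [Pi.zero_apply, dist_zero_left, Real.norm_of_nonneg (by positivity)]
      refine lt_of_le_of_lt ?_ h2
      have h4 : (δ / 2) ^ 2 ≤ (x - X i) ^ 2 + Y i ^ 2 := by
        rw [← sq_abs (x - X i)]
        nlinarith [sq_nonneg (Y i)]
      gcongr
    · have h1 : Tendsto (fun i => 1 / Real.pi *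
          (Real.arctan ((r - X i) / Y i) - Real.arctan ((-r - X i) / Y i))) l (𝓝 1) := by
        have hYi : Tendsto (fun i => (Y i)⁻¹) l atTop := tendsto_inv_nhdsGT_zero.comp hY
        have e1 : Tendsto (fun i => (r - X i) / Y i) l atTop := by
          have : Tendsto (fun i => r - X i) l (𝓝 r) := by simpa using hX.const_sub r
          exact this.pos_mul_atTop hr hYi
        have e2 : Tendsto (fun i => (-r - X i) / Y i) l atBot := by
          have : Tendsto (fun i => -r - X i) l (𝓝 (-r)) := by simpa using hX.const_sub (-r)
          exact this.neg_mul_atTop (by linarith) hYi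
        have a1 := Real.tendsto_arctan_atTop.mono_right nhdsWithin_le_nhds |>.comp e1
        have a2 := Real.tendsto_arctan_atBot.mono_right nhdsWithin_le_nhds |>.comp e2
        have := (a1.sub a2).const_mul (1 / Real.pi)
        have e : 1 / Real.pi * (Real.pi / 2 - -(Real.pi / 2)) = 1 := by
          have := Real.pi_ne_zero
          field_simp
          norm_num
        rwa [e] at this
      refine h1.congr' ?_
      filter_upwards [hY0] with i hi
      rw [integral_const_mul, ← intervalIntegral.integral_of_le hle,
        integral_poisson_kernel _ _ _ hi.ne']
    · exact .of_forall fun i => (by fun_prop : Measurable _).aestronglyMeasurable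
  refine (key.const_mul Real.pi).congr fun i => ?_
  rw [intervalIntegral.integral_of_le hle, ← integral_const_mul]
  refine integral_congr_ae (.of_forall fun x => ?_)
  have := Real.pi_ne_zero
  simp only [smul_eq_mul]
  field_simp

/-! ### The kernel of K* and the principal value -/

namespace FinitelyConnectedTorus

variable {τ : ℂ} {M : ℕ} (H : FinitelyConnectedTorus τ M)

theorem boundary_sub_mem_regSet (hτ : 0 < τ.im) {z ξ : ℂ} (hz : z ∈ H.boundary)
    (hξ : ξ ∈ H.boundary) : z - ξ ∈ regSet τ := by
  obtain ⟨j, t, rfl⟩ := H.exists_of_mem_boundary hz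
  obtain ⟨k, s, rfl⟩ := H.exists_of_mem_boundary hξ
  exact H.sub_mem_regSet hτ (H.γ_mem_closure j t) (H.γ_mem_closure k s)

/-- The kernel of the boundary operator `K*`. -/
noncomputable def normalKernel (z ξ : H.boundary) : ℝ :=
  (H.normal z * greenKernel τ (z - ξ)).re

theorem fderiv_torusGreen_normal (hτ : 0 < τ.im) {z ξ : H.boundary} (h : ξ ≠ z) :
    fderiv ℝ (fun w : ℂ => torusGreen τ (w - ξ)) z (H.normal z) = H.normalKernel z ξ := by
  have hm : (z : ℂ) - ξ ∈ latticeCompl τ := (mem_latticeCompl_iff τ).2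
    ⟨sub_ne_zero.2 fun e => h (Subtype.ext e.symm), H.boundary_sub_mem_regSet hτ z.2 ξ.2⟩
  have h1 := (hasFDerivAt_torusGreen hτ hm).comp (z : ℂ) ((hasFDerivAt_id (𝕜 := ℝ) (z : ℂ)).sub_const (ξ : ℂ))
  have h2 : HasFDerivAt (fun w : ℂ => torusGreen τ (w - ξ))
    (reMulCLM (greenKernel τ ((z : ℂ) - ξ))) z := by simpa [Function.comp_def] using h1
  rw [h2.fderiv, reMulCLM_apply, normalKernel, mul_comm]

/-- The real part is -ν·(ξ - z)/|ξ - z|², so the quadratic bound on the normal component cancels the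
singularity. At ξ = z the inverse has the default value 0. -/
theorem exists_re_normal_div_le (hτ : 0 < τ.im) : ∃ C > 0, ∀ z ξ : H.boundary,
    |(H.normal z * ((z : ℂ) - ξ)⁻¹).re| ≤ C := by
  obtain ⟨C, hC, h⟩ := H.exists_normal_le hτ
  refine ⟨C, hC, fun z ξ => ?_⟩
  by_cases hzξ : (z : ℂ) - ξ = 0
  · simp [hzξ, hC.le]
  have h1 := h z ξ
  have hn : 0 < ‖(ξ : ℂ) - z‖ := by
    rw [norm_sub_rev]
    exact norm_pos_iff.2 hzξ
  have e : (H.normal z * ((z : ℂ) - ξ)⁻¹).re =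
      -(starRingEnd ℂ (H.normal z) * (ξ - z)).re / ‖(ξ : ℂ) - z‖ ^ 2 := by
    rw [inv_def, norm_sub_rev, ← normSq_eq_norm_sq]
    simp only [mul_re, mul_im, conj_re, conj_im, sub_re, sub_im, ofReal_re, ofReal_im]
    ring
  rw [e, abs_div, abs_neg, abs_of_pos (pow_pos hn 2), div_le_iff₀ (pow_pos hn 2)]
  exact h1

theorem exists_greenKernelReg_le (hτ : 0 < τ.im) : ∃ C > 0, ∀ z ξ : H.boundary,
    ‖greenKernelReg τ (z - ξ)‖ ≤ C := by
  have hc : Continuous fun p : H.boundary × H.boundary => greenKernelReg τ (p.1 - p.2) :=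
    (continuousOn_greenKernelReg hτ).comp_continuous (by fun_prop)
      fun p => H.boundary_sub_mem_regSet hτ p.1.2 p.2.2
  obtain ⟨C, hC⟩ := isCompact_univ.exists_bound_of_continuousOn hc.continuousOn
  exact ⟨max C 1, by positivity, fun z ξ => (hC (z, ξ) (mem_univ _)).trans (le_max_left _ _)⟩

theorem normalKernel_eq (z ξ : H.boundary) : H.normalKernel z ξ =
    -(1 / (2 * Real.pi)) * (H.normal z * ((z : ℂ) - ξ)⁻¹).re +
      (H.normal z * greenKernelReg τ (z - ξ)).re := by
  rw [normalKernel, greenKernel, mul_add, add_re, mul_left_comm]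
  have : (-(1 / (2 * Real.pi)) : ℂ) = ((-(1 / (2 * Real.pi)) : ℝ) : ℂ) := by push_cast; rfl
  rw [this, re_ofReal_mul]

theorem exists_normalKernel_le (hτ : 0 < τ.im) : ∃ C > 0, ∀ z ξ : H.boundary,
    |H.normalKernel z ξ| ≤ C := by
  obtain ⟨A, hA, hA'⟩ := H.exists_re_normal_div_le hτ
  obtain ⟨B, hB, hB'⟩ := H.exists_greenKernelReg_le hτ
  refine ⟨1 / (2 * Real.pi) * A + B, by positivity, fun z ξ => ?_⟩
  rw [normalKernel_eq]
  refine (abs_add_le _ _).trans (add_le_add ?_ ?_)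
  · rw [abs_mul, abs_neg, abs_of_pos (by positivity : 0 < 1 / (2 * Real.pi))]
    exact mul_le_mul_of_nonneg_left (hA' z ξ) (by positivity)
  · refine (abs_re_le_norm _).trans ?_
    rw [norm_mul, norm_normal, one_mul]
    exact hB' z ξ

theorem measurable_normalKernel (hτ : 0 < τ.im) (z : H.boundary) :
    Measurable (H.normalKernel z) := by
  have : H.normalKernel z = fun ξ : H.boundary => -(1 / (2 * Real.pi)) * (H.normal z * ((z : ℂ) - ξ)⁻¹).re +
      (H.normal z * greenKernelReg τ (z - ξ)).re := funext (H.normalKernel_eq z)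
  rw [this]
  have hc : Continuous fun ξ : H.boundary => greenKernelReg τ (z - ξ) :=
    H.continuous_comp_sub (continuousOn_greenKernelReg hτ)
      fun ξ hξ => H.boundary_sub_mem_regSet hτ z.2 hξ
  exact ((measurable_re.comp ((measurable_const.sub measurable_subtype_coe).inv.const_mul _)).const_mul
    _).add (measurable_re.comp (hc.measurable.const_mul _))

theorem integrable_normalKernel_mul (hτ : 0 < τ.im) (z : H.boundary) (φ : C(H.boundary, ℝ))
    (μ : Measure H.boundary) [IsFiniteMeasure μ] :
    Integrable (fun ξ => H.normalKernel z ξ * φ ξ) μ := by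
  obtain ⟨C, hC, h⟩ := H.exists_normalKernel_le hτ
  exact (H.integrable_of_continuous φ.continuous μ).bdd_mul
    (H.measurable_normalKernel hτ z).aestronglyMeasurable (.of_forall fun ξ => h z ξ)

/-- The kernel is bounded and points are null, so the truncations converge by dominated convergence:
the principal value is an ordinary integral. -/
theorem tendsto_truncatedAdjoint_integral (hτ : 0 < τ.im) (φ : C(H.boundary, ℝ)) (z : H.boundary) :
    Tendsto (H.truncatedAdjoint φ z) (𝓝[>] 0)
      (𝓝 (∫ ξ, H.normalKernel z ξ * φ ξ ∂H.arcMeasure)) := by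
  have hi := H.integrable_normalKernel_mul hτ z φ H.arcMeasure
  have hm : Measurable fun ξ : H.boundary => ‖(ξ : ℂ) - z‖ := by fun_prop
  have he : ∀ ε : ℝ, 0 < ε → H.truncatedAdjoint φ z ε =
      ∫ ξ, {ξ : H.boundary | ε < ‖(ξ : ℂ) - z‖}.indicator
        (fun ξ => H.normalKernel z ξ * φ ξ) ξ ∂H.arcMeasure := by
    intro ε hε
    rw [← H.bdryIntegral_eq (hi.indicator (measurableSet_lt measurable_const hm))]
    unfold truncatedAdjoint
    congr 1
    funext ξ
    by_cases hξ : ε < ‖(ξ : ℂ) - z‖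
    · rw [if_pos hξ, indicator_of_mem (by exact hξ), H.fderiv_torusGreen_normal hτ]
      rintro rfl
      simp only [sub_self, norm_zero] at hξ
      linarith
    · rw [if_neg hξ, indicator_of_notMem (by exact hξ)]
  refine Tendsto.congr' (f₁ := fun ε : ℝ => ∫ ξ, {ξ : H.boundary | ε < ‖(ξ : ℂ) - z‖}.indicator
        (fun ξ => H.normalKernel z ξ * φ ξ) ξ ∂H.arcMeasure) ?_ ?_
  · filter_upwards [self_mem_nhdsWithin] with ε hε using (he ε hε).symm
  · refine tendsto_integral_filter_of_dominated_convergence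
      (fun ξ => ‖H.normalKernel z ξ * φ ξ‖) (.of_forall fun ε =>
        (hi.indicator (measurableSet_lt measurable_const hm)).aestronglyMeasurable)
      (.of_forall fun ε => .of_forall fun ξ => norm_indicator_le_norm_self _ _) hi.norm ?_
    filter_upwards [H.ae_ne z] with ξ hξ
    refine tendsto_const_nhds.congr' ?_
    have hpos : 0 < ‖(ξ : ℂ) - z‖ := by
      rw [norm_sub_rev]
      exact norm_pos_iff.2 hξ
    filter_upwards [nhdsWithin_le_nhds (Iio_mem_nhds hpos)] with ε hε
    rw [indicator_of_mem (by exact hε)]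

theorem adjointDoubleLayer_eq (hτ : 0 < τ.im) (φ : C(H.boundary, ℝ)) (z : H.boundary) :
    H.adjointDoubleLayer φ z = ∫ ξ, H.normalKernel z ξ * φ ξ ∂H.arcMeasure :=
  (H.tendsto_truncatedAdjoint_integral hτ φ z).limUnder_eq

theorem tendsto_truncatedAdjoint (hτ : 0 < τ.im) (φ : C(H.boundary, ℝ)) (z : H.boundary) :
    Tendsto (H.truncatedAdjoint φ z) (𝓝[>] 0) (𝓝 (H.adjointDoubleLayer φ z)) := by
  rw [H.adjointDoubleLayer_eq hτ]
  exact H.tendsto_truncatedAdjoint_integral hτ φ z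

end FinitelyConnectedTorus

/-! ### The jump relations -/

theorem norm_inv_sub_inv_le {u v : ℂ} {x p q C : ℝ} (hp : 0 < p) (hq : 0 < q)
    (huv : ‖u - v‖ ≤ C * x ^ 2) (hu : p * |x| ≤ ‖u‖) (hv : q * |x| ≤ ‖v‖) (hx : x ≠ 0) :
    ‖u⁻¹ - v⁻¹‖ ≤ C / (p * q) := by
  have hx' : 0 < |x| := abs_pos.2 hx
  have hu0 : 0 < ‖u‖ := lt_of_lt_of_le (by positivity) hu
  have hv0 : 0 < ‖v‖ := lt_of_lt_of_le (by positivity) hv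
  rw [inv_sub_inv (norm_pos_iff.1 hu0) (norm_pos_iff.1 hv0), norm_div, norm_mul, norm_sub_rev]
  rw [div_le_div_iff₀ (by positivity) (by positivity)]
  have h1 : p * |x| * (q * |x|) ≤ ‖u‖ * ‖v‖ := by gcongr
  have hC : 0 ≤ C := by
    by_contra hC
    have := norm_nonneg (u - v)
    nlinarith [sq_pos_of_pos hx', sq_abs x]
  calc ‖u - v‖ * (p * q) ≤ C * x ^ 2 * (p * q) := by gcongr
    _ = C * (p * |x| * (q * |x|)) := by rw [← sq_abs x]; ring
    _ ≤ _ := by gcongr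

/-- On the tangent line the normal component of the Cauchy kernel is exactly a Poisson kernel in the
rotated and scaled coordinate w / a. -/
theorem re_neg_I_mul_div_norm_mul_inv {a : ℂ} (ha : a ≠ 0) (w : ℂ) (x : ℝ) :
    (-I * a / ‖a‖ * (w - x * a)⁻¹).re =
      -(1 / ‖a‖) * ((w / a).im / ((x - (w / a).re) ^ 2 + (w / a).im ^ 2)) := by
  have h1 : w - x * a = a * (w / a - x) := by field_simp
  have h2 : -I * a / ‖a‖ * (a * (w / a - x))⁻¹ = ((1 / ‖a‖ : ℝ) : ℂ) * (-I * (w / a - x)⁻¹) := by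
    rw [mul_inv]
    push_cast
    field_simp
  rw [h1, h2, re_ofReal_mul, neg_mul, neg_mul]
  rw [mul_comm I, neg_re, mul_I_re, neg_neg, inv_im, normSq_apply]
  simp only [sub_re, sub_im, ofReal_re, ofReal_im, sub_zero]
  rw [neg_div, mul_neg]
  congr 3
  ring

/-- In a nontangential region this lets lower bounds for distances from z₀ be used for z. -/
theorem norm_sub_le_one_add_mul {z z₀ ξ : ℂ} {α : ℝ} (h : ‖z - z₀‖ ≤ α * ‖z - ξ‖) :
    ‖z₀ - ξ‖ ≤ (1 + α) * ‖z - ξ‖ :=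
  calc ‖z₀ - ξ‖ = ‖(z - ξ) - (z - z₀)‖ := by rw [sub_sub_sub_cancel_left]
    _ ≤ ‖z - ξ‖ + ‖z - z₀‖ := norm_sub_le _ _
    _ ≤ ‖z - ξ‖ + α * ‖z - ξ‖ := by gcongr
    _ = _ := by ring

theorem abs_re_mul_le_of_norm_eq_one {ν : ℂ} (hν : ‖ν‖ = 1) (w : ℂ) : |(ν * w).re| ≤ ‖w‖ :=
  (abs_re_le_norm _).trans (by rw [norm_mul, hν, one_mul])

theorem continuousAt_re_mul_inv_sub (ν : ℂ) {z₀ ξ : ℂ} (h : ξ ≠ z₀) :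
    ContinuousAt (fun z : ℂ => (ν * (z - ξ)⁻¹).re) z₀ :=
  continuous_re.continuousAt.comp (continuousAt_const.mul
    (ContinuousAt.inv₀ (by fun_prop) (sub_ne_zero.2 h.symm)))

namespace FinitelyConnectedTorus

variable {τ : ℂ} {M : ℕ} (H : FinitelyConnectedTorus τ M)

theorem ae_holeMeasure_mem_frontier (j : Fin M) :
    ∀ᵐ ξ : H.boundary ∂H.holeMeasure j, (ξ : ℂ) ∈ frontier (H.D j) := by
  rw [holeMeasure, ae_map_iff (H.continuous_bdryPoint j).aemeasurable
    (isClosed_frontier.measurableSet.preimage measurable_subtype_coe)]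
  exact .of_forall fun t => H.γ_mem_frontier j t

theorem deriv_γ_periodic (j : Fin M) : Function.Periodic (deriv (H.γ j)) 1 :=
  (H.periodic_γ j).deriv_one

theorem integral_holeMeasure_eq_symm (j : Fin M) (t₀ : ℝ) {E : Type*} [NormedAddCommGroup E]
    [NormedSpace ℝ E] {f : H.boundary → E} (hf : AEStronglyMeasurable f (H.holeMeasure j)) :
    ∫ ξ, f ξ ∂H.holeMeasure j = ∫ x in -(1 / 2 : ℝ)..1 / 2,
      ‖deriv (H.γ j) (t₀ + x)‖ • f (H.bdryPoint j (t₀ + x)) := by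
  have hp : Function.Periodic (fun t => ‖deriv (H.γ j) t‖ • f (H.bdryPoint j t)) 1 := fun t => by
    simp only [H.deriv_γ_periodic j t, H.bdryPoint_periodic j t]
  rw [H.integral_holeMeasure j hf, intervalIntegral.integral_comp_add_left
    (fun t => ‖deriv (H.γ j) t‖ • f (H.bdryPoint j t))]
  have := hp.intervalIntegral_add_eq 0 (t₀ + -(1 / 2))
  rw [zero_add] at this
  rw [this]
  congr 1
  ring

theorem measurable_mul_re_mul_inv_sub (φ : C(H.boundary, ℝ)) (ν z : ℂ) :
    Measurable fun ξ : H.boundary => φ ξ * (ν * (z - (ξ : ℂ))⁻¹).re :=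
  φ.continuous.measurable.mul
    (measurable_re.comp ((measurable_const.sub measurable_subtype_coe).inv.const_mul _))

theorem tendsto_integral_re_mul_inv_of_ne (hτ : 0 < τ.im) {i j : Fin M} (hij : i ≠ j) (t₀ : ℝ)
    (φ : C(H.boundary, ℝ)) {ν : ℂ} (hν : ‖ν‖ = 1) {l : Filter ℂ} [l.IsCountablyGenerated]
    (hl : l ≤ 𝓝 (H.γ j t₀)) {α : ℝ}
    (h1 : ∀ᶠ z in l, ∀ ξ ∈ H.boundary, ‖z - H.γ j t₀‖ ≤ α * ‖z - ξ‖) :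
    Tendsto (fun z => ∫ ξ : H.boundary, φ ξ * (ν * (z - (ξ : ℂ))⁻¹).re ∂H.holeMeasure i) l
      (𝓝 (∫ ξ : H.boundary, φ ξ * (ν * (H.γ j t₀ - (ξ : ℂ))⁻¹).re ∂H.holeMeasure i)) := by
  set z₀ := H.γ j t₀
  obtain ⟨δ, hδ, hsep⟩ := H.exists_separation hτ
  have hfar : ∀ ξ ∈ frontier (H.D i), δ ≤ ‖z₀ - ξ‖ := by
    intro ξ hξ
    by_contra hlt
    refine hij (hsep j z₀ (H.γ_mem_closure j t₀) ξ ?_ i 0 0 ?_).1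
    · rw [mem_ball, dist_comm, dist_eq_norm]
      exact not_le.1 hlt
    · simpa [latticePoint] using frontier_subset_closure hξ
  refine tendsto_integral_filter_of_dominated_convergence (fun _ => ‖φ‖ * ((1 + α) / δ))
    (.of_forall fun z => (H.measurable_mul_re_mul_inv_sub φ ν z).aestronglyMeasurable) ?_ (integrable_const _) ?_
  · filter_upwards [h1] with z h1
    filter_upwards [H.ae_holeMeasure_mem_frontier i] with ξ hξ
    rw [norm_mul]
    gcongr
    · exact φ.norm_coe_le_norm ξ
    · refine (abs_re_mul_le_of_norm_eq_one hν _).trans ?_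
      have h5 := norm_sub_le_one_add_mul (h1 ξ ξ.2)
      have h6 := hfar ξ hξ
      have h7 : 0 < ‖z - ξ‖ := by
        by_contra h0
        have : ‖z - (ξ : ℂ)‖ = 0 := le_antisymm (not_lt.1 h0) (norm_nonneg _)
        rw [this, mul_zero] at h5
        linarith
      rw [norm_inv, inv_eq_one_div, div_le_div_iff₀ h7 hδ]
      linarith
  · filter_upwards [H.ae_holeMeasure_mem_frontier i] with ξ hξ
    refine ((continuousAt_re_mul_inv_sub ν ?_).tendsto.mono_left hl).const_mul _
    rintro h
    have := hfar ξ hξ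
    rw [h, sub_self, norm_zero] at this
    linarith

/-- The kernel is compared with the one in which γ(t₀ + x) is replaced by its tangent line z₀ + xa.
The difference is bounded uniformly in z and converges to the direct value; the tangent line part is
a Poisson integral and produces the jump. The sign e = 1 means approach from the side of Ω, e = -1
approach from the hole. -/
theorem tendsto_integral_re_unitNormal_mul_inv_self (j : Fin M) (t₀ : ℝ) (φ : C(H.boundary, ℝ))
    {l : Filter ℂ} [l.IsCountablyGenerated] (hl : l ≤ 𝓝 (H.γ j t₀)) {α e : ℝ} (hα : 0 < α)
    (he : e ^ 2 = 1) (h1 : ∀ᶠ z in l, ∀ ξ ∈ H.boundary, ‖z - H.γ j t₀‖ ≤ α * ‖z - ξ‖)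
    (h2 : ∀ᶠ z in l, ‖(z - H.γ j t₀) / deriv (H.γ j) t₀‖ ≤
      α * (e * ((z - H.γ j t₀) / deriv (H.γ j) t₀).im))
    (h3 : ∀ᶠ z in l, z ≠ H.γ j t₀) :
    Tendsto (fun z => ∫ ξ : H.boundary, φ ξ * (unitNormal (H.γ j) t₀ * (z - (ξ : ℂ))⁻¹).re
      ∂H.holeMeasure j) l
      (𝓝 (∫ ξ : H.boundary, φ ξ * (unitNormal (H.γ j) t₀ * (H.γ j t₀ - (ξ : ℂ))⁻¹).re
        ∂H.holeMeasure j + -(e * Real.pi * φ (H.bdryPoint j t₀)))) := by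
  set z₀ := H.γ j t₀ with hz₀
  set a := deriv (H.γ j) t₀ with ha
  set ν := unitNormal (H.γ j) t₀ with hν
  have ha0 : a ≠ 0 := H.deriv_γ_ne_zero j t₀
  have hapos : 0 < ‖a‖ := norm_pos_iff.2 ha0
  have hre := abs_re_mul_le_of_norm_eq_one (norm_unitNormal (H.deriv_γ_ne_zero j t₀))
  set ψ : ℝ → ℝ := fun x => ‖deriv (H.γ j) (t₀ + x)‖ * φ (H.bdryPoint j (t₀ + x)) with hψ
  have hψc : Continuous ψ :=
    ((H.continuous_deriv_γ j).comp (by fun_prop)).norm.mul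
      (φ.continuous.comp ((H.continuous_bdryPoint j).comp (by fun_prop)))
  have hψ0 : ψ 0 = ‖a‖ * φ (H.bdryPoint j t₀) := by simp [hψ, ha]
  have hrepr : ∀ z : ℂ, ∫ ξ : H.boundary, φ ξ * (ν * (z - (ξ : ℂ))⁻¹).re ∂H.holeMeasure j =
      ∫ x in -(1 / 2 : ℝ)..1 / 2, ψ x * (ν * (z - H.γ j (t₀ + x))⁻¹).re := fun z => by
    rw [H.integral_holeMeasure_eq_symm j t₀ (H.measurable_mul_re_mul_inv_sub φ ν z).aestronglyMeasurable]
    refine intervalIntegral.integral_congr fun x _ => ?_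
    simp only [smul_eq_mul, hψ, mul_assoc]
    rfl
  have hline : ∀ (z : ℂ) (x : ℝ), (ν * (z - z₀ - x * a)⁻¹).re = -(1 / ‖a‖) *
      (((z - z₀) / a).im / ((x - ((z - z₀) / a).re) ^ 2 + ((z - z₀) / a).im ^ 2)) :=
    fun z x => re_neg_I_mul_div_norm_mul_inv ha0 (z - z₀) x
  have hω : Tendsto (fun z => (z - z₀) / a) l (𝓝 0) := by
    have : Continuous fun z : ℂ => (z - z₀) / a := by fun_prop
    exact (this.tendsto' z₀ 0 (by simp)).mono_left hl
  have hX : Tendsto (fun z => ((z - z₀) / a).re) l (𝓝 0) := by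
    simpa [Function.comp_def] using (continuous_re.tendsto 0).comp hω
  -- The factor e makes the height of the Poisson kernel positive on either side.
  have hYpos : ∀ᶠ z in l, 0 < e * ((z - z₀) / a).im := by
    filter_upwards [h2, h3] with z h2 h3
    have : 0 < ‖(z - z₀) / a‖ := norm_pos_iff.2 (div_ne_zero (sub_ne_zero.2 h3) ha0)
    exact pos_of_mul_pos_right (this.trans_le h2) hα.le
  have hY : Tendsto (fun z => e * ((z - z₀) / a).im) l (𝓝[>] 0) := by
    refine tendsto_nhdsWithin_iff.2 ⟨?_, hYpos⟩
    have := ((continuous_im.tendsto 0).comp hω).const_mul e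
    simpa [Function.comp_def] using this
  have hpois := (tendsto_integral_poisson_kernel hX hY hψc (r := 1 / 2) (by norm_num)).const_mul
    (-(e / ‖a‖))
  have hL : Tendsto (fun z => ∫ x in -(1 / 2 : ℝ)..1 / 2, ψ x * (ν * (z - z₀ - x * a)⁻¹).re) l
      (𝓝 (-(e * Real.pi * φ (H.bdryPoint j t₀)))) := by
    have e1 : -(e / ‖a‖) * (Real.pi * ψ 0) = -(e * Real.pi * φ (H.bdryPoint j t₀)) := by
      rw [hψ0]
      field_simp
    rw [e1] at hpois
    refine hpois.congr fun z => ?_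
    rw [← intervalIntegral.integral_const_mul]
    refine intervalIntegral.integral_congr fun x _ => ?_
    simp only [hline]
    rw [mul_pow, he, one_mul]
    have : e * (e * ((z - z₀) / a).im) = ((z - z₀) / a).im := by
      rw [← mul_assoc, ← sq, he, one_mul]
    calc _ = -(1 / ‖a‖) * (e * (e * ((z - z₀) / a).im) /
          ((x - ((z - z₀) / a).re) ^ 2 + ((z - z₀) / a).im ^ 2)) * ψ x := by ring
      _ = _ := by rw [this]; ring
  -- The two inverses differ by a quadratic numerator over a product of two quantities that are each
  -- bounded below by a multiple of |x|. The losses 1 + α in the dominating constant come from the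
  -- approach region.
  have hdiff : Tendsto (fun z => ∫ x in -(1 / 2 : ℝ)..1 / 2,
      ψ x * ((ν * (z - H.γ j (t₀ + x))⁻¹).re - (ν * (z - z₀ - x * a)⁻¹).re)) l
      (𝓝 (∫ x in -(1 / 2 : ℝ)..1 / 2, ψ x * (ν * (z₀ - H.γ j (t₀ + x))⁻¹).re)) := by
    obtain ⟨c, hc, hc'⟩ := H.exists_chord_ge
    obtain ⟨C, hC, hC'⟩ := H.exists_taylor_le
    obtain ⟨A, hA, hA'⟩ := H.exists_deriv_le
    have hchord : ∀ x ∈ uIoc (-(1 / 2) : ℝ) (1 / 2), c * |x| ≤ ‖z₀ - H.γ j (t₀ + x)‖ := by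
      intro x hx
      rw [uIoc_of_le (by norm_num)] at hx
      rw [norm_sub_rev]
      exact hc' j t₀ x (abs_le.2 ⟨hx.1.le, hx.2⟩)
    have hm1 : ∀ z : ℂ, Measurable fun x : ℝ => (ν * (z - H.γ j (t₀ + x))⁻¹).re := fun z =>
      measurable_re.comp ((measurable_const.sub
        ((H.contDiff_γ j).continuous.comp (by fun_prop : Continuous fun x : ℝ => t₀ + x)).measurable).inv.const_mul _)
    have hm2 : ∀ z : ℂ, Measurable fun x : ℝ => (ν * (z - z₀ - x * a)⁻¹).re := fun z =>
      measurable_re.comp (Measurable.const_mul (Measurable.inv (by fun_prop)) _)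
    refine intervalIntegral.tendsto_integral_filter_of_dominated_convergence
      (fun _ => A * ‖φ‖ * (C / (c / (1 + α) * (‖a‖ / (1 + α)))))
      (.of_forall fun z => (hψc.measurable.mul ((hm1 z).sub (hm2 z))).aestronglyMeasurable) ?_
      intervalIntegrable_const ?_
    · filter_upwards [h1, h2, hYpos] with z h1 h2 hYp
      refine .of_forall fun x hx => ?_
      rw [norm_mul, hψ, norm_mul, norm_norm]
      refine mul_le_mul (mul_le_mul (hA' j _) (φ.norm_coe_le_norm _) (norm_nonneg _) hA.le) ?_
        (norm_nonneg _) (by positivity)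
      rw [← sub_re, ← mul_sub]
      refine (hre _).trans ?_
      rcases eq_or_ne x 0 with rfl | hx0
      · simp only [add_zero, ofReal_zero, zero_mul, sub_zero, ← hz₀, sub_self, norm_zero]
        positivity
      · refine norm_inv_sub_inv_le (x := x) (by positivity) (by positivity) ?_ ?_ ?_ hx0
        · refine le_trans (le_of_eq ?_) (hC' j t₀ x)
          rw [← norm_neg]
          congr 1
          rw [hz₀, ha]
          ring
        · rw [div_mul_eq_mul_div, div_le_iff₀ (by positivity), mul_comm _ (1 + α)]
          exact (hchord x hx).trans (norm_sub_le_one_add_mul (h1 _ (H.bdryPoint j (t₀ + x)).2))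
        · have e1 : z - z₀ - x * a = a * ((z - z₀) / a - x) := by field_simp
          rw [e1, norm_mul, div_mul_eq_mul_div, div_le_iff₀ (by positivity), mul_assoc]
          gcongr
          have e2 : |x| ≤ ‖(z - z₀) / a - x‖ + ‖(z - z₀) / a‖ := by
            have := norm_sub_le ((z - z₀) / a - x) ((z - z₀) / a)
            rwa [sub_sub_cancel_left, norm_neg, norm_real] at this
          have e3 : e * ((z - z₀) / a).im ≤ ‖(z - z₀) / a - x‖ := by
            have h5 : |e| = 1 := by
              rw [← sq_eq_sq₀ (abs_nonneg e) zero_le_one, sq_abs, he, one_pow]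
            refine (le_abs_self _).trans ?_
            rw [abs_mul, h5, one_mul]
            have := abs_im_le_norm ((z - z₀) / a - x)
            rwa [sub_im, ofReal_im, sub_zero] at this
          nlinarith
    · have hne : ∀ᵐ x : ℝ, x ≠ 0 := Measure.ae_ne volume 0
      filter_upwards [hne] with x hx0 hx
      have hx' : 0 < |x| := abs_pos.2 hx0
      have hne1 : H.γ j (t₀ + x) ≠ z₀ := fun h => by
        have := hchord x hx
        rw [h, sub_self, norm_zero] at this
        nlinarith
      have hne2 : z₀ + x * a ≠ z₀ := by
        rw [Ne, add_eq_left]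
        exact mul_ne_zero (ofReal_ne_zero.2 hx0) ha0
      have l1 := (continuousAt_re_mul_inv_sub ν hne1).tendsto.mono_left hl
      have l2 := (continuousAt_re_mul_inv_sub ν hne2).tendsto.mono_left hl
      -- At z = z₀ the tangent line kernel vanishes because tangent and normal are orthogonal, so
      -- only the kernel of the curve survives in the limit.
      have e2 : (ν * (z₀ - (z₀ + x * a))⁻¹).re = 0 := by
        have := hline z₀ x
        simp only [sub_self, zero_div, zero_im, mul_zero] at this
        rw [← this, sub_add_cancel_left, zero_sub]
      rw [e2] at l2
      have := (l1.sub l2).const_mul (ψ x)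
      rw [sub_zero] at this
      refine this.congr fun z => ?_
      rw [sub_add_eq_sub_sub]
  have hsum := hdiff.add hL
  rw [hrepr]
  refine hsum.congr' ?_
  filter_upwards [h1, h3, hYpos] with z h1 h3 hYp
  rw [hrepr, ← intervalIntegral.integral_add]
  · refine intervalIntegral.integral_congr fun x _ => ?_
    ring
  all_goals
    have k1 : Continuous fun x : ℝ => (ν * (z - H.γ j (t₀ + x))⁻¹).re := by
      refine continuous_re.comp (continuous_const.mul (Continuous.inv₀ ?_ fun x h0 => ?_))
      · exact continuous_const.sub ((H.contDiff_γ j).continuous.comp (by fun_prop))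
      · have := h1 _ (H.bdryPoint j (t₀ + x)).2
        change _ ≤ α * ‖z - H.γ j (t₀ + x)‖ at this
        rw [h0, norm_zero, mul_zero] at this
        exact h3 (sub_eq_zero.1 (norm_le_zero_iff.1 this))
    have k2 : Continuous fun x : ℝ => (ν * (z - z₀ - x * a)⁻¹).re := by
      refine continuous_re.comp (continuous_const.mul (Continuous.inv₀ (by fun_prop) fun x h0 => ?_))
      have : (z - z₀) / a = x := by
        rw [div_eq_iff ha0]
        exact sub_eq_zero.1 h0
      rw [this, ofReal_im, mul_zero] at hYp
      exact hYp.false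
  · exact (hψc.mul (k1.sub k2)).intervalIntegrable _ _
  · exact (hψc.mul k2).intervalIntegrable _ _

theorem tendsto_integral_re_normal_inv (hτ : 0 < τ.im) (j : Fin M) (t₀ : ℝ) (φ : C(H.boundary, ℝ))
    {l : Filter ℂ} [l.IsCountablyGenerated] (hl : l ≤ 𝓝 (H.γ j t₀)) {α e : ℝ} (hα : 0 < α)
    (he : e ^ 2 = 1) (h1 : ∀ᶠ z in l, ∀ ξ ∈ H.boundary, ‖z - H.γ j t₀‖ ≤ α * ‖z - ξ‖)
    (h2 : ∀ᶠ z in l, ‖(z - H.γ j t₀) / deriv (H.γ j) t₀‖ ≤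
      α * (e * ((z - H.γ j t₀) / deriv (H.γ j) t₀).im))
    (h3 : ∀ᶠ z in l, z ≠ H.γ j t₀) :
    Tendsto (fun z => ∫ ξ : H.boundary, φ ξ * (unitNormal (H.γ j) t₀ * (z - (ξ : ℂ))⁻¹).re ∂H.arcMeasure)
      l (𝓝 (∫ ξ : H.boundary, φ ξ * (unitNormal (H.γ j) t₀ * (H.γ j t₀ - (ξ : ℂ))⁻¹).re ∂H.arcMeasure +
        -(e * Real.pi * φ (H.bdryPoint j t₀)))) := by
  set z₀ := H.γ j t₀ with hz₀
  set ν := unitNormal (H.γ j) t₀ with hν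
  have hνn : ‖ν‖ = 1 := norm_unitNormal (H.deriv_γ_ne_zero j t₀)
  have hm := H.measurable_mul_re_mul_inv_sub φ ν
  have hcz : ∀ᶠ z in l, Continuous fun ξ : H.boundary => (ν * (z - (ξ : ℂ))⁻¹).re := by
    filter_upwards [h1, h3] with z h1 h3
    refine continuous_re.comp (continuous_const.mul (Continuous.inv₀ (by fun_prop) fun ξ h0 => ?_))
    have := h1 ξ ξ.2
    rw [h0, norm_zero, mul_zero] at this
    exact h3 (sub_eq_zero.1 (norm_le_zero_iff.1 this))
  have hi0 : Integrable (fun ξ : H.boundary => φ ξ * (ν * (z₀ - (ξ : ℂ))⁻¹).re) H.arcMeasure := by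
    obtain ⟨C, hC, h⟩ := H.exists_re_normal_div_le hτ
    refine Integrable.of_bound (hm z₀).aestronglyMeasurable (‖φ‖ * C) (.of_forall fun ξ => ?_)
    rw [norm_mul]
    gcongr
    · exact φ.norm_coe_le_norm ξ
    · have := h (H.bdryPoint j t₀) ξ
      rwa [H.normal_eq] at this
  have hiz : ∀ᶠ z in l, Integrable (fun ξ : H.boundary => φ ξ * (ν * (z - (ξ : ℂ))⁻¹).re)
      H.arcMeasure := by
    filter_upwards [hcz] with z hz
    exact H.integrable_of_continuous (φ.continuous.mul hz) _
  have hall : Tendsto (fun z => ∑ i, ∫ ξ : H.boundary, φ ξ * (ν * (z - (ξ : ℂ))⁻¹).re ∂H.holeMeasure i) l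
      (𝓝 (∑ i, (∫ ξ : H.boundary, φ ξ * (ν * (z₀ - (ξ : ℂ))⁻¹).re ∂H.holeMeasure i +
        if i = j then -(e * Real.pi * φ (H.bdryPoint j t₀)) else 0))) := by
    refine tendsto_finsetSum _ fun i _ => ?_
    by_cases hij : i = j
    · subst hij
      simpa using H.tendsto_integral_re_unitNormal_mul_inv_self i t₀ φ hl hα he h1 h2 h3
    · simpa [hij] using H.tendsto_integral_re_mul_inv_of_ne hτ hij t₀ φ hνn hl h1
  rw [Finset.sum_add_distrib, Finset.sum_ite_eq' Finset.univ j, if_pos (Finset.mem_univ j),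
    ← H.integral_arcMeasure hi0] at hall
  refine hall.congr' ?_
  filter_upwards [hiz] with z hz
  exact (H.integral_arcMeasure hz).symm

end FinitelyConnectedTorus

namespace FinitelyConnectedTorus

variable {τ : ℂ} {M : ℕ} (H : FinitelyConnectedTorus τ M)

theorem re_mul_greenKernel (ν w : ℂ) : (ν * greenKernel τ w).re =
    -(1 / (2 * Real.pi)) * (ν * w⁻¹).re + (ν * greenKernelReg τ w).re := by
  rw [greenKernel, mul_add, add_re, mul_left_comm]
  have : (-(1 / (2 * Real.pi)) : ℂ) = ((-(1 / (2 * Real.pi)) : ℝ) : ℂ) := by push_cast; rfl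
  rw [this, re_ofReal_mul]

theorem re_mul_layerGrad (hτ : 0 < τ.im) (φ : C(H.boundary, ℝ)) {z : ℂ} (hz : z ∈ H.offBoundary)
    (ν : ℂ) : Integrable (fun ξ : H.boundary => φ ξ * (ν * greenKernel τ (z - ξ)).re) H.arcMeasure ∧
      (ν * H.layerGrad φ z).re =
        ∫ ξ : H.boundary, φ ξ * (ν * greenKernel τ (z - ξ)).re ∂H.arcMeasure := by
  have hk := (H.integrable_smul_greenKernel hτ φ hz).const_mul ν
  have he : ∀ ξ : H.boundary, (ν * φ ξ • greenKernel τ (z - ξ)).re =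
      φ ξ * (ν * greenKernel τ (z - ξ)).re := fun ξ => by
    rw [mul_smul_comm, real_smul, re_ofReal_mul]
  simp only [← he]
  refine ⟨hk.re, ?_⟩
  rw [layerGrad, ← integral_const_mul]
  exact (reCLM.integral_comp_comm hk).symm

/-- The factor -1/(2π) of the singular part turns the jump -eπφ into eφ/2. The regular part of the
kernel is continuous across the boundary and completes the direct value to K*φ. -/
theorem tendsto_layerGrad (hτ : 0 < τ.im) (j : Fin M) (t₀ : ℝ) (φ : C(H.boundary, ℝ))
    {l : Filter ℂ} [l.IsCountablyGenerated] (hl : l ≤ 𝓝 (H.γ j t₀)) {α e : ℝ} (hα : 0 < α)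
    (he : e ^ 2 = 1) (h1 : ∀ᶠ z in l, ∀ ξ ∈ H.boundary, ‖z - H.γ j t₀‖ ≤ α * ‖z - ξ‖)
    (h2 : ∀ᶠ z in l, ‖(z - H.γ j t₀) / deriv (H.γ j) t₀‖ ≤
      α * (e * ((z - H.γ j t₀) / deriv (H.γ j) t₀).im))
    (h3 : ∀ᶠ z in l, z ≠ H.γ j t₀) :
    Tendsto (fun z => (H.normal (H.bdryPoint j t₀) * H.layerGrad φ z).re) l
      (𝓝 (e / 2 * φ (H.bdryPoint j t₀) + H.adjointDoubleLayer φ (H.bdryPoint j t₀))) := by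
  have hz₀ : H.γ j t₀ ∈ H.boundary := (H.bdryPoint j t₀).2
  have hreg := fun ξ hξ => H.boundary_sub_mem_regSet hτ hz₀ (ξ := ξ) hξ
  have hν := H.normal_eq j t₀
  rw [hν]
  set ν := unitNormal (H.γ j) t₀ with hν'
  have hF : ContinuousOn (fun w => (ν * greenKernelReg τ w).re) (regSet τ) :=
    continuous_re.comp_continuousOn (continuousOn_const.mul (continuousOn_greenKernelReg hτ))
  have hL := H.tendsto_integral_re_normal_inv hτ j t₀ φ hl hα he h1 h2 h3
  have hR := (H.continuousAt_integral_sub (isOpen_regSet hτ) hF φ H.arcMeasure hreg).tendsto.mono_left hl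
  have hsum := (hL.const_mul (-(1 / (2 * Real.pi)))).add hR
  have hiR : ∀ z : ℂ, (∀ ξ ∈ H.boundary, z - ξ ∈ regSet τ) →
      Integrable (fun ξ : H.boundary => φ ξ • (ν * greenKernelReg τ (z - ξ)).re) H.arcMeasure :=
    fun z hz => H.integrable_of_continuous (φ.continuous.smul (H.continuous_comp_sub hF hz)) _
  have hlim : e / 2 * φ (H.bdryPoint j t₀) + H.adjointDoubleLayer φ (H.bdryPoint j t₀) =
      -(1 / (2 * Real.pi)) * (∫ ξ : H.boundary, φ ξ * (ν * (H.γ j t₀ - (ξ : ℂ))⁻¹).re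
        ∂H.arcMeasure + -(e * Real.pi * φ (H.bdryPoint j t₀))) +
      ∫ ξ : H.boundary, φ ξ • (ν * greenKernelReg τ (H.γ j t₀ - ξ)).re ∂H.arcMeasure := by
    have hiL : Integrable (fun ξ : H.boundary => φ ξ * (ν * (H.γ j t₀ - (ξ : ℂ))⁻¹).re)
        H.arcMeasure := by
      have := ((H.integrable_normalKernel_mul hτ (H.bdryPoint j t₀) φ H.arcMeasure).sub
        (hiR _ hreg)).const_mul (-(2 * Real.pi))
      refine this.congr (.of_forall fun ξ => ?_)
      simp only [Pi.sub_apply, normalKernel_eq, hν]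
      have := Real.pi_ne_zero
      change -(2 * Real.pi) * ((-(1 / (2 * Real.pi)) * (ν * (H.γ j t₀ - (ξ : ℂ))⁻¹).re +
        (ν * greenKernelReg τ (H.γ j t₀ - ξ)).re) * φ ξ -
        φ ξ * (ν * greenKernelReg τ (H.γ j t₀ - ξ)).re) = _
      field_simp
      ring
    have e1 : H.adjointDoubleLayer φ (H.bdryPoint j t₀) =
        -(1 / (2 * Real.pi)) * ∫ ξ : H.boundary, φ ξ * (ν * (H.γ j t₀ - (ξ : ℂ))⁻¹).re ∂H.arcMeasure +
        ∫ ξ : H.boundary, φ ξ • (ν * greenKernelReg τ (H.γ j t₀ - ξ)).re ∂H.arcMeasure := by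
      rw [H.adjointDoubleLayer_eq hτ, ← integral_const_mul,
        ← integral_add (hiL.const_mul _) (hiR _ hreg)]
      refine integral_congr_ae (.of_forall fun ξ => ?_)
      simp only [normalKernel_eq, hν, smul_eq_mul]
      change (-(1 / (2 * Real.pi)) * (ν * (H.γ j t₀ - (ξ : ℂ))⁻¹).re +
        (ν * greenKernelReg τ (H.γ j t₀ - ξ)).re) * φ ξ = _
      ring
    have := Real.pi_ne_zero
    rw [e1]
    field_simp
    ring
  rw [hlim]
  refine hsum.congr' ?_
  obtain ⟨K, hKW, -, δ, hδ, hK⟩ := H.exists_compact_of_sub_mem (isOpen_regSet hτ) hreg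
  filter_upwards [h1, h3, hl (ball_mem_nhds _ hδ)] with z h1 h3 hz
  have hzr : ∀ ξ ∈ H.boundary, z - ξ ∈ regSet τ := fun ξ hξ => hKW (hK z hz ξ hξ)
  have hoff : z ∈ H.offBoundary := fun ξ hξ => (mem_latticeCompl_iff τ).2 ⟨fun h0 => by
    have := h1 ξ hξ
    rw [h0, norm_zero, mul_zero] at this
    exact h3 (sub_eq_zero.1 (norm_le_zero_iff.1 this)), hzr ξ hξ⟩
  have hkr := (H.re_mul_layerGrad hτ φ hoff ν).1
  have hiL : Integrable (fun ξ : H.boundary => φ ξ * (ν * (z - (ξ : ℂ))⁻¹).re) H.arcMeasure := by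
    refine ((hkr.sub (hiR z hzr)).const_mul (-(2 * Real.pi))).congr (.of_forall fun ξ => ?_)
    have := Real.pi_ne_zero
    simp only [Pi.sub_apply, re_mul_greenKernel, smul_eq_mul]
    field_simp
    ring
  rw [(H.re_mul_layerGrad hτ φ hoff ν).2, ← integral_const_mul,
    ← integral_add (hiL.const_mul _) (hiR z hzr)]
  refine integral_congr_ae (.of_forall fun ξ => ?_)
  simp only [re_mul_greenKernel, smul_eq_mul]
  ring

theorem unitNormal_div_deriv (j : Fin M) (t : ℝ) :
    unitNormal (H.γ j) t / deriv (H.γ j) t = -I * ((1 / ‖deriv (H.γ j) t‖ : ℝ) : ℂ) := by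
  have := H.deriv_γ_ne_zero j t
  rw [unitNormal]
  push_cast
  field_simp

/-- Along the normal the approach conditions hold with constant 1: by the tangent balls, z is a
nearest boundary point to the points of the segment. -/
theorem tendsto_layerGrad_normal (hτ : 0 < τ.im) (z : H.boundary) (φ : C(H.boundary, ℝ))
    {e : ℝ} (he : e ^ 2 = 1) :
    Tendsto (fun s : ℝ => (H.normal z * H.layerGrad φ (z + (-(e * s) : ℝ) * H.normal z)).re)
      (𝓝[>] 0) (𝓝 (e / 2 * φ z + H.adjointDoubleLayer φ z)) := by
  obtain ⟨⟨j, t⟩, rfl⟩ := H.exists_bdryPoint_eq z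
  obtain ⟨r, hr⟩ := H.exists_isTangentRadius hτ
  set F : ℝ → ℂ := fun s => H.γ j t + (-(e * s) : ℝ) * H.normal (H.bdryPoint j t) with hF
  have habs : |e| = 1 := by rw [← sq_eq_sq₀ (abs_nonneg e) zero_le_one, sq_abs, he, one_pow]
  have hl : map F (𝓝[>] 0) ≤ 𝓝 (H.γ j t) := by
    have : Continuous F := by fun_prop
    exact (this.tendsto' 0 _ (by simp [hF])).mono_left nhdsWithin_le_nhds
  have hsub : ∀ s, F s - H.γ j t = (-(e * s) : ℝ) * H.normal (H.bdryPoint j t) := fun s =>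
    add_sub_cancel_left _ _
  have hn : ∀ s : ℝ, 0 < s → ‖((-(e * s) : ℝ) : ℂ) * H.normal (H.bdryPoint j t)‖ = s := fun s hs => by
    rw [norm_mul, norm_normal, mul_one, norm_real, Real.norm_eq_abs, abs_neg, abs_mul, habs,
      one_mul, abs_of_pos hs]
  refine H.tendsto_layerGrad hτ j t φ hl one_pos he ?_ ?_ ?_ |>.comp tendsto_map
  · rw [eventually_map]
    filter_upwards [self_mem_nhdsWithin, nhdsWithin_le_nhds (Iio_mem_nhds hr.pos)] with s hs hsr ξ hξ
    have hs' : |(-(e * s))| = s := by rw [abs_neg, abs_mul, habs, one_mul, abs_of_pos hs]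
    have := hr.le_norm_sub (z := H.bdryPoint j t) (s := -(e * s)) (hs'.le.trans (le_of_lt hsr)) hξ
    rw [hsub, hn s hs, one_mul]
    rwa [hs'] at this
  · rw [eventually_map]
    filter_upwards [self_mem_nhdsWithin] with s hs
    have hs : 0 < s := hs
    have hd : 0 < ‖deriv (H.γ j) t‖ := norm_pos_iff.2 (H.deriv_γ_ne_zero j t)
    rw [hsub, normal_eq, mul_div_assoc, unitNormal_div_deriv]
    have : ((-(e * s) : ℝ) : ℂ) * (-I * ((1 / ‖deriv (H.γ j) t‖ : ℝ) : ℂ)) =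
        ((e * s / ‖deriv (H.γ j) t‖ : ℝ) : ℂ) * I := by
      push_cast
      ring
    rw [this, norm_mul, norm_I, mul_one, norm_real, im_ofReal_mul, I_im, mul_one]
    rw [Real.norm_eq_abs, abs_div, abs_mul, habs, abs_of_pos hs, abs_of_pos hd]
    refine le_of_eq ?_
    have : e * (e * s / ‖deriv (H.γ j) t‖) = e ^ 2 * s / ‖deriv (H.γ j) t‖ := by ring
    rw [this, he]
    ring
  · rw [eventually_map]
    filter_upwards [self_mem_nhdsWithin] with s hs h0
    have := hn s hs
    rw [← hsub, h0, sub_self, norm_zero] at this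
    exact (ne_of_gt hs) this.symm

/-- Nontangential approach regions in `Ω` lie in cones around the normal. -/
theorem eventually_cone (hτ : 0 < τ.im) (j : Fin M) (t : ℝ) {α : ℝ} (hα : 0 < α) :
    ∀ᶠ z in 𝓝 (H.γ j t), z ∈ H.domain → (∀ ξ ∈ H.boundary, ‖z - H.γ j t‖ ≤ α * ‖z - ξ‖) →
      ‖(z - H.γ j t) / deriv (H.γ j) t‖ ≤ 2 * α * ((z - H.γ j t) / deriv (H.γ j) t).im := by
  obtain ⟨r, hr⟩ := H.exists_isTangentRadius hτ
  obtain ⟨C, hC, hC'⟩ := H.exists_taylor_le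
  set a := deriv (H.γ j) t with ha
  have ha0 : a ≠ 0 := H.deriv_γ_ne_zero j t
  have hap : 0 < ‖a‖ := norm_pos_iff.2 ha0
  have hω : Tendsto (fun z => ‖(z - H.γ j t) / a‖) (𝓝 (H.γ j t)) (𝓝 0) := by
    have : Continuous fun z : ℂ => ‖(z - H.γ j t) / a‖ := by fun_prop
    exact this.tendsto' _ _ (by simp)
  -- The first smallness absorbs the Taylor remainder into half of the left side; the second is what
  -- places z in the inner tangent ball if Im ω < 0.
  filter_upwards [hω.eventually_lt_const (u := ‖a‖ / (2 * α * C)) (by positivity),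
    hω.eventually_lt_const (u := r / (α * ‖a‖)) (by have := hr.pos; positivity)] with z hz1 hz2 hz hcone
  set ω := (z - H.γ j t) / a with hωd
  have hzω : z = H.γ j t + a * ω := by
    rw [hωd]
    field_simp
    ring
  have hω0 : 0 < ‖ω‖ := by
    rw [norm_pos_iff]
    rintro h0
    rw [h0, mul_zero, add_zero] at hzω
    refine H.notMem_boundary_of_mem_domain hz ?_
    rw [hzω]
    exact (H.bdryPoint j t).2
  -- The test point γ(t + Re ω) has the tangential offset of z to first order, so only Im ω and a
  -- quadratic error remain.
  have h1 := hcone _ (H.bdryPoint j (t + ω.re)).2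
  change _ ≤ α * ‖z - H.γ j (t + ω.re)‖ at h1
  have h2 : ‖z - H.γ j (t + ω.re)‖ ≤ ‖a‖ * |ω.im| + C * ‖ω‖ ^ 2 := by
    have e1 : z - H.γ j (t + ω.re) = a * (ω.im * I) -
        (H.γ j (t + ω.re) - H.γ j t - ω.re * a) := by
      rw [hzω]
      nth_rw 1 [← re_add_im ω]
      ring
    rw [e1]
    refine (norm_sub_le _ _).trans (add_le_add (le_of_eq ?_) ((hC' j t ω.re).trans ?_))
    · rw [norm_mul, norm_mul, norm_I, mul_one, norm_real, Real.norm_eq_abs]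
    · have := abs_re_le_norm ω
      rw [← sq_abs ω.re]
      gcongr
  have h3 : ‖z - H.γ j t‖ = ‖a‖ * ‖ω‖ := by rw [hzω, add_sub_cancel_left, norm_mul]
  rw [lt_div_iff₀ (by positivity)] at hz1 hz2
  have h4 : ‖ω‖ ≤ 2 * α * |ω.im| := by
    have h5 : ‖a‖ * ‖ω‖ ≤ α * (‖a‖ * |ω.im| + C * ‖ω‖ ^ 2) := by
      rw [← h3]
      exact h1.trans (by gcongr)
    have h6 : α * (C * ‖ω‖ ^ 2) ≤ ‖a‖ * ‖ω‖ / 2 := by nlinarith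
    have h7 : ‖a‖ * ‖ω‖ ≤ ‖a‖ * (2 * α * |ω.im|) := by nlinarith
    exact le_of_mul_le_mul_left h7 hap
  -- If Im ω were negative, z would lie in the tangent ball inside the hole.
  suffices 0 ≤ ω.im by rwa [abs_of_nonneg this] at h4
  by_contra hneg
  rw [not_le] at hneg
  rw [abs_of_neg hneg] at h4
  refine H.notMem_D_of_mem_domain hz j (hr.tangentBall_subset_D j t ?_)
  rw [tangentBall, mem_ball, dist_eq_norm, abs_of_pos hr.pos, normal_eq]
  have e1 : z - (H.γ j t + r * unitNormal (H.γ j) t) = a * (ω + ((r / ‖a‖ : ℝ) : ℂ) * I) := by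
    rw [hzω, unitNormal]
    push_cast
    field_simp
    ring
  change ‖z - (H.γ j t + r * unitNormal (H.γ j) t)‖ < r
  rw [e1, ← sq_lt_sq₀ (norm_nonneg _) hr.pos.le, norm_mul, mul_pow]
  have e2 : ‖ω + ((r / ‖a‖ : ℝ) : ℂ) * I‖ ^ 2 = ‖ω‖ ^ 2 + 2 * (r / ‖a‖) * ω.im + (r / ‖a‖) ^ 2 := by
    rw [← normSq_eq_norm_sq, ← normSq_eq_norm_sq, normSq_apply, normSq_apply]
    simp only [add_re, add_im, re_ofReal_mul, im_ofReal_mul, I_re, I_im]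
    ring
  have e3 : ‖a‖ ^ 2 * (‖ω‖ ^ 2 + 2 * (r / ‖a‖) * ω.im + (r / ‖a‖) ^ 2) =
      ‖a‖ * (‖a‖ * ‖ω‖ ^ 2 + 2 * r * ω.im) + r ^ 2 := by
    field_simp
  rw [e2, e3]
  have h8 : ‖a‖ * ‖ω‖ ^ 2 + 2 * r * ω.im < 0 := by
    have h9 : α * (‖a‖ * ‖ω‖ ^ 2 + 2 * r * ω.im) < 0 := by
      have := mul_lt_mul_of_pos_right hz2 hω0
      have := mul_le_mul_of_nonneg_left h4 hr.pos.le
      nlinarith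
    exact neg_of_mul_neg_right h9 hα.le
  nlinarith

theorem tendsto_layerGrad_nontangential (hτ : 0 < τ.im) (z₀ : H.boundary) (φ : C(H.boundary, ℝ)) :
    Tendsto (fun z => (H.normal z₀ * H.layerGrad φ z).re) (H.nontangential z₀)
      (𝓝 (1 / 2 * φ z₀ + H.adjointDoubleLayer φ z₀)) := by
  obtain ⟨⟨j, t⟩, rfl⟩ := H.exists_bdryPoint_eq z₀
  refine tendsto_iSup.2 fun α => ?_
  have hpos : 0 < max α 1 := lt_max_of_lt_right one_pos
  have hc : ∀ z : ℂ, ‖z - H.γ j t‖ ≤ α * infDist z H.boundary →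
      ∀ ξ ∈ H.boundary, ‖z - H.γ j t‖ ≤ max α 1 * ‖z - ξ‖ := fun z hz ξ hξ => by
    refine hz.trans ?_
    rw [← dist_eq_norm]
    exact mul_le_mul (le_max_left _ _) (infDist_le_dist_of_mem hξ) infDist_nonneg hpos.le
  have h1 : ∀ᶠ z in 𝓝[{z | z ∈ H.domain ∧ ‖z - H.γ j t‖ ≤ α * infDist z H.boundary}] (H.γ j t),
      ∀ ξ ∈ H.boundary, ‖z - H.γ j t‖ ≤ 2 * max α 1 * ‖z - ξ‖ := by
    filter_upwards [self_mem_nhdsWithin] with z hz ξ hξ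
    refine (hc z hz.2 ξ hξ).trans ?_
    gcongr
    linarith
  refine H.tendsto_layerGrad hτ j t φ nhdsWithin_le_nhds (e := 1) (mul_pos two_pos hpos)
    (by norm_num) h1 ?_ ?_
  · filter_upwards [self_mem_nhdsWithin, nhdsWithin_le_nhds (H.eventually_cone hτ j t hpos)]
      with z hz h
    rw [one_mul]
    exact h hz.1 (hc z hz.2)
  · filter_upwards [self_mem_nhdsWithin] with z hz h0
    exact H.notMem_boundary_of_mem_domain hz.1 (h0 ▸ (H.bdryPoint j t).2)

/-- The outer normal segment lies in the approach region with α = 1. Without this, `limUnder` in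
`normalDeriv` would not be determined. -/
theorem neBot_nontangential (hτ : 0 < τ.im) (z₀ : H.boundary) : (H.nontangential z₀).NeBot := by
  obtain ⟨r, hr⟩ := H.exists_isTangentRadius hτ
  have h : Tendsto (fun s : ℝ => (z₀ : ℂ) + (-s : ℝ) * H.normal z₀) (𝓝[>] 0)
      (𝓝[{z | z ∈ H.domain ∧ ‖z - z₀‖ ≤ 1 * infDist z H.boundary}] (z₀ : ℂ)) := by
    refine tendsto_nhdsWithin_iff.2 ⟨?_, ?_⟩
    · refine Tendsto.mono_left (Continuous.tendsto' ?_ _ _ (by simp)) nhdsWithin_le_nhds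
      fun_prop
    · filter_upwards [self_mem_nhdsWithin, nhdsWithin_le_nhds (Iio_mem_nhds hr.pos)] with s hs hsr
      have hs : 0 < s := hs
      have hsr : s < r := hsr
      refine ⟨hr.tangentBall_neg_subset_domain z₀ (H.mem_tangentBall_neg hr.pos hs (by linarith)), ?_⟩
      rw [one_mul, add_sub_cancel_left, norm_mul, norm_normal, mul_one, norm_real]
      refine (le_infDist ⟨(z₀ : ℂ), z₀.2⟩).2 fun ξ hξ => ?_
      rw [dist_eq_norm]
      exact hr.le_norm_sub (by rw [abs_neg, abs_of_pos hs]; exact hsr.le) hξ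
  exact (h.neBot).mono (le_iSup (fun α : ℝ =>
    𝓝[{z | z ∈ H.domain ∧ ‖z - z₀‖ ≤ α * infDist z H.boundary}] (z₀ : ℂ)) 1)

end FinitelyConnectedTorus

/-! ### Compactness of K* -/

namespace FinitelyConnectedTorus

variable {τ : ℂ} {M : ℕ} (H : FinitelyConnectedTorus τ M)

theorem continuousAt_normalKernel (hτ : 0 < τ.im) {z ξ : H.boundary} (h : (z : ℂ) - ξ ≠ 0) :
    ContinuousAt (fun z => H.normalKernel z ξ) z := by
  have hm : (z : ℂ) - ξ ∈ latticeCompl τ := (mem_latticeCompl_iff τ).2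
    ⟨h, H.boundary_sub_mem_regSet hτ z.2 ξ.2⟩
  have h1 : ContinuousAt (fun w : H.boundary => greenKernel τ ((w : ℂ) - ξ)) z :=
    ((continuousOn_greenKernel hτ).continuousAt ((isOpen_latticeCompl hτ).mem_nhds hm)).comp
      (f := fun w : H.boundary => (w : ℂ) - ξ) (by fun_prop)
  exact continuous_re.continuousAt.comp (H.continuous_normal.continuousAt.mul h1)

theorem tendsto_integral_norm_normalKernel_sub (hτ : 0 < τ.im) (z₀ : H.boundary) :
    Tendsto (fun z => ∫ ξ, ‖H.normalKernel z ξ - H.normalKernel z₀ ξ‖ ∂H.arcMeasure) (𝓝 z₀)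
      (𝓝 0) := by
  obtain ⟨C, hC, h⟩ := H.exists_normalKernel_le hτ
  have : Tendsto (fun z => ∫ ξ, ‖H.normalKernel z ξ - H.normalKernel z₀ ξ‖ ∂H.arcMeasure) (𝓝 z₀)
      (𝓝 (∫ _ : H.boundary, (0 : ℝ) ∂H.arcMeasure)) := by
    refine tendsto_integral_filter_of_dominated_convergence (fun _ => C + C) (.of_forall fun z =>
      ((H.measurable_normalKernel hτ z).sub
        (H.measurable_normalKernel hτ z₀)).norm.aestronglyMeasurable)
      (.of_forall fun z => .of_forall fun ξ => ?_) (integrable_const _) ?_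
    · rw [norm_norm]
      exact (norm_sub_le _ _).trans (add_le_add (h z ξ) (h z₀ ξ))
    · filter_upwards [H.ae_ne z₀] with ξ hξ
      have := ((H.continuousAt_normalKernel hτ hξ).sub
        (continuousAt_const (y := H.normalKernel z₀ ξ))).norm.tendsto
      simpa using this
  simpa using this

theorem norm_integral_normalKernel_sub_le (hτ : 0 < τ.im) (φ : C(H.boundary, ℝ))
    (z z₀ : H.boundary) :
    ‖∫ ξ, H.normalKernel z ξ * φ ξ ∂H.arcMeasure - ∫ ξ, H.normalKernel z₀ ξ * φ ξ ∂H.arcMeasure‖ ≤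
      ‖φ‖ * ∫ ξ, ‖H.normalKernel z ξ - H.normalKernel z₀ ξ‖ ∂H.arcMeasure := by
  have h1 : ∀ z, Integrable (H.normalKernel z) H.arcMeasure := fun z => by
    simpa using H.integrable_normalKernel_mul hτ z (ContinuousMap.const _ 1) H.arcMeasure
  rw [← integral_sub (H.integrable_normalKernel_mul hτ z φ _)
    (H.integrable_normalKernel_mul hτ z₀ φ _), ← integral_const_mul]
  refine (norm_integral_le_integral_norm _).trans (integral_mono_of_nonneg
    (.of_forall fun _ => norm_nonneg _) (((h1 z).sub (h1 z₀)).norm.const_mul _)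
    (.of_forall fun ξ => ?_))
  dsimp only
  rw [← sub_mul, norm_mul, mul_comm]
  gcongr
  exact φ.norm_coe_le_norm ξ

/-- The kernel depends continuously on z in L¹, so the estimate is uniform over bounded sets of
densities. This gives continuity of K*φ and also equicontinuity. -/
theorem tendsto_integral_normalKernel (hτ : 0 < τ.im) (C : ℝ) (z₀ : H.boundary) :
    ∀ ε > 0, ∀ᶠ z in 𝓝 z₀, ∀ φ : C(H.boundary, ℝ), ‖φ‖ ≤ C →
      ‖∫ ξ, H.normalKernel z ξ * φ ξ ∂H.arcMeasure -
        ∫ ξ, H.normalKernel z₀ ξ * φ ξ ∂H.arcMeasure‖ < ε := by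
  intro ε hε
  have := (H.tendsto_integral_norm_normalKernel_sub hτ z₀).const_mul C
  rw [mul_zero] at this
  filter_upwards [this.eventually_lt_const hε] with z hz φ hφ
  refine (H.norm_integral_normalKernel_sub_le hτ φ z z₀).trans_lt (lt_of_le_of_lt ?_ hz)
  gcongr

theorem continuous_adjointDoubleLayer (hτ : 0 < τ.im) (φ : C(H.boundary, ℝ)) :
    Continuous (H.adjointDoubleLayer φ) := by
  rw [continuous_iff_continuousAt]
  intro z₀
  rw [ContinuousAt, Metric.tendsto_nhds]
  intro ε hε
  filter_upwards [H.tendsto_integral_normalKernel hτ ‖φ‖ z₀ ε hε] with z hz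
  rw [dist_eq_norm, H.adjointDoubleLayer_eq hτ, H.adjointDoubleLayer_eq hτ]
  exact hz φ le_rfl

theorem exists_norm_adjointDoubleLayer_le (hτ : 0 < τ.im) : ∃ C > 0, ∀ (φ : C(H.boundary, ℝ)) z,
    ‖H.adjointDoubleLayer φ z‖ ≤ C * ‖φ‖ := by
  obtain ⟨C, hC, h⟩ := H.exists_normalKernel_le hτ
  refine ⟨C * H.arcMeasure.real univ + 1, by positivity, fun φ z => ?_⟩
  rw [H.adjointDoubleLayer_eq hτ]
  refine (norm_integral_le_of_norm_le_const (C := C * ‖φ‖) (.of_forall fun ξ => ?_)).trans ?_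
  · rw [norm_mul]
    exact mul_le_mul (h z ξ) (φ.norm_coe_le_norm ξ) (norm_nonneg _) hC.le
  · nlinarith [norm_nonneg φ]

/-- `K*` as a bounded operator on the space of continuous functions on the boundary. -/
noncomputable def adjointOp (hτ : 0 < τ.im) : C(H.boundary, ℝ) →L[ℝ] C(H.boundary, ℝ) :=
  LinearMap.mkContinuousOfExistsBound
    { toFun := fun φ => ⟨H.adjointDoubleLayer φ, H.continuous_adjointDoubleLayer hτ φ⟩
      map_add' := fun φ ψ => by
        ext z
        simp only [ContinuousMap.coe_mk, ContinuousMap.add_apply, H.adjointDoubleLayer_eq hτ]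
        rw [← integral_add (H.integrable_normalKernel_mul hτ z φ _)
          (H.integrable_normalKernel_mul hτ z ψ _)]
        simp only [mul_add]
      map_smul' := fun c φ => by
        ext z
        simp only [ContinuousMap.coe_mk, ContinuousMap.smul_apply, H.adjointDoubleLayer_eq hτ,
          smul_eq_mul, RingHom.id_apply]
        rw [← integral_const_mul]
        simp only [mul_left_comm c] }
    (by
      obtain ⟨C, hC, h⟩ := H.exists_norm_adjointDoubleLayer_le hτ
      exact ⟨C, fun φ => (ContinuousMap.norm_le _ (by positivity)).2 (h φ)⟩)

/-- Arzelà–Ascoli: the image of the unit ball is uniformly bounded and equicontinuous. The isometry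
`e` passes to bounded continuous functions and back. -/
theorem isCompactOperator_adjointOp (hτ : 0 < τ.im) : IsCompactOperator (H.adjointOp hτ) := by
  obtain ⟨C, hC, h⟩ := H.exists_norm_adjointDoubleLayer_le hτ
  set e := ContinuousMap.isometryEquivBoundedOfCompact H.boundary ℝ
  set A := (e ∘ H.adjointOp hτ) '' closedBall 0 1
  have hA : IsCompact (closure A) := by
    refine BoundedContinuousFunction.arzela_ascoli (Icc (-C) C) isCompact_Icc A ?_ ?_
    · rintro _ z ⟨φ, hφ, rfl⟩
      have h1 := h φ z
      rw [mem_closedBall, dist_zero_right] at hφ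
      exact abs_le.1 (h1.trans (by nlinarith))
    · intro z₀
      rw [Metric.equicontinuousAt_iff_right]
      intro ε hε
      filter_upwards [H.tendsto_integral_normalKernel hτ 1 z₀ ε hε] with z hz
      rintro ⟨_, φ, hφ, rfl⟩
      rw [mem_closedBall, dist_zero_right] at hφ
      have := hz φ hφ
      rw [← H.adjointDoubleLayer_eq hτ, ← H.adjointDoubleLayer_eq hτ, norm_sub_rev] at this
      exact this
  refine (isCompactOperator_iff_image_closedBall_subset_compact
    (H.adjointOp hτ : C(H.boundary, ℝ) →ₗ[ℝ] C(H.boundary, ℝ)) one_pos).2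
    ⟨e.symm '' closure A, hA.image e.symm.continuous, ?_⟩
  rintro _ ⟨φ, hφ, rfl⟩
  exact ⟨e (H.adjointOp hτ φ), subset_closure ⟨φ, hφ, rfl⟩, e.symm_apply_apply _⟩

end FinitelyConnectedTorus

/-! ### Vanishing periods in the holes and the mean of K*φ on each curve -/

/-- By continuity Im(L w - L z) stays in (-π, π) near z, so there L w is L z plus the principal
logarithm of g w / g z. -/
theorem HasDerivAt.of_exp_eq {L g : ℂ → ℂ} {g' z : ℂ} (hL : ContinuousAt L z)
    (h : ∀ᶠ w in 𝓝 z, Complex.exp (L w) = g w) (hg : HasDerivAt g g' z) :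
    HasDerivAt L (g' / g z) z := by
  have hz : Complex.exp (L z) = g z := h.self_of_nhds
  have hg0 : g z ≠ 0 := hz ▸ Complex.exp_ne_zero _
  have h1 : HasDerivAt (fun w => L z + Complex.log (g w / g z)) (g' / g z) z := by
    have h2 := (hg.div_const (g z)).clog (by rw [div_self hg0]; exact one_mem_slitPlane)
    rw [div_self hg0, div_one] at h2
    exact h2.const_add _
  refine h1.congr_of_eventuallyEq ?_
  have h3 : Tendsto (fun w => (L w - L z).im) (𝓝 z) (𝓝 0) := by
    have : ContinuousAt (fun w => (L w - L z).im) z :=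
      continuous_im.continuousAt.comp (hL.sub continuousAt_const)
    simpa [ContinuousAt] using this
  have hpi := Real.pi_pos
  filter_upwards [h, h3.eventually_lt_const hpi, h3.eventually_const_lt (neg_lt_zero.2 hpi)]
    with w hw h4 h5
  rw [← hw, ← hz, ← Complex.exp_sub, Complex.log_exp h5 h4.le]
  ring

/-- The logarithmic derivative of a zero free holomorphic function has no periods in a simply
connected domain. -/
theorem integral_logDeriv_eq_zero {U : Set ℂ} (hU : IsSimplyConnected U) (hUo : IsOpen U)
    {g g' : ℂ → ℂ} (hg : ∀ z ∈ U, HasDerivAt g (g' z) z) (hg' : ContinuousOn g' U)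
    (h0 : ∀ z ∈ U, g z ≠ 0) {c c' : ℝ → ℂ} (hc : ∀ t, HasDerivAt c (c' t) t) (hc' : Continuous c')
    (hcU : ∀ t, c t ∈ U) (h01 : c 0 = c 1) :
    ∫ t in (0 : ℝ)..1, c' t * (g' (c t) / g (c t)) = 0 := by
  have hgc : ContinuousOn g U := fun z hz => (hg z hz).continuousAt.continuousWithinAt
  -- Simple connectedness yields a continuous logarithm of g; the integrand is the derivative of
  -- that logarithm along the closed curve.
  obtain ⟨L, hLc, hL⟩ := Complex.exists_continuousOn_eqOn_exp_comp hU hUo hgc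
    (by rintro ⟨z, hz, h⟩; exact h0 z hz h)
  have hcc : Continuous c := continuous_iff_continuousAt.2 fun t => (hc t).continuousAt
  have hd : ∀ t, HasDerivAt (fun t => L (c t)) (c' t * (g' (c t) / g (c t))) t := fun t => by
    have h1 := HasDerivAt.of_exp_eq (hLc.continuousAt (hUo.mem_nhds (hcU t)))
      (by filter_upwards [hUo.mem_nhds (hcU t)] with w hw using hL hw) (hg _ (hcU t))
    have := h1.comp_of_eq t (hc t) rfl
    rw [mul_comm]
    exact this
  have hcont : Continuous fun t => c' t * (g' (c t) / g (c t)) :=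
    hc'.mul ((hg'.comp_continuous hcc hcU).div (hgc.comp_continuous hcc hcU)
      fun t => h0 _ (hcU t))
  rw [intervalIntegral.integral_eq_sub_of_hasDerivAt (fun t _ => hd t)
    (hcont.intervalIntegrable _ _), h01, sub_self]

namespace FinitelyConnectedTorus

variable {τ : ℂ} {M : ℕ} (H : FinitelyConnectedTorus τ M)

/-- By Fubini it suffices to fix ξ on the boundary. Then ϑ₁(· - ξ) has no zero in the hole, so its
logarithmic derivative has no period, and the constant term of the gradient integrates to zero along
a closed curve. -/
theorem integral_layerGrad_eq_zero (hτ : 0 < τ.im) (φ : C(H.boundary, ℝ))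
    (hφ : ∫ ξ, φ ξ ∂H.arcMeasure = 0) (j : Fin M) {c c' : ℝ → ℂ}
    (hc : ∀ t, HasDerivAt c (c' t) t) (hc' : Continuous c') (hcD : ∀ t, c t ∈ H.D j)
    (h01 : c 0 = c 1) : ∫ t in (0 : ℝ)..1, c' t * H.layerGrad φ (c t) = 0 := by
  have hoff : ∀ t, c t ∈ H.offBoundary := fun t => H.D_subset_offBoundary hτ j (hcD t)
  have hcc : Continuous c := continuous_iff_continuousAt.2 fun t => (hc t).continuousAt
  have hθ := differentiable_jacobiThetaOne hτ
  have hlog : Continuous fun p : ℝ × H.boundary => logDeriv (jacobiThetaOne τ) (c p.1 - p.2) :=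
    (differentiableOn_logDeriv_jacobiThetaOne hτ).continuousOn.comp_continuous
      (by fun_prop) fun p => hoff p.1 p.2 p.2.2
  have hfc : Continuous fun p : ℝ × H.boundary =>
      c' p.1 * ((φ p.2 : ℂ) * logDeriv (jacobiThetaOne τ) (c p.1 - p.2)) :=
    (hc'.comp continuous_fst).mul
      ((continuous_ofReal.comp (φ.continuous.comp continuous_snd)).mul hlog)
  have hfub : ∫ t in (0 : ℝ)..1, ∫ ξ : H.boundary,
      c' t * ((φ ξ : ℂ) * logDeriv (jacobiThetaOne τ) (c t - ξ)) ∂H.arcMeasure = 0 := by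
    rw [intervalIntegral.integral_of_le zero_le_one, integral_integral_swap]
    · refine integral_eq_zero_of_ae (.of_forall fun ξ => ?_)
      have h1 := integral_logDeriv_eq_zero (H.simplyConnected_D j) (H.isOpen_D j)
        (g := fun z => jacobiThetaOne τ (z - ξ)) (g' := fun z => deriv (jacobiThetaOne τ) (z - ξ))
        (fun z _ => by
          have := (hθ (z - ξ)).hasDerivAt.comp z ((hasDerivAt_id z).sub_const (ξ : ℂ))
          simpa [Function.comp_def] using this)
        (((hθ.contDiff (n := 1)).continuous_deriv le_rfl).comp (by fun_prop)).continuousOn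
        (fun z hz h => by
          obtain ⟨m, n, h⟩ := (jacobiThetaOne_eq_zero_iff hτ).1 h
          exact (mem_latticeCompl hτ).1 (H.D_subset_offBoundary hτ j hz ξ ξ.2) m n h)
        hc hc' hcD h01
      dsimp only
      rw [← intervalIntegral.integral_of_le zero_le_one]
      simp only [mul_left_comm (c' _)]
      rw [intervalIntegral.integral_const_mul]
      simp only [logDeriv_apply]
      rw [h1, mul_zero, Pi.zero_apply]
    · obtain ⟨A, hA⟩ := (isCompact_Icc (a := (0 : ℝ)) (b := 1)).prod (isCompact_univ (X := H.boundary))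
        |>.exists_bound_of_continuousOn hfc.continuousOn
      refine Integrable.of_bound hfc.aestronglyMeasurable A ?_
      have : ∀ᵐ p ∂((volume.restrict (Ioc (0 : ℝ) 1)).prod H.arcMeasure), p.1 ∈ Ioc (0 : ℝ) 1 :=
        (Measure.quasiMeasurePreserving_fst).ae (ae_restrict_mem measurableSet_Ioc)
      filter_upwards [this] with p hp
      exact hA p ⟨Ioc_subset_Icc_self hp, mem_univ _⟩
  have hci : ∀ {f : ℝ → ℂ}, Continuous f → IntervalIntegrable f volume 0 1 :=
    fun hf => hf.intervalIntegrable _ _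
  set B := I / τ.im * ∫ ξ : H.boundary, (φ ξ : ℂ) * ((ξ : ℂ).im : ℂ) ∂H.arcMeasure
  have hlc : Continuous fun t => H.layerGrad φ (c t) :=
    (H.differentiableOn_layerGrad hτ φ hφ).continuousOn.comp_continuous hcc hoff
  have he : ∀ t, c' t * H.layerGrad φ (c t) = -(1 / (2 * Real.pi)) * (∫ ξ : H.boundary,
      c' t * ((φ ξ : ℂ) * logDeriv (jacobiThetaOne τ) (c t - ξ)) ∂H.arcMeasure) + c' t * B := by
    intro t
    rw [H.layerGrad_eq_of_mean_zero hτ φ hφ (hoff t), integral_const_mul]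
    simp only [smul_eq_mul]
    ring
  have h2 : ∫ t in (0 : ℝ)..1, c' t * B = 0 := by
    rw [intervalIntegral.integral_mul_const,
      intervalIntegral.integral_eq_sub_of_hasDerivAt (fun t _ => hc t) (hci hc'), h01, sub_self,
      zero_mul]
  have h3 : ∀ t, -(1 / (2 * Real.pi) : ℂ) * (∫ ξ : H.boundary,
      c' t * ((φ ξ : ℂ) * logDeriv (jacobiThetaOne τ) (c t - ξ)) ∂H.arcMeasure) =
      c' t * H.layerGrad φ (c t) - c' t * B := fun t => by rw [he t]; ring
  have h4 := congrArg (fun x => -(1 / (2 * Real.pi) : ℂ) * x) hfub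
  rw [← intervalIntegral.integral_const_mul, mul_zero] at h4
  simp only [h3] at h4
  rw [intervalIntegral.integral_sub (hci (f := fun t => c' t * H.layerGrad φ (c t)) (hc'.mul hlc))
    (hci (f := fun t => c' t * B) (hc'.mul continuous_const)), h2,
    sub_zero] at h4
  exact h4

theorem exists_greenKernelReg_le_of_near (hτ : 0 < τ.im) : ∃ δ > 0, ∃ C > 0,
    ∀ z : ℂ, ∀ z₀ ∈ H.boundary, ‖z - z₀‖ ≤ δ → ∀ ξ ∈ H.boundary,
      z - ξ ∈ regSet τ ∧ ‖greenKernelReg τ (z - ξ)‖ ≤ C := by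
  have hc : IsCompact ((fun p : ℂ × ℂ => p.1 - p.2) '' H.boundary ×ˢ H.boundary) :=
    (H.isCompact_boundary.prod H.isCompact_boundary).image (by fun_prop)
  obtain ⟨δ, hδ, h⟩ := hc.exists_cthickening_subset_open (isOpen_regSet hτ)
    (image_subset_iff.2 fun p hp => H.boundary_sub_mem_regSet hτ hp.1 hp.2)
  obtain ⟨C, hC⟩ := (hc.cthickening (r := δ)).exists_bound_of_continuousOn
    ((continuousOn_greenKernelReg hτ).mono h)
  refine ⟨δ, hδ, max C 1, by positivity, fun z z₀ hz₀ hz ξ hξ => ?_⟩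
  have hm : z - ξ ∈ cthickening δ ((fun p : ℂ × ℂ => p.1 - p.2) '' H.boundary ×ˢ H.boundary) := by
    refine mem_cthickening_of_dist_le _ (z₀ - ξ) _ _ ⟨(z₀, ξ), ⟨hz₀, hξ⟩, rfl⟩ ?_
    rwa [dist_sub_right, dist_eq_norm]
  exact ⟨h hm, (hC _ hm).trans (le_max_left _ _)⟩

end FinitelyConnectedTorus

namespace FinitelyConnectedTorus

variable {τ : ℂ} {M : ℕ} (H : FinitelyConnectedTorus τ M)

theorem mem_D_of_normal {r : ℝ} (hr : H.IsTangentRadius r) (j : Fin M) (t : ℝ) {s : ℝ} (hs : 0 < s)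
    (hsr : s ≤ r) : H.γ j t + s * H.normal (H.bdryPoint j t) ∈ H.D j :=
  hr.tangentBall_subset_D j t
    (H.mem_tangentBall (z := H.bdryPoint j t) hr.pos hs (by linarith [hr.pos]))

theorem add_normal_mem_offBoundary (hτ : 0 < τ.im) {r : ℝ} (hr : H.IsTangentRadius r)
    (z₀ : H.boundary) {s : ℝ} (hs : 0 < s) (hsr : s ≤ r) :
    (z₀ : ℂ) + s * H.normal z₀ ∈ H.offBoundary := by
  obtain ⟨⟨j, t⟩, rfl⟩ := H.exists_bdryPoint_eq z₀
  exact H.D_subset_offBoundary hτ j (H.mem_D_of_normal hr j t hs hsr)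

theorem le_norm_add_normal_sub {r : ℝ} (hr : H.IsTangentRadius r) (z₀ : H.boundary) {s : ℝ}
    (hs : 0 < s) (hsr : s ≤ r) {ξ : ℂ} (hξ : ξ ∈ H.boundary) :
    s ≤ ‖(z₀ : ℂ) + s * H.normal z₀ - ξ‖ := by
  have := hr.le_norm_sub (z := z₀) (s := s) (by rwa [abs_of_pos hs]) hξ
  rwa [abs_of_pos hs] at this

theorem norm_smul_normal (z₀ : H.boundary) {s : ℝ} (hs : 0 < s) : ‖(s : ℂ) * H.normal z₀‖ = s := by
  rw [norm_mul, norm_normal, mul_one, norm_real, Real.norm_of_nonneg hs.le]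

/-- With w = z₀ + sν - ξ the real part is (s - ν·(ξ - z₀))/|w|². Since s ≤ |w|, the first term is of
Poisson type; since |ξ - z₀| ≤ 2|w|, the second is bounded. -/
theorem exists_re_normal_mul_inv_le (hτ : 0 < τ.im) {r : ℝ} (hr : H.IsTangentRadius r) :
    ∃ C > 0, ∀ (z₀ : H.boundary) (s : ℝ), 0 < s → s ≤ r → ∀ ξ : H.boundary,
      |(H.normal z₀ * ((z₀ : ℂ) + s * H.normal z₀ - ξ)⁻¹).re| ≤
        C + 2 * (s / (s ^ 2 + ‖(z₀ : ℂ) + s * H.normal z₀ - ξ‖ ^ 2)) := by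
  obtain ⟨C, hC, h⟩ := H.exists_normal_le hτ
  refine ⟨4 * C, by positivity, fun z₀ s hs hsr ξ => ?_⟩
  have h1 := h z₀ ξ
  have h2 := H.le_norm_add_normal_sub hr z₀ hs hsr ξ.2
  set w := (z₀ : ℂ) + s * H.normal z₀ - ξ with hw
  have hw0 : 0 < ‖w‖ := hs.trans_le h2
  have e : (H.normal z₀ * w⁻¹).re =
      (s - (starRingEnd ℂ (H.normal z₀) * (ξ - z₀)).re) / ‖w‖ ^ 2 := by
    have e1 : (H.normal z₀ * w⁻¹).re = (starRingEnd ℂ (H.normal z₀) * w).re / ‖w‖ ^ 2 := by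
      rw [inv_def, ← normSq_eq_norm_sq]
      simp only [mul_re, mul_im, conj_re, conj_im, ofReal_re, ofReal_im]
      ring
    have e2 : starRingEnd ℂ (H.normal z₀) * w =
        s - starRingEnd ℂ (H.normal z₀) * (ξ - z₀) := by
      have e3 : starRingEnd ℂ (H.normal z₀) * H.normal z₀ = 1 := by
        rw [mul_comm, mul_conj, normSq_eq_norm_sq, norm_normal]
        simp
      calc _ = s * (starRingEnd ℂ (H.normal z₀) * H.normal z₀) -
            starRingEnd ℂ (H.normal z₀) * (ξ - z₀) := by rw [hw]; ring
        _ = _ := by rw [e3, mul_one]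
    rw [e1, e2, sub_re, ofReal_re]
  have h3 : ‖(ξ : ℂ) - z₀‖ ≤ 2 * ‖w‖ := by
    have e4 : (ξ : ℂ) - z₀ = s * H.normal z₀ - w := by rw [hw]; ring
    rw [e4]
    refine (norm_sub_le _ _).trans ?_
    rw [H.norm_smul_normal z₀ hs]
    linarith
  have h4 : C * ‖(ξ : ℂ) - z₀‖ ^ 2 ≤ C * (2 * ‖w‖) ^ 2 := by gcongr
  rw [e, abs_div, abs_of_pos (pow_pos hw0 2), div_le_iff₀ (pow_pos hw0 2)]
  have h5 : |s - (starRingEnd ℂ (H.normal z₀) * (ξ - z₀)).re| ≤ s + C * (2 * ‖w‖) ^ 2 := by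
    refine (abs_sub _ _).trans ?_
    rw [abs_of_pos hs]
    linarith
  have h6 : s ≤ 2 * (s / (s ^ 2 + ‖w‖ ^ 2)) * ‖w‖ ^ 2 := by
    rw [mul_assoc, div_mul_eq_mul_div, ← mul_div_assoc, le_div_iff₀ (by positivity)]
    have : s ^ 2 ≤ ‖w‖ ^ 2 := by gcongr
    nlinarith
  nlinarith

/-- A domination up to the boundary, needed to pass to the limit under the integral: the Poisson
type part of the kernel has bounded total mass. -/
theorem exists_re_normal_mul_layerGrad_le (hτ : 0 < τ.im) (φ : C(H.boundary, ℝ)) :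
    ∃ s₀ > 0, ∃ C > 0, ∀ (z₀ : H.boundary) (s : ℝ), 0 < s → s ≤ s₀ →
      |(H.normal z₀ * H.layerGrad φ (z₀ + s * H.normal z₀)).re| ≤ C := by
  obtain ⟨r, hr⟩ := H.exists_isTangentRadius hτ
  obtain ⟨A, hA, hA'⟩ := H.exists_re_normal_mul_inv_le hτ hr
  obtain ⟨δ, hδ, B, hB, hB'⟩ := H.exists_greenKernelReg_le_of_near hτ
  obtain ⟨P, hP⟩ := H.exists_lintegral_poisson_le
  refine ⟨min r δ, lt_min hr.pos hδ,
    ‖φ‖ * ((A + B) * H.arcMeasure.real univ + 2 * max P 0) + 1, by positivity, fun z₀ s hs hs₀ => ?_⟩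
  have hsr : s ≤ r := hs₀.trans (min_le_left _ _)
  have hsδ : s ≤ δ := hs₀.trans (min_le_right _ _)
  have hoff := H.add_normal_mem_offBoundary hτ hr z₀ hs hsr
  set z := (z₀ : ℂ) + s * H.normal z₀ with hz
  have hzn : ‖z - z₀‖ ≤ δ := by rwa [hz, add_sub_cancel_left, H.norm_smul_normal z₀ hs]
  have hpc : Continuous fun ξ : H.boundary => s / (s ^ 2 + ‖z - ξ‖ ^ 2) :=
    continuous_const.div (by fun_prop) fun ξ => by positivity
  have hpi := H.integrable_of_continuous hpc H.arcMeasure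
  have hpP : ∫ ξ : H.boundary, s / (s ^ 2 + ‖z - ξ‖ ^ 2) ∂H.arcMeasure ≤ max P 0 := by
    rw [integral_eq_lintegral_of_nonneg_ae (.of_forall fun ξ => by positivity)
      hpc.aestronglyMeasurable]
    exact ENNReal.toReal_le_of_le_ofReal (le_max_right _ _)
      ((hP z s hs).trans (ENNReal.ofReal_le_ofReal (le_max_left _ _)))
  have hk : ∀ ξ : H.boundary, ‖φ ξ * (H.normal z₀ * greenKernel τ (z - ξ)).re‖ ≤
      ‖φ‖ * ((A + B) + 2 * (s / (s ^ 2 + ‖z - ξ‖ ^ 2))) := fun ξ => by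
    rw [norm_mul]
    gcongr
    · exact φ.norm_coe_le_norm ξ
    · rw [re_mul_greenKernel, Real.norm_eq_abs]
      refine (abs_add_le _ _).trans ?_
      have h1 := hA' z₀ s hs hsr ξ
      rw [← hz] at h1
      have h2 : |(H.normal z₀ * greenKernelReg τ (z - ξ)).re| ≤ B :=
        (abs_re_mul_le_of_norm_eq_one (H.norm_normal z₀) _).trans (hB' z z₀ z₀.2 hzn ξ ξ.2).2
      have h3 : |-(1 / (2 * Real.pi)) * (H.normal z₀ * (z - ξ)⁻¹).re| ≤
          |(H.normal z₀ * (z - (ξ : ℂ))⁻¹).re| := by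
        rw [abs_mul, abs_neg, abs_of_pos (by positivity : 0 < 1 / (2 * Real.pi))]
        refine mul_le_of_le_one_left (abs_nonneg _) ?_
        rw [div_le_one (by positivity)]
        linarith [Real.pi_gt_three]
      linarith
  rw [(H.re_mul_layerGrad hτ φ hoff _).2, ← Real.norm_eq_abs]
  refine (norm_integral_le_of_norm_le (((integrable_const _).add (hpi.const_mul 2)).const_mul _)
    (.of_forall hk)).trans ?_
  rw [integral_const_mul, integral_add' (integrable_const _) (hpi.const_mul 2), integral_const,
    integral_const_mul, smul_eq_mul, mul_comm (H.arcMeasure.real univ)]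
  have : ‖φ‖ * ((A + B) * H.arcMeasure.real univ +
      2 * ∫ ξ : H.boundary, s / (s ^ 2 + ‖z - ξ‖ ^ 2) ∂H.arcMeasure) ≤
      ‖φ‖ * ((A + B) * H.arcMeasure.real univ + 2 * max P 0) := by gcongr
  linarith

/-- Since |z - ξ| ≥ s, the kernel 1/|z - ξ| is at most s^{-1/2}|z - ξ|^{-1/2}, and the last factor
is uniformly integrable. This crude rate suffices because the full gradient is only used with a
factor s. -/
theorem exists_norm_layerGrad_le (hτ : 0 < τ.im) (φ : C(H.boundary, ℝ)) :
    ∃ s₀ > 0, ∃ C > 0, ∀ (z₀ : H.boundary) (s : ℝ), 0 < s → s ≤ s₀ →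
      ‖H.layerGrad φ (z₀ + s * H.normal z₀)‖ ≤ C * (1 / √s) + C := by
  obtain ⟨r, hr⟩ := H.exists_isTangentRadius hτ
  obtain ⟨δ, hδ, B, hB, hB'⟩ := H.exists_greenKernelReg_le_of_near hτ
  obtain ⟨P, hP⟩ := H.exists_lintegral_sqrt_le
  refine ⟨min r δ, lt_min hr.pos hδ,
    max (‖φ‖ * max P 0) (‖φ‖ * (B * H.arcMeasure.real univ)) + 1, by positivity,
    fun z₀ s hs hs₀ => ?_⟩
  have hsr : s ≤ r := hs₀.trans (min_le_left _ _)
  have hsδ : s ≤ δ := hs₀.trans (min_le_right _ _)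
  have hfar := fun ξ : H.boundary => H.le_norm_add_normal_sub hr z₀ hs hsr ξ.2
  set z := (z₀ : ℂ) + s * H.normal z₀ with hz
  have hzn : ‖z - z₀‖ ≤ δ := by rwa [hz, add_sub_cancel_left, H.norm_smul_normal z₀ hs]
  have hpc : Continuous fun ξ : H.boundary => 2 * √(1 / ‖z - ξ‖) :=
    continuous_const.mul (Real.continuous_sqrt.comp (continuous_const.div (by fun_prop)
      fun ξ => (hs.trans_le (hfar ξ)).ne'))
  have hpi := H.integrable_of_continuous hpc H.arcMeasure
  have hpP : ∫ ξ : H.boundary, 2 * √(1 / ‖z - ξ‖) ∂H.arcMeasure ≤ max P 0 := by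
    rw [integral_eq_lintegral_of_nonneg_ae (.of_forall fun ξ => by positivity)
      hpc.aestronglyMeasurable]
    refine ENNReal.toReal_le_of_le_ofReal (le_max_right _ _)
      ((hP z 1 zero_le_one).trans (ENNReal.ofReal_le_ofReal ?_))
    rw [Real.sqrt_one, mul_one]
    exact le_max_left _ _
  have hk : ∀ ξ : H.boundary, ‖φ ξ • greenKernel τ (z - ξ)‖ ≤
      ‖φ‖ * (1 / √s * (2 * √(1 / ‖z - ξ‖)) + B) := fun ξ => by
    rw [norm_smul]
    gcongr
    · exact φ.norm_coe_le_norm ξ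
    · rw [greenKernel]
      refine (norm_add_le _ _).trans (add_le_add ?_ (hB' z z₀ z₀.2 hzn ξ ξ.2).2)
      have hw : 0 < ‖z - ξ‖ := hs.trans_le (hfar ξ)
      have h1 : √(1 / ‖z - ξ‖) ≤ 1 / √s := by
        rw [Real.sqrt_div zero_le_one, Real.sqrt_one]
        have := Real.sqrt_le_sqrt (hfar ξ)
        have := Real.sqrt_pos.2 hs
        gcongr
      have h2 : √(1 / ‖z - ξ‖) * √(1 / ‖z - ξ‖) = 1 / ‖z - ξ‖ := Real.mul_self_sqrt (by positivity)
      have h3 : ‖(-(1 / (2 * Real.pi)) : ℂ)‖ ≤ 1 := by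
        have : (-(1 / (2 * Real.pi)) : ℂ) = ((-(1 / (2 * Real.pi)) : ℝ) : ℂ) := by push_cast; rfl
        rw [this, norm_real, norm_neg, Real.norm_of_nonneg (by positivity),
          div_le_one (by positivity)]
        linarith [Real.pi_gt_three]
      rw [norm_mul, norm_inv, ← one_div]
      have h4 : 0 ≤ √(1 / ‖z - ξ‖) := Real.sqrt_nonneg _
      calc _ ≤ 1 * (1 / ‖z - ξ‖) := by gcongr
        _ = √(1 / ‖z - ξ‖) * √(1 / ‖z - ξ‖) := by rw [h2, one_mul]
        _ ≤ 1 / √s * (2 * √(1 / ‖z - ξ‖)) := by gcongr; linarith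
  refine (norm_integral_le_of_norm_le (((hpi.const_mul _).add (integrable_const _)).const_mul _)
    (.of_forall hk)).trans ?_
  rw [integral_const_mul, integral_add' (hpi.const_mul _) (integrable_const _), integral_const,
    integral_const_mul, smul_eq_mul, mul_comm (H.arcMeasure.real univ)]
  have hsq := Real.sqrt_pos.2 hs
  have e1 : ‖φ‖ * (1 / √s * ∫ ξ : H.boundary, 2 * √(1 / ‖z - ξ‖) ∂H.arcMeasure) ≤
      ‖φ‖ * (1 / √s * max P 0) := by gcongr
  have e2 : ‖φ‖ * max P 0 * (1 / √s) ≤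
      (max (‖φ‖ * max P 0) (‖φ‖ * (B * H.arcMeasure.real univ)) + 1) * (1 / √s) := by
    gcongr
    exact (le_max_left _ _).trans (le_add_of_nonneg_right zero_le_one)
  have e3 := le_max_right (‖φ‖ * max P 0) (‖φ‖ * (B * H.arcMeasure.real univ))
  linarith

theorem hasDerivAt_deriv_γ (j : Fin M) (t : ℝ) :
    HasDerivAt (deriv (H.γ j)) (deriv (deriv (H.γ j)) t) t := by
  have : ContDiff ℝ 1 (deriv (H.γ j)) := (contDiff_succ_iff_deriv (n := 1).1 (H.contDiff_γ j)).2.2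
  exact (this.differentiable one_ne_zero t).hasDerivAt

theorem continuous_deriv_deriv_γ (j : Fin M) : Continuous (deriv (deriv (H.γ j))) := by
  have : ContDiff ℝ 1 (deriv (H.γ j)) := (contDiff_succ_iff_deriv (n := 1).1 (H.contDiff_γ j)).2.2
  exact this.continuous_deriv le_rfl

/-- Displacing γ by s|γ'|ν = -isγ' gives a closed C¹ curve c in the hole. Then |γ'|ν = -iγ' = -ic' +
sγ''. The first term contributes nothing since the gradient has no periods, and the second
contributes O(s · s^{-1/2}) + O(s). -/
theorem exists_integral_normal_layerGrad_le (hτ : 0 < τ.im) (φ : C(H.boundary, ℝ))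
    (hφ : ∫ ξ, φ ξ ∂H.arcMeasure = 0) (j : Fin M) :
    ∃ C : ℝ, ∀ᶠ s in 𝓝[>] (0 : ℝ), ‖∫ t in (0 : ℝ)..1, ‖deriv (H.γ j) t‖ *
      (H.normal (H.bdryPoint j t) * H.layerGrad φ (H.γ j t +
        ((s * ‖deriv (H.γ j) t‖ : ℝ) : ℂ) * H.normal (H.bdryPoint j t))).re‖ ≤ C * (√s + s) := by
  obtain ⟨r, hr⟩ := H.exists_isTangentRadius hτ
  obtain ⟨s₁, hs₁, C, hC, hC'⟩ := H.exists_norm_layerGrad_le hτ φ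
  obtain ⟨A, hA, hA'⟩ := H.exists_deriv_le
  obtain ⟨a, ha, ha'⟩ := H.exists_deriv_ge
  obtain ⟨B, hB, hB'⟩ := (H.deriv_γ_periodic j).deriv_one.exists_norm_le
    (H.continuous_deriv_deriv_γ j)
  refine ⟨B * C * (1 / √a + 1), ?_⟩
  have hmin : 0 < min r s₁ / A := div_pos (lt_min hr.pos hs₁) hA
  filter_upwards [self_mem_nhdsWithin, nhdsWithin_le_nhds (Iio_mem_nhds hmin)] with s hs hsm
  have hs : 0 < s := hs
  have hσ : ∀ t, 0 < s * ‖deriv (H.γ j) t‖ := fun t => mul_pos hs (ha.trans_le (ha' j t))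
  have hσm : ∀ t, s * ‖deriv (H.γ j) t‖ ≤ min r s₁ := fun t =>
    (mul_le_mul_of_nonneg_left (hA' j t) hs.le).trans ((lt_div_iff₀ hA).1 hsm).le
  set c : ℝ → ℂ := fun t => H.γ j t + s * (-I * deriv (H.γ j) t) with hc
  set c' : ℝ → ℂ := fun t => deriv (H.γ j) t + s * (-I * deriv (deriv (H.γ j)) t) with hc'
  have hcν : ∀ t, c t = H.γ j t + ((s * ‖deriv (H.γ j) t‖ : ℝ) : ℂ) * H.normal (H.bdryPoint j t) :=
    fun t => by
      rw [normal_eq, hc, ofReal_mul, mul_assoc, mul_comm _ (unitNormal _ _), unitNormal_mul_norm]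
      exact H.deriv_γ_ne_zero j t
  have hcd : ∀ t, HasDerivAt c (c' t) t := fun t =>
    (((H.contDiff_γ j).differentiable (by norm_num) t).hasDerivAt).add
      (((H.hasDerivAt_deriv_γ j t).const_mul (-I)).const_mul (s : ℂ))
  have hc'c : Continuous c' := (H.continuous_deriv_γ j).add
    (continuous_const.mul (continuous_const.mul (H.continuous_deriv_deriv_γ j)))
  have hcD : ∀ t, c t ∈ H.D j := fun t => by
    rw [hcν]
    exact H.mem_D_of_normal hr j t (hσ t) ((hσm t).trans (min_le_left _ _))
  have hcc : Continuous c := continuous_iff_continuousAt.2 fun t => (hcd t).continuousAt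
  have hL : Continuous fun t => H.layerGrad φ (c t) :=
    (H.differentiableOn_layerGrad hτ φ hφ).continuousOn.comp_continuous hcc
      fun t => H.D_subset_offBoundary hτ j (hcD t)
  have h0 := H.integral_layerGrad_eq_zero hτ φ hφ j hcd hc'c hcD (by
    have h1 := H.periodic_γ j 0
    have h2 := H.deriv_γ_periodic j 0
    rw [zero_add] at h1 h2
    simp only [hc, h1, h2])
  have h1 : ∫ t in (0 : ℝ)..1, (-I * (c' t * H.layerGrad φ (c t))).re = 0 := by
    have h2 := reCLM.intervalIntegral_comp_comm (μ := volume) (a := 0) (b := 1)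
      (f := fun t => -I * (c' t * H.layerGrad φ (c t)))
      ((continuous_const.mul (hc'c.mul hL)).intervalIntegrable _ _)
    rw [intervalIntegral.integral_const_mul, h0, mul_zero, map_zero] at h2
    exact h2
  have h2 : ∀ t, ‖deriv (H.γ j) t‖ * (H.normal (H.bdryPoint j t) * H.layerGrad φ (c t)).re =
      (-I * (c' t * H.layerGrad φ (c t))).re +
        s * (deriv (deriv (H.γ j)) t * H.layerGrad φ (c t)).re := fun t => by
    rw [← re_ofReal_mul, ← re_ofReal_mul, ← add_re, ← mul_assoc, normal_eq,
      mul_comm _ (unitNormal _ _), unitNormal_mul_norm (H.deriv_γ_ne_zero j t)]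
    congr 1
    simp only [hc']
    linear_combination (-(s : ℂ) * deriv (deriv (H.γ j)) t * H.layerGrad φ (c t)) * I_mul_I
  have hi1 : Continuous fun t => (-I * (c' t * H.layerGrad φ (c t))).re :=
    continuous_re.comp (continuous_const.mul (hc'c.mul hL))
  have hi2 : Continuous fun t => s * (deriv (deriv (H.γ j)) t * H.layerGrad φ (c t)).re :=
    continuous_const.mul (continuous_re.comp ((H.continuous_deriv_deriv_γ j).mul hL))
  simp only [← hcν, h2]
  rw [intervalIntegral.integral_add (hi1.intervalIntegrable _ _) (hi2.intervalIntegrable _ _), h1,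
    zero_add]
  have hsq := Real.sqrt_pos.2 hs
  have hsqa := Real.sqrt_pos.2 ha
  refine (intervalIntegral.norm_integral_le_of_norm_le_const
    (C := s * (B * (C * (1 / (√s * √a)) + C))) fun t _ => ?_).trans ?_
  · rw [norm_mul, Real.norm_of_nonneg hs.le]
    gcongr
    refine (abs_re_le_norm _).trans ?_
    rw [norm_mul]
    gcongr
    · exact hB' t
    · rw [hcν]
      refine (hC' (H.bdryPoint j t) _ (hσ t) ((hσm t).trans (min_le_right _ _))).trans ?_
      rw [← Real.sqrt_mul hs.le]
      have := ha' j t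
      gcongr
  · rw [sub_zero, abs_one, mul_one]
    have e1 : s * (1 / (√s * √a)) = √s * (1 / √a) := by
      nth_rw 1 [← Real.mul_self_sqrt hs.le]
      field_simp
    have e2 : s * (B * (C * (1 / (√s * √a)) + C)) = B * C * (√s * (1 / √a) + s) := by
      rw [← e1]
      ring
    rw [e2, mul_assoc (B * C)]
    have : 0 ≤ 1 / √a := by positivity
    gcongr
    nlinarith

/-- On each boundary curve, `K*` is the multiplication by one half in the mean. -/
theorem holeIntegral_adjointDoubleLayer (hτ : 0 < τ.im) (φ : C(H.boundary, ℝ))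
    (hφ : ∫ ξ, φ ξ ∂H.arcMeasure = 0) (j : Fin M) :
    H.holeIntegral j (fun ξ => -1 / 2 * φ ξ + H.adjointDoubleLayer φ ξ) = 0 := by
  obtain ⟨C, hC⟩ := H.exists_integral_normal_layerGrad_le hτ φ hφ j
  obtain ⟨s₀, hs₀, B, hB, hB'⟩ := H.exists_re_normal_mul_layerGrad_le hτ φ
  obtain ⟨A, hA, hA'⟩ := H.exists_deriv_le
  obtain ⟨r, hr⟩ := H.exists_isTangentRadius hτ
  set F : ℝ → ℝ → ℝ := fun s t => ‖deriv (H.γ j) t‖ *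
      (H.normal (H.bdryPoint j t) * H.layerGrad φ (H.γ j t +
        ((s * ‖deriv (H.γ j) t‖ : ℝ) : ℂ) * H.normal (H.bdryPoint j t))).re with hF
  have hd : ∀ t, 0 < ‖deriv (H.γ j) t‖ := fun t => norm_pos_iff.2 (H.deriv_γ_ne_zero j t)
  have l1 : Tendsto (fun s => ∫ t in (0 : ℝ)..1, F s t) (𝓝[>] 0) (𝓝 0) := by
    refine squeeze_zero_norm' hC (Tendsto.mono_left (Continuous.tendsto' ?_ _ _ ?_)
      nhdsWithin_le_nhds)
    · fun_prop
    · simp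
  -- The same integrals converge to that of the inner normal derivative, by the jump relation with e
  -- = -1 and the bound on the normal component.
  have l2 : Tendsto (fun s => ∫ t in (0 : ℝ)..1, F s t) (𝓝[>] 0)
      (𝓝 (H.holeIntegral j (fun ξ => -1 / 2 * φ ξ + H.adjointDoubleLayer φ ξ))) := by
    have hm : 0 < min s₀ r / A := div_pos (lt_min hs₀ hr.pos) hA
    have hev : ∀ᶠ s : ℝ in 𝓝[>] 0, 0 < s ∧ ∀ t, s * ‖deriv (H.γ j) t‖ ≤ min s₀ r := by
      filter_upwards [self_mem_nhdsWithin, nhdsWithin_le_nhds (Iio_mem_nhds hm)] with s hs hsm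
      exact ⟨hs, fun t => (mul_le_mul_of_nonneg_left (hA' j t) (le_of_lt hs)).trans
        ((lt_div_iff₀ hA).1 hsm).le⟩
    refine intervalIntegral.tendsto_integral_filter_of_dominated_convergence (fun _ => A * B) ?_ ?_
      intervalIntegrable_const ?_
    · filter_upwards [hev] with s hs
      refine Continuous.aestronglyMeasurable ?_
      have hν : Continuous fun t => H.normal (H.bdryPoint j t) :=
        H.continuous_normal.comp (H.continuous_bdryPoint j)
      have hγ := H.continuous_deriv_γ j
      have hL := (H.differentiableOn_layerGrad hτ φ hφ).continuousOn.comp_continuous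
        (f := fun t => H.γ j t + ((s * ‖deriv (H.γ j) t‖ : ℝ) : ℂ) * H.normal (H.bdryPoint j t))
        ((H.contDiff_γ j).continuous.add
          ((continuous_ofReal.comp (continuous_const.mul hγ.norm)).mul hν))
        fun t => H.D_subset_offBoundary hτ j (H.mem_D_of_normal hr j t (mul_pos hs.1 (hd t))
          ((hs.2 t).trans (min_le_right _ _)))
      exact hγ.norm.mul (continuous_re.comp (hν.mul hL))
    · filter_upwards [hev] with s hs
      refine .of_forall fun t _ => ?_
      rw [hF, norm_mul, norm_norm]
      exact mul_le_mul (hA' j t) (hB' (H.bdryPoint j t) _ (mul_pos hs.1 (hd t))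
        ((hs.2 t).trans (min_le_left _ _))) (norm_nonneg _) hA.le
    · refine .of_forall fun t _ => ?_
      have h1 := H.tendsto_layerGrad_normal hτ (H.bdryPoint j t) φ (e := -1) (by norm_num)
      have h2 : Tendsto (fun s : ℝ => s * ‖deriv (H.γ j) t‖) (𝓝[>] 0) (𝓝[>] 0) := by
        refine tendsto_nhdsWithin_iff.2 ⟨Tendsto.mono_left
          (Continuous.tendsto' (by fun_prop) _ _ (by simp)) nhdsWithin_le_nhds, ?_⟩
        filter_upwards [self_mem_nhdsWithin] with s hs using mul_pos hs (hd t)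
      have h3 := (h1.comp h2).const_mul ‖deriv (H.γ j) t‖
      rw [mul_comm _ ‖deriv (H.γ j) t‖]
      refine h3.congr fun s => ?_
      simp only [hF, Function.comp_apply, neg_one_mul, neg_neg]
      rfl
  exact tendsto_nhds_unique l2 l1

end FinitelyConnectedTorus

/-! ### Maximum principle and boundary point lemma for harmonic functions -/

namespace InnerProductSpace

theorem HarmonicOnNhd.eq_of_eventually_eq {f : ℂ → ℝ} {S : Set ℂ} (hf : HarmonicOnNhd f S)
    (hS : IsPreconnected S) {w : ℂ} (hw : w ∈ S) (h : ∀ᶠ y in 𝓝 w, f y = f w) {y : ℂ}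
    (hy : y ∈ S) : f y = f w := by
  have h1 : AnalyticOnNhd ℝ f S := fun z hz => _root_.HarmonicAt.analyticAt (hf z hz)
  exact h1.eqOn_of_preconnected_of_eventuallyEq (g := fun _ => f w) (fun _ _ => analyticAt_const)
    hS hw h hy

/-- Locally f = Re F with F holomorphic, and |e^F| = e^f, so the maximum modulus principle applies
to e^F. -/
theorem HarmonicAt.eventually_eq_of_isLocalMax {f : ℂ → ℝ} {x : ℂ} (hf : HarmonicAt f x)
    (hmax : IsLocalMax f x) : ∀ᶠ y in 𝓝 x, f y = f x := by
  obtain ⟨r, hr, hb⟩ := Metric.eventually_nhds_iff_ball.1 hf.eventually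
  have hfb : HarmonicOnNhd f (ball x r) := hb
  obtain ⟨F, hF, hFe⟩ := hfb.exists_analyticOnNhd_ball_re_eq
  have hn : ∀ y ∈ ball x r, ‖Complex.exp (F y)‖ = Real.exp (f y) := fun y hy => by
    rw [Complex.norm_exp]
    exact congrArg Real.exp (hFe hy)
  have hm : IsLocalMax (norm ∘ fun y => Complex.exp (F y)) x := by
    filter_upwards [hmax, ball_mem_nhds x hr] with y hy hyb
    simp only [Function.comp_apply, hn y hyb, hn x (mem_ball_self hr)]
    exact Real.exp_le_exp.2 hy
  have := Complex.eventually_eq_of_isLocalMax_norm (by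
    filter_upwards [ball_mem_nhds x hr] with y hy using (hF y hy).differentiableAt.cexp) hm
  filter_upwards [this, ball_mem_nhds x hr] with y hy hyb
  have h1 := congrArg norm hy
  rw [hn y hyb, hn x (mem_ball_self hr)] at h1
  exact Real.exp_injective h1

/-- The lower Harnack inequality on a disk. -/
theorem HarmonicContOnCl.harnack_le {f : ℂ → ℝ} {c w : ℂ} {R : ℝ}
    (hf : HarmonicContOnCl f (ball c R)) (hw : w ∈ ball c R) (h0 : ∀ z ∈ sphere c R, 0 ≤ f z) :
    (R - ‖w - c‖) / (R + ‖w - c‖) * f c ≤ f w := by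
  have hR : 0 < R := pos_of_mem_ball hw
  have hsub : sphere c |R| ⊆ closure (ball c R) := by
    rw [closure_ball c hR.ne', abs_of_pos hR]
    exact sphere_subset_closedBall
  have hc : ContinuousOn f (sphere c |R|) := hf.continuousOn.mono hsub
  have hmean : Real.circleAverage f c R = f c := HarmonicContOnCl.circleAverage_eq (by rwa [abs_of_pos hR])
  have hk : ContinuousOn ((re ∘ herglotzRieszKernel c w) • f) (sphere c |R|) :=
    (continuous_re.comp_continuousOn (continuousOn_herglotzRieszKernel_sphere hw)).smul hc
  rw [← hf.circleAverage_re_herglotzRieszKernel_smul hw]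
  conv_lhs => rw [← hmean]
  rw [← smul_eq_mul, ← Real.circleAverage_smul]
  refine Real.circleAverage_mono (hc.const_smul _).circleIntegrable' hk.circleIntegrable'
    fun z hz => ?_
  rw [abs_of_pos hR] at hz
  exact mul_le_mul_of_nonneg_right (le_re_herglotzRieszKernel hz hw) (h0 z hz)

/-- A weak form of the Hopf boundary point lemma on a disk. -/
theorem HarmonicContOnCl.eq_zero_of_tendsto_deriv {f : ℂ → ℝ} {p n : ℂ} {R : ℝ} (hR : 0 < R)
    (hn : ‖n‖ = 1) (hf : HarmonicContOnCl f (ball (p + R * n) R))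
    (h0 : ∀ z ∈ sphere (p + R * n) R, 0 ≤ f z) (hp : f p = 0) {d : ℝ → ℝ}
    (hd : ∀ s ∈ Ioo 0 R, HasDerivAt (fun s : ℝ => f (p + s * n)) (d s) s)
    (hd0 : Tendsto d (𝓝[>] 0) (𝓝 0)) : f (p + R * n) ≤ 0 := by
  by_contra! hpos
  set c := p + R * n
  have hdist : ∀ s ∈ Icc 0 R, ‖p + (s : ℂ) * n - c‖ = R - s := fun s hs => by
    have : p + (s : ℂ) * n - c = ((s - R : ℝ) : ℂ) * n := by
      push_cast
      ring
    rw [this, norm_mul, hn, mul_one, norm_real, Real.norm_eq_abs, abs_sub_comm,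
      abs_of_nonneg (by linarith [hs.2])]
  have hcont : ContinuousOn (fun s : ℝ => f (p + s * n)) (Icc 0 R) := by
    refine hf.continuousOn.comp (by fun_prop) fun s hs => ?_
    rw [closure_ball c hR.ne', mem_closedBall, dist_eq_norm, hdist s hs]
    linarith [hs.1]
  -- Harnack gives f(p + sn) ≥ s f(c)/(2R - s) ≥ s f(c)/(2R), whereas a derivative below f(c)/(2R)
  -- near p gives a smaller value by the mean value theorem.
  have hk : 0 < f c / (2 * R) := by positivity
  obtain ⟨δ, hδ, hδ'⟩ := mem_nhdsGT_iff_exists_Ioo_subset.1 (hd0.eventually_lt_const hk)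
  have hδ : 0 < δ := hδ
  set s := min δ R / 2 with hs
  have hmin : 0 < min δ R := lt_min hδ hR
  have hs0 : 0 < s := by positivity
  have hsR : s < R := by linarith [min_le_right δ R]
  have hsδ : s < δ := by linarith [min_le_left δ R]
  obtain ⟨x, hx, hslope⟩ := exists_hasDerivAt_eq_slope (fun s : ℝ => f (p + s * n)) d hs0
    (hcont.mono (Icc_subset_Icc_right hsR.le))
    fun x hx => hd x ⟨hx.1, hx.2.trans hsR⟩
  have h1 : d x < f c / (2 * R) := hδ' ⟨hx.1, hx.2.trans hsδ⟩
  have hw : p + (s : ℂ) * n ∈ ball c R := by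
    rw [mem_ball, dist_eq_norm, hdist s ⟨hs0.le, hsR.le⟩]
    linarith
  have h2 := hf.harnack_le hw h0
  rw [hdist s ⟨hs0.le, hsR.le⟩] at h2
  simp only [ofReal_zero, zero_mul, add_zero, hp, sub_zero] at hslope
  have h3 : f (p + s * n) = d x * s := by
    rw [hslope]
    field_simp
  have h4 : s / (2 * R) * f c ≤ (R - (R - s)) / (R + (R - s)) * f c := by
    rw [sub_sub_cancel]
    gcongr
    linarith
  have h5 : s / (2 * R) * f c = f c / (2 * R) * s := by ring
  have h6 : d x * s < f c / (2 * R) * s := by gcongr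
  linarith

end InnerProductSpace

/-! ### Potentials with vanishing outer normal derivative -/

namespace FinitelyConnectedTorus

open InnerProductSpace

variable {τ : ℂ} {M : ℕ} (H : FinitelyConnectedTorus τ M)

theorem exists_mem_frontier_of_mem_closure {V : Set ℂ} (hV : V ⊆ H.domain) {p : ℂ}
    (hp : p ∈ closure V) (hpΩ : p ∉ H.domain) : ∃ m n, p + latticePoint τ m n ∈ H.boundary := by
  simp only [domain, mem_ofPred_eq, not_forall, not_not] at hpΩ
  obtain ⟨j, m, n, h⟩ := hpΩ
  refine ⟨m, n, H.frontier_subset_boundary j ⟨h, fun hi => ?_⟩⟩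
  rw [(H.isOpen_D j).interior_eq] at hi
  have ho : IsOpen ((fun z => z + latticePoint τ m n) ⁻¹' H.D j) :=
    (H.isOpen_D j).preimage (by fun_prop)
  obtain ⟨q, hq, hqV⟩ := mem_closure_iff.1 hp _ ho hi
  exact hV hqV j m n (subset_closure hq)

/-- A harmonic function on the torus domain that attains its supremum at a boundary point where it
has vanishing normal derivative is locally constant. -/
theorem eventually_eq_of_tendsto_layerGrad (hτ : 0 < τ.im) (φ : C(H.boundary, ℝ))
    (hφ : ∫ ξ, φ ξ ∂H.arcMeasure = 0)
    (h : ∀ z : H.boundary, 1 / 2 * φ z + H.adjointDoubleLayer φ z = 0) :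
    ∀ z ∈ H.domain, ∀ᶠ w in 𝓝 z, H.singleLayer φ w = H.singleLayer φ z := by
  obtain ⟨r, hr⟩ := H.exists_isTangentRadius hτ
  set u := H.singleLayer φ with hu
  have huc : Continuous u := H.continuous_singleLayer hτ φ
  have hharm : HarmonicOnNhd u H.domain :=
    (H.harmonicOnNhd_singleLayer hτ φ hφ).mono (H.domain_subset_offBoundary hτ)
  have hper : ∀ z m n, u (z + latticePoint τ m n) = u z :=
    H.singleLayer_add_latticePoint hτ φ
  -- By the identity theorem V contains every connected open subset of Ω that it meets, so it is a
  -- union of components. Connectedness of Ω need not be proved.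
  set V : Set ℂ := {z | z ∈ H.domain ∧ ¬ ∀ᶠ w in 𝓝 z, u w = u z} with hV
  have hVΩ : V ⊆ H.domain := fun z hz => hz.1
  have hsub : ∀ S : Set ℂ, IsOpen S → IsPreconnected S → S ⊆ H.domain → (S ∩ V).Nonempty →
      S ⊆ V := by
    rintro S hSo hSc hS ⟨v, hvS, hvV⟩ w hw
    refine ⟨hS hw, fun hev => hvV.2 ?_⟩
    have heq := fun y hy => (hharm.mono hS).eq_of_eventually_eq hSc hw hev (y := y) hy
    filter_upwards [hSo.mem_nhds hvS] with y hy
    rw [heq y hy, heq v hvS]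
  have hVper : ∀ z ∈ V, ∀ m n, z + latticePoint τ m n ∈ V := by
    refine fun z hz m n => ⟨H.add_latticePoint_mem_domain hz.1 m n, fun hev => hz.2 ?_⟩
    have ht : Tendsto (fun w => w + latticePoint τ m n) (𝓝 z) (𝓝 (z + latticePoint τ m n)) :=
      (by fun_prop : Continuous fun w => w + latticePoint τ m n).tendsto z
    filter_upwards [ht.eventually hev] with w hw
    rwa [hper, hper] at hw
  suffices hVe : V = ∅ by
    intro z hz
    by_contra hc
    exact (hVe ▸ (⟨hz, hc⟩ : z ∈ V) : z ∈ (∅ : Set ℂ))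
  rw [← not_nonempty_iff_eq_empty]
  rintro hne
  -- V and u are invariant under the lattice, so the supremum over the unbounded set V is controlled
  -- on a compact piece.
  have hK : IsCompact (closure V ∩ closedBall 0 (1 + ‖τ‖)) :=
    (isCompact_closedBall _ _).inter_left isClosed_closure
  have hmove : ∀ q ∈ V, ∃ q' ∈ closure V ∩ closedBall 0 (1 + ‖τ‖), u q' = u q := fun q hq => by
    obtain ⟨m, n, hmn⟩ := exists_mem_parallelogram hτ q
    exact ⟨_, ⟨subset_closure (hVper q hq m n), mem_closedBall_zero_iff.2 hmn⟩, hper q m n⟩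
  obtain ⟨q₀, hq₀⟩ := hne
  obtain ⟨p, ⟨hpV, -⟩, hpmax⟩ := hK.exists_isMaxOn
    (let ⟨q', hq', _⟩ := hmove q₀ hq₀; ⟨q', hq'⟩) huc.continuousOn
  have hmax : ∀ q ∈ V, u q ≤ u p := fun q hq => by
    obtain ⟨q', hq', e⟩ := hmove q hq
    rw [← e]
    exact hpmax hq'
  have hloc : ∀ q ∈ V, u q = u p → False := fun q hq hqp => by
    refine hq.2 ((hharm q hq.1).eventually_eq_of_isLocalMax ?_)
    obtain ⟨ε, hε, hb⟩ := Metric.isOpen_iff.1 (H.isOpen_domain hτ) q hq.1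
    have := hsub _ isOpen_ball (convex_ball q ε).isPreconnected hb ⟨q, mem_ball_self hε, hq⟩
    filter_upwards [ball_mem_nhds q hε] with w hw
    rw [hqp]
    exact hmax w (this hw)
  have hpΩ : p ∉ H.domain := fun hpΩ => by
    obtain ⟨ε, hε, hb⟩ := Metric.isOpen_iff.1 (H.isOpen_domain hτ) p hpΩ
    have := hsub _ isOpen_ball (convex_ball p ε).isPreconnected hb
      (mem_closure_iff.1 hpV _ isOpen_ball (mem_ball_self hε))
    exact hloc p (this (mem_ball_self hε)) rfl
  obtain ⟨m, n, hmn⟩ := H.exists_mem_frontier_of_mem_closure hVΩ hpV hpΩ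
  set z₀ : H.boundary := ⟨p + latticePoint τ m n, hmn⟩ with hz₀
  have hz₀V : (z₀ : ℂ) ∈ closure V :=
    map_mem_closure (f := fun w => w + latticePoint τ m n) (by fun_prop) hpV
      fun v hv => hVper v hv m n
  have huz₀ : u z₀ = u p := hper p m n
  have hTo : ∀ z : H.boundary, IsOpen (H.tangentBall z (-r)) := fun z => isOpen_ball
  -- A point of V close to z₀ lies in the outer tangent ball of a boundary point ξ close to z₀, so
  -- that ball is in V; its centre lies in the tangent ball at z₀ by continuity of the normal.
  have hT : H.tangentBall z₀ (-r) ⊆ V := by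
    refine hsub _ (hTo _) (H.isPreconnected_tangentBall _ _) (hr.tangentBall_neg_subset_domain z₀) ?_
    have hcen : ContinuousAt (fun ξ : H.boundary => (ξ : ℂ) + (-r : ℝ) * H.normal ξ) z₀ :=
      (continuous_subtype_val.add (continuous_const.mul H.continuous_normal)).continuousAt
    obtain ⟨δ, hδ, hδ'⟩ := Metric.continuousAt_iff.1 hcen r hr.pos
    obtain ⟨v, hvV, hv⟩ := Metric.mem_closure_iff.1 hz₀V (min (δ / 2) r) (by
      have := hr.pos
      positivity)
    rw [dist_comm, dist_eq_norm] at hv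
    obtain ⟨ξ, s, hs0, hsv, hvs⟩ := hr.nearest_mem_tangentBall (hVΩ hvV)
      (hv.trans_le (min_le_right _ _))
    have hsr : s < r := hsv.trans_lt (hv.trans_le (min_le_right _ _))
    have hξV := hsub _ (hTo ξ) (H.isPreconnected_tangentBall _ _)
      (hr.tangentBall_neg_subset_domain ξ) ⟨v, by
        rw [hvs]
        exact H.mem_tangentBall_neg hr.pos hs0 (by linarith), hvV⟩
    refine ⟨(ξ : ℂ) + (-r : ℝ) * H.normal ξ, ?_,
      hξV (IsTangentRadius.center_mem (H := H) (neg_ne_zero.2 hr.pos.ne'))⟩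
    rw [tangentBall, mem_ball, abs_neg, abs_of_pos hr.pos]
    refine hδ' ?_
    rw [Subtype.dist_eq, dist_eq_norm]
    have e : (ξ : ℂ) - z₀ = (v - z₀) + s * H.normal ξ := by
      rw [hvs]
      push_cast
      ring
    rw [e]
    refine (norm_add_le _ _).trans_lt ?_
    rw [H.norm_smul_normal ξ hs0]
    have := hv.trans_le (min_le_left _ _)
    linarith
  have hcV : (z₀ : ℂ) + (-r : ℝ) * H.normal z₀ ∈ V :=
    hT (IsTangentRadius.center_mem (H := H) (neg_ne_zero.2 hr.pos.ne'))
  have hball : H.tangentBall z₀ (-r) = ball ((z₀ : ℂ) + r * -H.normal z₀) r := by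
    rw [tangentBall, abs_neg, abs_of_pos hr.pos, ofReal_neg, neg_mul, mul_neg]
  have hcl : closure (ball ((z₀ : ℂ) + r * -H.normal z₀) r) ⊆ closure V :=
    hball ▸ closure_mono hT
  have hle : ∀ q ∈ closure V, u q ≤ u p := fun q hq =>
    closure_minimal (t := {q | u q ≤ u p}) hmax (isClosed_le huc continuous_const) hq
  -- The Hopf lemma for the nonnegative function u(p) - u shows that the maximum is also attained at
  -- the centre of the ball, a point of V, which the strong maximum principle forbids.
  have hfin := HarmonicContOnCl.eq_zero_of_tendsto_deriv (f := fun z => u p - u z) (p := z₀)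
    (n := -H.normal z₀) hr.pos (by rw [norm_neg, norm_normal])
    ⟨(harmonicOnNhd_const (u p)).sub (hharm.mono (hball ▸ hT.trans hVΩ)),
      (continuous_const.sub huc).continuousOn⟩
    (fun z hz => sub_nonneg.2 (hle z (hcl (by
      rw [closure_ball _ hr.pos.ne']
      exact sphere_subset_closedBall hz))))
    (sub_eq_zero.2 huz₀.symm)
    (d := fun s => (H.normal z₀ * H.layerGrad φ (z₀ + (-(1 * s) : ℝ) * H.normal z₀)).re)
    (fun s hs => ?_) ?_
  · refine hloc _ hcV (le_antisymm (hmax _ hcV) ?_)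
    have e : (z₀ : ℂ) + (-r : ℝ) * H.normal z₀ = z₀ + r * -H.normal z₀ := by
      push_cast
      ring
    rw [e]
    linarith
  · have hs2 : (z₀ : ℂ) + (-(1 * s) : ℝ) * H.normal z₀ ∈ H.offBoundary := by
      rw [one_mul]
      exact H.domain_subset_offBoundary hτ (hr.tangentBall_neg_subset_domain z₀
        (H.mem_tangentBall_neg hr.pos hs.1 (by linarith [hs.1, hs.2])))
    have hline : HasDerivAt (fun s : ℝ => (z₀ : ℂ) + s * -H.normal z₀) (-H.normal z₀) s := by
      simpa using ((hasDerivAt_id s).ofReal_comp.mul_const (-H.normal z₀)).const_add (z₀ : ℂ)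
    have e : (z₀ : ℂ) + s * -H.normal z₀ = z₀ + (-(1 * s) : ℝ) * H.normal z₀ := by
      push_cast
      ring
    have h1 := (H.hasFDerivAt_singleLayer hτ φ hs2).comp_hasDerivAt_of_eq s hline e.symm
    refine (h1.const_sub (u p)).congr_deriv ?_
    rw [reMulCLM_apply, mul_neg, neg_re, neg_neg, mul_comm]
  · have := H.tendsto_layerGrad_normal hτ z₀ φ (e := 1) (by norm_num)
    rwa [h z₀] at this

end FinitelyConnectedTorus

/-! ### Injectivity and the Fredholm alternative -/

/-- If the maximum over the closure exceeded a, the set where it is attained would lie in D and be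
open, closed and nonempty in the plane, contrary to boundedness. -/
theorem InnerProductSpace.HarmonicOnNhd.le_of_frontier {f : ℂ → ℝ} {D : Set ℂ}
    (hf : HarmonicOnNhd f D) (hD : IsOpen D) (hb : Bornology.IsBounded D)
    (hc : ContinuousOn f (closure D)) {a : ℝ} (ha : ∀ z ∈ frontier D, f z ≤ a) {z : ℂ}
    (hz : z ∈ D) : f z ≤ a := by
  by_contra! hlt
  have hK : IsCompact (closure D) := hb.isCompact_closure
  obtain ⟨p, hp, hmax⟩ := hK.exists_isMaxOn ⟨z, subset_closure hz⟩ hc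
  have hpa : a < f p := hlt.trans_le (hmax (subset_closure hz))
  set W := closure D ∩ f ⁻¹' {f p} with hW
  have hWD : W ⊆ D := fun q hq => by
    by_contra hqD
    have h1 := ha q ⟨hq.1, by rwa [hD.interior_eq]⟩
    have h2 : f q = f p := hq.2
    linarith
  have hclosed : IsClosed W := hc.preimage_isClosed_of_isClosed isClosed_closure isClosed_singleton
  have hopen : IsOpen W := isOpen_iff_mem_nhds.2 fun q hq => by
    have hq2 : f q = f p := hq.2
    have hl : IsLocalMax f q := by
      filter_upwards [hD.mem_nhds (hWD hq)] with w hw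
      rw [hq2]
      exact hmax (subset_closure hw)
    filter_upwards [(hf q (hWD hq)).eventually_eq_of_isLocalMax hl, hD.mem_nhds (hWD hq)]
      with w hw hwD
    exact ⟨subset_closure hwD, hw.trans hq2⟩
  rcases isClopen_iff.1 ⟨hclosed, hopen⟩ with h | h
  · exact (h ▸ (⟨hp, rfl⟩ : p ∈ W) : p ∈ (∅ : Set ℂ))
  · exact NormedSpace.unbounded_univ ℝ ℂ (hb.subset (h ▸ hWD))

/-- The Fredholm alternative for a compact operator on a closed invariant subspace. -/
theorem IsCompactOperator.exists_sub_smul_eq_of_mapsTo {X : Type*} [NormedAddCommGroup X]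
    [NormedSpace ℝ X] [CompleteSpace X] {T : X →L[ℝ] X} (hT : IsCompactOperator T)
    {V : Submodule ℝ X} (hV : IsClosed (V : Set X)) (hTV : ∀ x ∈ V, (T : X →ₗ[ℝ] X) x ∈ V) {μ : ℝ}
    (hμ : μ ≠ 0) (hinj : ∀ x ∈ V, T x = μ • x → x = 0) {g : X} (hg : g ∈ V) :
    ∃ x ∈ V, T x - μ • x = g := by
  have : CompleteSpace V := hV.completeSpace_coe
  have hcomp : IsCompactOperator ((T : X →ₗ[ℝ] X).restrict hTV) :=
    IsCompactOperator.restrict (f := (T : X →ₗ[ℝ] X)) hT hTV hV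
  set S : V →L[ℝ] V := ⟨(T : X →ₗ[ℝ] X).restrict hTV,
    Continuous.subtype_mk (T.continuous.comp continuous_subtype_val) _⟩
  have hS : IsCompactOperator S := hcomp
  have hSapp : ∀ x : V, (S x : X) = T x := fun _ => rfl
  -- For a compact operator a nonzero scalar that is not an eigenvalue belongs to the resolvent set.
  have hres : μ ∈ resolventSet ℝ S := by
    refine (hS.hasEigenvalue_or_mem_resolventSet hμ).resolve_left fun he => ?_
    obtain ⟨x, hx⟩ := he.exists_hasEigenvector
    have h1 : S x = μ • x := hx.apply_eq_smul
    refine hx.2 (Subtype.ext (hinj x x.2 ?_))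
    rw [← hSapp, h1]
    rfl
  obtain ⟨R, hR⟩ := (spectrum.mem_resolventSet_iff.1 hres).exists_right_inv
  have h1 : μ • R ⟨g, hg⟩ - S (R ⟨g, hg⟩) = ⟨g, hg⟩ := by
    rw [Algebra.algebraMap_eq_smul_one] at hR
    exact DFunLike.congr_fun hR ⟨g, hg⟩
  -- The sign arises because R inverts μ - T, not T - μ.
  refine ⟨-R ⟨g, hg⟩, V.neg_mem (R ⟨g, hg⟩).2, ?_⟩
  have h2 := congrArg Subtype.val h1
  simp only [AddSubgroupClass.coe_sub, Submodule.coe_smul, hSapp] at h2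
  simp only [map_neg, smul_neg]
  refine Eq.trans ?_ h2
  abel

namespace FinitelyConnectedTorus

open InnerProductSpace

variable {τ : ℂ} {M : ℕ} (H : FinitelyConnectedTorus τ M)

/-- Uniqueness of the solution of the boundary integral equation. -/
theorem eq_zero_of_half_add_adjointDoubleLayer (hτ : 0 < τ.im) (φ : C(H.boundary, ℝ))
    (hφ : ∫ ξ, φ ξ ∂H.arcMeasure = 0)
    (h : ∀ z : H.boundary, 1 / 2 * φ z + H.adjointDoubleLayer φ z = 0) : φ = 0 := by
  have hconst := H.eventually_eq_of_tendsto_layerGrad hτ φ hφ h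
  obtain ⟨r, hr⟩ := H.exists_isTangentRadius hτ
  set u := H.singleLayer φ with hu
  have huc : Continuous u := H.continuous_singleLayer hτ φ
  have hoff : HarmonicOnNhd u H.offBoundary := H.harmonicOnNhd_singleLayer hτ φ hφ
  ext z₀
  obtain ⟨⟨j, t₀⟩, rfl⟩ := H.exists_bdryPoint_eq z₀
  dsimp only
  have hr0 : -r ≠ 0 := neg_ne_zero.2 hr.pos.ne'
  set c : ℝ → ℂ := fun t => H.γ j t + (-r : ℝ) * H.normal (H.bdryPoint j t) with hc
  have hcc : Continuous c := (H.contDiff_γ j).continuous.add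
    (continuous_const.mul (H.continuous_normal.comp (H.continuous_bdryPoint j)))
  have hcT : ∀ t, c t ∈ H.tangentBall (H.bdryPoint j t) (-r) := fun t =>
    IsTangentRadius.center_mem (H := H) hr0
  have hTΩ := fun t => hr.tangentBall_neg_subset_domain (H.bdryPoint j t)
  -- The potential is constant on the outer tangent ball, and γ(t) is in the closure of that ball.
  -- The centres form a connected curve in Ω, so the boundary value does not depend on t.
  have hγc : ∀ t, u (H.γ j t) = u (c t) := fun t => by
    have h1 : ∀ w ∈ H.tangentBall (H.bdryPoint j t) (-r), u w = u (c t) := fun w hw =>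
      (hoff.mono ((hTΩ t).trans (H.domain_subset_offBoundary hτ))).eq_of_eventually_eq
        (H.isPreconnected_tangentBall _ _) (hcT t) (hconst _ (hTΩ t (hcT t))) hw
    exact closure_minimal (t := {w | u w = u (c t)}) h1 (isClosed_eq huc continuous_const)
      (H.mem_closure_tangentBall (H.bdryPoint j t) hr0)
  have hloc : IsLocallyConstant fun t => u (c t) :=
    (IsLocallyConstant.iff_eventually_eq _).2 fun t =>
      hcc.continuousAt.eventually (hconst _ (hTΩ t (hcT t)))
  have hfr : ∀ w ∈ frontier (H.D j), u w = u (c t₀) := fun w hw => by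
    rw [← H.range_γ j] at hw
    obtain ⟨t, rfl⟩ := hw
    rw [hγc]
    exact hloc.apply_eq_of_preconnectedSpace t t₀
  have hDharm : HarmonicOnNhd u (H.D j) := hoff.mono (H.D_subset_offBoundary hτ j)
  have hD : ∀ w ∈ H.D j, u w = u (c t₀) := fun w hw => by
    refine le_antisymm (hDharm.le_of_frontier (H.isOpen_D j) (H.isBounded_D j) huc.continuousOn
      (fun q hq => (hfr q hq).le) hw) ?_
    have := hDharm.neg.le_of_frontier (H.isOpen_D j) (H.isBounded_D j) huc.neg.continuousOn
      (a := -u (c t₀)) (fun q hq => (neg_le_neg (hfr q hq).ge)) hw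
    exact neg_le_neg_iff.1 this
  have hgrad : ∀ w ∈ H.D j, H.layerGrad φ w = 0 := fun w hw => by
    have h1 := (H.hasFDerivAt_singleLayer hτ φ (H.D_subset_offBoundary hτ j hw)).fderiv
    have h2 : u =ᶠ[𝓝 w] fun _ => u (c t₀) := by
      filter_upwards [(H.isOpen_D j).mem_nhds hw] with q hq using hD q hq
    rw [h2.fderiv_eq, fderiv_fun_const, Pi.zero_apply] at h1
    have h3 := DFunLike.congr_fun h1 (starRingEnd ℂ (H.layerGrad φ w))
    rw [reMulCLM_apply, mul_conj, ofReal_re] at h3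
    exact normSq_eq_zero.1 h3.symm
  -- The inner jump relation gives -½φ + K*φ = 0, because the potential is constant in the hole.
  -- Subtracting it from the hypothesis leaves φ = 0.
  have hlim := H.tendsto_layerGrad_normal hτ (H.bdryPoint j t₀) φ (e := -1) (by norm_num)
  have hzero : Tendsto (fun s : ℝ => (H.normal (H.bdryPoint j t₀) * H.layerGrad φ
      (H.bdryPoint j t₀ + (-(-1 * s) : ℝ) * H.normal (H.bdryPoint j t₀))).re) (𝓝[>] 0) (𝓝 0) := by
    refine tendsto_const_nhds.congr' ?_
    filter_upwards [self_mem_nhdsWithin, nhdsWithin_le_nhds (Iio_mem_nhds hr.pos)] with s hs hsr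
    rw [neg_one_mul, neg_neg]
    have := hgrad _ (H.mem_D_of_normal hr j t₀ hs (le_of_lt hsr))
    change 0 = (_ * H.layerGrad φ (H.γ j t₀ + _)).re
    rw [this, mul_zero, zero_re]
  have h1 := tendsto_nhds_unique hlim hzero
  have h2 := h (H.bdryPoint j t₀)
  rw [ContinuousMap.zero_apply]
  linarith

/-- The continuous functions of mean zero on the boundary. -/
noncomputable def meanZero : Submodule ℝ C(H.boundary, ℝ) where
  carrier := {φ | ∫ ξ, φ ξ ∂H.arcMeasure = 0}
  add_mem' {φ ψ} hφ hψ := by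
    have h1 := integral_add (H.integrable_of_continuous φ.continuous H.arcMeasure)
      (H.integrable_of_continuous ψ.continuous H.arcMeasure)
    rw [mem_ofPred_eq] at hφ hψ ⊢
    rw [hφ, hψ, add_zero] at h1
    exact h1
  zero_mem' := by simp
  smul_mem' c φ hφ := by
    have h1 := integral_const_mul (μ := H.arcMeasure) c φ
    rw [mem_ofPred_eq] at hφ ⊢
    rw [hφ, mul_zero] at h1
    exact h1

theorem mem_meanZero {φ : C(H.boundary, ℝ)} : φ ∈ H.meanZero ↔ ∫ ξ, φ ξ ∂H.arcMeasure = 0 := Iff.rfl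

theorem isClosed_meanZero : IsClosed (H.meanZero : Set C(H.boundary, ℝ)) := by
  have : Continuous fun φ : C(H.boundary, ℝ) => ∫ ξ, φ ξ ∂H.arcMeasure := by
    refine (LipschitzWith.of_dist_le' (K := H.arcMeasure.real univ) fun φ ψ => ?_).continuous
    rw [dist_eq_norm, ← integral_sub (H.integrable_of_continuous φ.continuous H.arcMeasure)
      (H.integrable_of_continuous ψ.continuous H.arcMeasure), mul_comm]
    exact norm_integral_le_of_norm_le_const
      (.of_forall fun ξ => by rw [← dist_eq_norm]; exact ContinuousMap.dist_apply_le_dist ξ)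
  exact isClosed_eq this continuous_const

theorem holeIntegral_adjointDoubleLayer_eq (hτ : 0 < τ.im) (φ : C(H.boundary, ℝ))
    (hφ : ∫ ξ, φ ξ ∂H.arcMeasure = 0) (j : Fin M) :
    H.holeIntegral j (H.adjointDoubleLayer φ) = 1 / 2 * H.holeIntegral j φ := by
  have h := H.holeIntegral_adjointDoubleLayer hτ φ hφ j
  have hK := H.continuous_adjointDoubleLayer hτ φ
  have i1 := H.integrable_of_continuous φ.continuous (H.holeMeasure j)
  have i2 := H.integrable_of_continuous hK (H.holeMeasure j)
  rw [H.holeIntegral_eq j ((i1.const_mul _).fun_add i2).aestronglyMeasurable,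
    integral_add (i1.const_mul _) i2, integral_const_mul] at h
  rw [H.holeIntegral_eq j i1.aestronglyMeasurable, H.holeIntegral_eq j i2.aestronglyMeasurable]
  linarith

/-- On each curve K* halves the integral, so a total of zero is preserved. -/
theorem adjointOp_mem_meanZero (hτ : 0 < τ.im) :
    ∀ φ ∈ H.meanZero, (H.adjointOp hτ : C(H.boundary, ℝ) →ₗ[ℝ] C(H.boundary, ℝ)) φ ∈
      H.meanZero := by
  intro φ hφ
  have e : ∀ ψ : C(H.boundary, ℝ), ∫ ξ, ψ ξ ∂H.arcMeasure = ∑ j, H.holeIntegral j ψ := fun ψ =>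
    (H.bdryIntegral_eq (H.integrable_of_continuous ψ.continuous _)).symm
  rw [mem_meanZero, e] at hφ ⊢
  have h1 : ∀ j, H.holeIntegral j (H.adjointOp hτ φ) = 1 / 2 * H.holeIntegral j φ :=
    H.holeIntegral_adjointDoubleLayer_eq hτ φ (by rw [e, hφ])
  calc ∑ j, H.holeIntegral j (H.adjointOp hτ φ) = 1 / 2 * ∑ j, H.holeIntegral j φ := by
        rw [Finset.mul_sum]
        exact Finset.sum_congr rfl fun j _ => h1 j
    _ = 0 := by rw [hφ, mul_zero]

/-- Existence of a solution of the boundary integral equation. -/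
theorem exists_half_add_adjointDoubleLayer_eq (hτ : 0 < τ.im) (g : C(H.boundary, ℝ))
    (hg : ∫ ξ, g ξ ∂H.arcMeasure = 0) : ∃ φ : C(H.boundary, ℝ), ∫ ξ, φ ξ ∂H.arcMeasure = 0 ∧
      ∀ z, 1 / 2 * φ z + H.adjointDoubleLayer φ z = g z := by
  obtain ⟨φ, h1, h2⟩ := (H.isCompactOperator_adjointOp hτ).exists_sub_smul_eq_of_mapsTo
    H.isClosed_meanZero (H.adjointOp_mem_meanZero hτ) (μ := -(1 / 2)) (by norm_num)
    (fun φ hφ h => H.eq_zero_of_half_add_adjointDoubleLayer hτ φ hφ fun z => by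
      have h3 : H.adjointDoubleLayer φ z = -(1 / 2) * φ z := DFunLike.congr_fun h z
      rw [h3]
      ring) hg
  refine ⟨φ, h1, fun z => ?_⟩
  have h3 : H.adjointDoubleLayer φ z - -(1 / 2) * φ z = g z := DFunLike.congr_fun h2 z
  linarith

theorem hasNormalDeriv_singleLayer (hτ : 0 < τ.im) (φ : C(H.boundary, ℝ)) (C : ℝ)
    (z₀ : H.boundary) : H.HasNormalDeriv (fun z => H.singleLayer φ z + C)
      (1 / 2 * φ z₀ + H.adjointDoubleLayer φ z₀) z₀ := by
  refine (H.tendsto_layerGrad_nontangential hτ z₀ φ).congr' ?_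
  refine eventually_iSup.2 fun α => ?_
  filter_upwards [self_mem_nhdsWithin] with z hz
  have h1 := (H.hasFDerivAt_singleLayer hτ φ
    (H.domain_subset_offBoundary hτ hz.1)).add_const C
  rw [h1.fderiv, reMulCLM_apply, mul_comm]

end FinitelyConnectedTorus

/-! ### Solution of the Neumann problem -/

theorem mainTheorem2 (τ : ℂ) (hτ : 0 < τ.im) (M : ℕ) (H : FinitelyConnectedTorus τ M)
    (g : C(H.boundary, ℝ)) (hg : H.bdryIntegral g = 0) :
    -- the principal values that define `K*` exist
    (∀ (φ : C(H.boundary, ℝ)) (z₀ : H.boundary),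
      Tendsto (H.truncatedAdjoint φ z₀) (𝓝[>] (0 : ℝ)) (𝓝 (H.adjointDoubleLayer φ z₀))) ∧
    (∃! φ : C(H.boundary, ℝ), H.IsDensity g φ) ∧
    ∀ φ : C(H.boundary, ℝ), H.IsDensity g φ →
      (∀ C : ℝ, H.IsNeumannSolution g (fun z => H.singleLayer φ z + C)) ∧
      (∀ j : Fin M, H.holeIntegral j φ = H.holeIntegral j g) ∧
      (∀ (C : ℝ) (j : Fin M),
        H.flux (fun z => H.singleLayer φ z + C) j = H.holeIntegral j φ) := by
  have hmean : ∀ φ : C(H.boundary, ℝ), H.bdryIntegral φ = ∫ ξ, φ ξ ∂H.arcMeasure := fun φ =>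
    H.bdryIntegral_eq (H.integrable_of_continuous φ.continuous _)
  refine ⟨fun φ z₀ => H.tendsto_truncatedAdjoint hτ φ z₀, ?_, fun φ hφ => ?_⟩
  · obtain ⟨φ, h1, h2⟩ := H.exists_half_add_adjointDoubleLayer_eq hτ g (by rw [← hmean, hg])
    refine ⟨φ, ⟨by rw [hmean, h1], h2⟩, fun ψ hψ => ?_⟩
    have h3 : ∫ ξ, ψ ξ ∂H.arcMeasure = 0 := by rw [← hmean, hψ.mean_zero]
    refine sub_eq_zero.1 (H.eq_zero_of_half_add_adjointDoubleLayer hτ (ψ - φ)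
      (H.meanZero.sub_mem h3 h1) fun z => ?_)
    have h4 : H.adjointDoubleLayer (ψ - φ : C(H.boundary, ℝ)) z =
        H.adjointDoubleLayer ψ z - H.adjointDoubleLayer φ z :=
      DFunLike.congr_fun (map_sub (H.adjointOp hτ) ψ φ) z
    rw [h4, ContinuousMap.sub_apply]
    linarith [hψ.equation z, h2 z]
  · have h0 : ∫ ξ, φ ξ ∂H.arcMeasure = 0 := by rw [← hmean, hφ.mean_zero]
    have hd : ∀ (C : ℝ) (z₀ : H.boundary),
        H.HasNormalDeriv (fun z => H.singleLayer φ z + C) (g z₀) z₀ := fun C z₀ => by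
      rw [← hφ.equation z₀]
      exact H.hasNormalDeriv_singleLayer hτ φ C z₀
    -- Integrating the equation over ∂D_j: half of the integral of φ comes from ½φ and the other
    -- half from K*φ.
    have hflux : ∀ j, H.holeIntegral j φ = H.holeIntegral j g := fun j => by
      have hK := H.continuous_adjointDoubleLayer hτ φ
      have i1 := H.integrable_of_continuous φ.continuous (H.holeMeasure j)
      have i2 := H.integrable_of_continuous hK (H.holeMeasure j)
      have e := H.holeIntegral_adjointDoubleLayer_eq hτ φ h0 j
      have hg' : (g : H.boundary → ℝ) = fun z => 1 / 2 * φ z + H.adjointDoubleLayer φ z :=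
        funext fun z => (hφ.equation z).symm
      rw [H.holeIntegral_eq j i1.aestronglyMeasurable, H.holeIntegral_eq j i2.aestronglyMeasurable]
        at e
      rw [hg', H.holeIntegral_eq j i1.aestronglyMeasurable,
        H.holeIntegral_eq j ((i1.const_mul _).fun_add i2).aestronglyMeasurable,
        integral_add (i1.const_mul _) i2, integral_const_mul]
      linarith
    refine ⟨fun C => ⟨fun z m n => ?_, ?_, ?_, hd C⟩, hflux, fun C j => ?_⟩
    · rw [H.singleLayer_add_latticePoint hτ]
    · exact ((H.harmonicOnNhd_singleLayer hτ φ h0).mono (H.domain_subset_offBoundary hτ)).add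
        (InnerProductSpace.harmonicOnNhd_const C)
    · exact ((H.continuous_singleLayer hτ φ).add continuous_const).continuousOn
    · have e : H.normalDeriv (fun z => H.singleLayer φ z + C) = g := funext fun z₀ => by
        have := H.neBot_nontangential hτ z₀
        exact (hd C z₀).limUnder_eq
      rw [FinitelyConnectedTorus.flux, e, hflux j]
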